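/- An instance of fair division of $m\ge 0$ divisible chores among $n\ge 1$ agents is given by costs $c_{ij}\ge 0$ of chore $j$ for agent $i$. It is bivalued if there are real numbers $a,b>0$ with $c_{ij}\in\{a,b\}$ for all $i,j$. A fractional allocation is a matrix $x\in[0,1]^{n\times m}$ with $\sum_i x_{ij}=1$ for every chore $j$; agent $i$ has cost $c_i(x_h)=\sum_j c_{ij}x_{hj}$ for the bundle of agent $h$. The allocation $x$ is envy-free if $c_i(x_i)\le c_i(x_h)$ for all agents $i,h$, and fractionally Pareto-optimal if there is no fractional allocation $y$ with $c_i(y_i)\le c_i(x_i)$ for all $i$ and $c_h(y_h)<c_h(x_h)$ for some $h$. **Theorem.** Given a bivalued instance of divisible chores with all $c_{ij}\in\{a,b\}$ for some real $a,b>0$, an allocation that is both envy-free and fractionally Pareto-optimal exists and can be computed in strongly polynomial time. That is, there is a single algorithm, on a random access machine that stores real numbers and performs the operations $+,-,\times,/$ and comparison on them, which on input $n$, $m$ and the matrix $(c_{ij})$ of any bivalued instance outputs such an allocation; the number of its steps (arithmetic operations included) is bounded by a polynomial in $n$ and $m$; and if all $c_{ij}$ are rational, all numbers occurring in the computation are rational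 with binary encoding length bounded by a polynomial in $n$, $m$ and the encoding length of the input. -/

import Mathlib

open scoped BigOperators

/-! ## Fair division of divisible chores -/

namespace Chores

/-- A fractional allocation of `m` divisible chores to `n` agents: `x i j ∈ [0,1]` is the fraction
of chore `j` given to agent `i`, and every chore is given out completely. -/
def IsAllocation {n m : ℕ} (x : Fin n → Fin m → ℝ) : Prop :=
  (∀ i j, 0 ≤ x i j ∧ x i j ≤ 1) ∧ ∀ j, ∑ i, x i j = 1

/-- Additive cost of a bundle `z` (with fractions `z j`) for an agent whose costs are `d`. -/
def bundleCost {m : ℕ} (d : Fin m → ℝ) (z : Fin m → ℝ) : ℝ := ∑ j, d j * z j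

/-- No agent strictly prefers the bundle of another agent. -/
def EnvyFree {n m : ℕ} (c x : Fin n → Fin m → ℝ) : Prop :=
  ∀ i h, bundleCost (c i) (x i) ≤ bundleCost (c i) (x h)

/-- `y` dominates `x`: no agent is worse off and some agent is strictly better off. -/
def Dominates {n m : ℕ} (c y x : Fin n → Fin m → ℝ) : Prop :=
  (∀ i, bundleCost (c i) (y i) ≤ bundleCost (c i) (x i)) ∧
    ∃ h, bundleCost (c h) (y h) < bundleCost (c h) (x h)

/-- Fractional Pareto optimality: no fractional allocation dominates `x`. -/
def FracParetoOptimal {n m : ℕ} (c x : Fin n → Fin m → ℝ) : Prop :=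
  ∀ y : Fin n → Fin m → ℝ, IsAllocation y → ¬ Dominates c y x

/-- All costs lie in a set `{a, b}` with `a, b > 0`. -/
def Bivalued {n m : ℕ} (c : Fin n → Fin m → ℝ) : Prop :=
  ∃ a b : ℝ, 0 < a ∧ 0 < b ∧ ∀ i j, c i j = a ∨ c i j = b

end Chores

/-! ## A random access machine with arithmetic on numbers, in structured form

The memory has two sorts of cells: index cells, holding natural numbers, and number cells, holding
real numbers. Both are organised in (countably many) arrays with two indices. Programs are fixed
finite texts; array names are part of the text, positions in an array are computed. On indices
there are only addition, truncated subtraction and comparison, so that after `t` steps all indices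
have `O(t)` more bits than at the start; on numbers there are the four arithmetic operations and
comparison. There is no way to convert a number to an index, in particular no rounding. -/

namespace RAM

/-- The memory: `idx A i j` and `num A i j` are the contents of position `(i, j)` of the index
array, respectively of the number array, with name `A`. -/
structure Memory where
  idx : ℕ → ℕ → ℕ → ℕ
  num : ℕ → ℕ → ℕ → ℝ

/-- Store `v` at position `(i, j)` of index array `A`. -/
def Memory.setIdx (σ : Memory) (A i j v : ℕ) : Memory :=
  { σ with idx := fun A' i' j' => if A' = A ∧ i' = i ∧ j' = j then v else σ.idx A' i' j' }

/-- Store `v` at position `(i, j)` of number array `A`. -/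
noncomputable def Memory.setNum (σ : Memory) (A i j : ℕ) (v : ℝ) : Memory :=
  { σ with num := fun A' i' j' => if A' = A ∧ i' = i ∧ j' = j then v else σ.num A' i' j' }

/-- Index expressions: constants, array reads, addition, truncated subtraction. -/
inductive IExpr where
  | lit (k : ℕ)
  | get (A : ℕ) (i j : IExpr)
  | add (e f : IExpr)
  | sub (e f : IExpr)

/-- Value of an index expression. -/
def IExpr.eval (σ : Memory) : IExpr → ℕ
  | .lit k => k
  | .get A i j => σ.idx A (i.eval σ) (j.eval σ)
  | .add e f => e.eval σ + f.eval σ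
  | .sub e f => e.eval σ - f.eval σ

/-- Number of operations performed when evaluating an index expression. -/
def IExpr.cost : IExpr → ℕ
  | .lit _ => 1
  | .get _ i j => i.cost + j.cost + 1
  | .add e f => e.cost + f.cost + 1
  | .sub e f => e.cost + f.cost + 1

/-- Number expressions: the value of an index expression, array reads, and arithmetic. -/
inductive NExpr where
  | ofIdx (e : IExpr)
  | get (A : ℕ) (i j : IExpr)
  | add (e f : NExpr)
  | sub (e f : NExpr)
  | mul (e f : NExpr)
  | div (e f : NExpr)

/-- Value of a number expression; dividing by zero yields zero. -/
noncomputable def NExpr.eval (σ : Memory) : NExpr → ℝ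
  | .ofIdx e => (e.eval σ : ℝ)
  | .get A i j => σ.num A (i.eval σ) (j.eval σ)
  | .add e f => e.eval σ + f.eval σ
  | .sub e f => e.eval σ - f.eval σ
  | .mul e f => e.eval σ * f.eval σ
  | .div e f => e.eval σ / f.eval σ

/-- Number of operations performed when evaluating a number expression. -/
def NExpr.cost : NExpr → ℕ
  | .ofIdx e => e.cost + 1
  | .get _ i j => i.cost + j.cost + 1
  | .add e f => e.cost + f.cost + 1
  | .sub e f => e.cost + f.cost + 1
  | .mul e f => e.cost + f.cost + 1
  | .div e f => e.cost + f.cost + 1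

/-- Every number that occurs in the evaluation of the expression (its value and all intermediate
results) satisfies `ok`. -/
def NExpr.Within (ok : ℝ → Prop) (σ : Memory) : NExpr → Prop
  | .ofIdx e => ok (NExpr.eval σ (.ofIdx e))
  | .get A i j => ok (NExpr.eval σ (.get A i j))
  | .add e f => e.Within ok σ ∧ f.Within ok σ ∧ ok (NExpr.eval σ (.add e f))
  | .sub e f => e.Within ok σ ∧ f.Within ok σ ∧ ok (NExpr.eval σ (.sub e f))
  | .mul e f => e.Within ok σ ∧ f.Within ok σ ∧ ok (NExpr.eval σ (.mul e f))
  | .div e f => e.Within ok σ ∧ f.Within ok σ ∧ ok (NExpr.eval σ (.div e f))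

/-- Tests: comparisons of indices and of numbers, and Boolean combinations. -/
inductive Test where
  | idxLe (e f : IExpr)
  | numLe (e f : NExpr)
  | not (b : Test)
  | and (b d : Test)

/-- The test succeeds. -/
def Test.Holds (σ : Memory) : Test → Prop
  | .idxLe e f => e.eval σ ≤ f.eval σ
  | .numLe e f => e.eval σ ≤ f.eval σ
  | .not b => ¬ b.Holds σ
  | .and b d => b.Holds σ ∧ d.Holds σ

/-- Number of operations performed for a test. -/
def Test.cost : Test → ℕ
  | .idxLe e f => e.cost + f.cost + 1
  | .numLe e f => e.cost + f.cost + 1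
  | .not b => b.cost + 1
  | .and b d => b.cost + d.cost + 1

/-- Every number that occurs in the evaluation of the test satisfies `ok`. -/
def Test.Within (ok : ℝ → Prop) (σ : Memory) : Test → Prop
  | .idxLe _ _ => True
  | .numLe e f => e.Within ok σ ∧ f.Within ok σ
  | .not b => b.Within ok σ
  | .and b d => b.Within ok σ ∧ d.Within ok σ

/-- Programs. `setIdx A i j e` and `setNum A i j e` assign to position `(i, j)` of array `A`;
`loop b p` repeats `p` while the test `b` succeeds. -/
inductive Program where
  | skip
  | setIdx (A : ℕ) (i j : IExpr) (e : IExpr)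
  | setNum (A : ℕ) (i j : IExpr) (e : NExpr)
  | seq (p q : Program)
  | cond (b : Test) (p q : Program)
  | loop (b : Test) (p : Program)

/-- `Run ok p σ t τ`: started in memory `σ`, the program `p` halts after `t` steps in memory `τ`,
and every number that it computes or reads on the way satisfies `ok`. -/
inductive Run (ok : ℝ → Prop) : Program → Memory → ℕ → Memory → Prop where
  | skip (σ : Memory) : Run ok .skip σ 1 σ
  | setIdx (A : ℕ) (i j e : IExpr) (σ : Memory) :
      Run ok (.setIdx A i j e) σ (i.cost + j.cost + e.cost + 1)
        (σ.setIdx A (i.eval σ) (j.eval σ) (e.eval σ))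
  | setNum (A : ℕ) (i j : IExpr) (e : NExpr) (σ : Memory) (he : e.Within ok σ) :
      Run ok (.setNum A i j e) σ (i.cost + j.cost + e.cost + 1)
        (σ.setNum A (i.eval σ) (j.eval σ) (e.eval σ))
  | seq {p q : Program} {σ τ υ : Memory} {s t : ℕ} (hp : Run ok p σ s τ) (hq : Run ok q τ t υ) :
      Run ok (.seq p q) σ (s + t) υ
  | condTrue {b : Test} {p q : Program} {σ τ : Memory} {t : ℕ} (hw : b.Within ok σ)
      (hb : b.Holds σ) (hp : Run ok p σ t τ) : Run ok (.cond b p q) σ (b.cost + t) τ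
  | condFalse {b : Test} {p q : Program} {σ τ : Memory} {t : ℕ} (hw : b.Within ok σ)
      (hb : ¬ b.Holds σ) (hq : Run ok q σ t τ) : Run ok (.cond b p q) σ (b.cost + t) τ
  | loopDone {b : Test} {p : Program} {σ : Memory} (hw : b.Within ok σ) (hb : ¬ b.Holds σ) :
      Run ok (.loop b p) σ b.cost σ
  | loopStep {b : Test} {p : Program} {σ τ υ : Memory} {s t : ℕ} (hw : b.Within ok σ)
      (hb : b.Holds σ) (hp : Run ok p σ s τ) (hl : Run ok (.loop b p) τ t υ) :
      Run ok (.loop b p) σ (b.cost + s + t) υ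

/-- Initial memory for an `n × m` matrix `c`: positions `(0, 0)` and `(0, 1)` of index array `0`
hold `n` and `m`, number array `0` holds the matrix, and all the rest is zero. -/
noncomputable def input {n m : ℕ} (c : Fin n → Fin m → ℝ) : Memory where
  idx := fun A i j =>
    if A = 0 ∧ i = 0 ∧ j = 0 then n else if A = 0 ∧ i = 0 ∧ j = 1 then m else 0
  num := fun A i j =>
    if h : A = 0 ∧ i < n ∧ j < m then c ⟨i, h.2.1⟩ ⟨j, h.2.2⟩ else 0

/-- The `n × m` matrix in number array `1`. -/
def output (n m : ℕ) (τ : Memory) : Fin n → Fin m → ℝ := fun i j => τ.num 1 i j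

/-- Binary encoding length of a rational number: sign, numerator and denominator in lowest
terms. -/
def bitSize (q : ℚ) : ℕ := 1 + q.num.natAbs.size + q.den.size

/-- Binary encoding length of a rational matrix. -/
def totalBitSize {n m : ℕ} (q : Fin n → Fin m → ℚ) : ℕ := ∑ i, ∑ j, bitSize (q i j)

/-- The problem "given a real `n × m` matrix `c` with `Dom c`, find a real `n × m` matrix `x` with
`Sol c x`" can be solved in strongly polynomial time. One program solves it for all `n`, `m` and
`c`; the number of its steps, arithmetic operations included, is bounded by a polynomial in `n` and
`m` alone; and if the entries of `c` are rational, then all numbers that occur in the computation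
are rational numbers whose encoding length is bounded by a polynomial in `n`, `m` and the encoding
length of `c`. -/
def StronglyPolynomial (Dom : ∀ {n m : ℕ}, (Fin n → Fin m → ℝ) → Prop)
    (Sol : ∀ {n m : ℕ}, (Fin n → Fin m → ℝ) → (Fin n → Fin m → ℝ) → Prop) : Prop :=
  ∃ (p : Program) (P Q : Polynomial ℕ),
    ∀ (n m : ℕ) (c : Fin n → Fin m → ℝ), Dom c →
      ∃ (t : ℕ) (τ : Memory),
        Run (fun _ => True) p (input c) t τ ∧
        t ≤ P.eval (n + m) ∧
        Sol c (output n m τ) ∧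
        ∀ q : Fin n → Fin m → ℚ, (∀ i j, c i j = (q i j : ℝ)) →
          Run (fun v => ∃ r : ℚ, v = (r : ℝ) ∧ bitSize r ≤ Q.eval (n + m + totalBitSize q))
            p (input c) t τ

end RAM

/-! ### Program logic: termination with time bounds, loops, tables -/

namespace RAM

open Polynomial

/-! Let a ≤ b be the least and the greatest cost, and call a chore easy for an agent whose cost for
it is a. The allocation produced is a competitive equilibrium with equal incomes: chores have
prices, each agent receives only chores with the least ratio of cost to price for that agent, and
all bundles have the same total price E. Such an allocation is envy-free and fractionally
Pareto-optimal.

The equilibrium comes from a balanced allocation of the chores that are easy for somebody: shares go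
only to agents who find the chore easy, and whoever takes part of a chore has a load that is at most
the load of anybody else who finds it easy. The agents below a suitable threshold of load are called
low. Chores that are easy for a low agent get price a, all others price b. With the right threshold,
low agents earn at most E and the others at least E. The others keep the fraction of their chores
that is worth E. What they give up, and the chores that are easy for nobody, has price b and cost b
for every low agent, by balancedness; it fills up the incomes of the low agents exactly
(`equilibrium_of_balanced`).

A balanced allocation depends only on the graph of easy pairs, so it is computed with natural
numbers. Cut each easy chore into N = n³ + 1 units and move single units to agents whose load is
smaller by at least two, until this is impossible; the sum of squares of the loads bounds the number
of moves. Split the values of the loads into maximal runs of consecutive integers. The agents in one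
run form a block, and loads in a block differ by less than n. A chore belongs to the lowest block
containing an agent who finds it easy, and all its units are there. The chores of a block can be
shared out with exactly equal loads: a violated Hall condition would be off by an integer, while the
loads are so close to the average of the block, compared with N, that the error is less than one
(`blocks_of_stable`). An even distribution is found by push-relabel, where an agent with an excess
can never reach height n by the usual gap argument (`Preflow.height_lt`). Blocks with higher loads
have higher averages, so the result is balanced (`balanced_of_preflow`).

All searches move one unit at a time and have polynomially bounded potentials, which gives the bound
on the number of steps. Costs enter only when a and b are determined and when prices and shares are
computed. The latter is a formula of fixed depth with sums of at most n terms nested a fixed number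
of times, so for rational input numerators and denominators keep polynomial length
(`halts_priceProg`). -/

theorem NExpr.Within.mono {ok ok' : ℝ → Prop} (h : ∀ v, ok v → ok' v) {σ : Memory} :
    ∀ {e : NExpr}, e.Within ok σ → e.Within ok' σ
  | .ofIdx _, he => h _ he
  | .get _ _ _, he => h _ he
  | .add _ _, he => ⟨he.1.mono h, he.2.1.mono h, h _ he.2.2⟩
  | .sub _ _, he => ⟨he.1.mono h, he.2.1.mono h, h _ he.2.2⟩
  | .mul _ _, he => ⟨he.1.mono h, he.2.1.mono h, h _ he.2.2⟩
  | .div _ _, he => ⟨he.1.mono h, he.2.1.mono h, h _ he.2.2⟩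

theorem Test.Within.mono {ok ok' : ℝ → Prop} (h : ∀ v, ok v → ok' v) {σ : Memory} {b : Test}
    (hb : b.Within ok σ) : b.Within ok' σ := by
  induction b with
  | idxLe e f => trivial
  | numLe e f => exact ⟨NExpr.Within.mono h hb.1, NExpr.Within.mono h hb.2⟩
  | not b ih => exact ih hb
  | and b d ihb ihd => exact ⟨ihb hb.1, ihd hb.2⟩

/-- This allows a single analysed run to serve both for real input, with no condition on the
numbers, and for rational input, with the bound on encoding lengths. -/
theorem Run.mono {ok ok' : ℝ → Prop} (h : ∀ v, ok v → ok' v) {p : Program} {σ τ : Memory} {t : ℕ}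
    (hr : Run ok p σ t τ) : Run ok' p σ t τ := by
  induction hr with
  | skip σ => exact .skip σ
  | setIdx A i j e σ => exact .setIdx A i j e σ
  | setNum A i j e σ he => exact .setNum A i j e σ (he.mono h)
  | seq _ _ ih₁ ih₂ => exact .seq ih₁ ih₂
  | condTrue hw hb _ ih => exact .condTrue (hw.mono h) hb ih
  | condFalse hw hb _ ih => exact .condFalse (hw.mono h) hb ih
  | loopDone hw hb => exact .loopDone (hw.mono h) hb
  | loopStep hw hb _ _ ih₁ ih₂ => exact .loopStep (hw.mono h) hb ih₁ ih₂

/-- Started in `σ`, the program `p` halts within `P(k)` steps in a memory satisfying `Post`, and all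
numbers that occur satisfy `ok`. -/
def Halts (k : ℕ) (ok : ℝ → Prop) (P : ℕ[X]) (p : Program) (Post : Memory → Prop) (σ : Memory) :
    Prop :=
  ∃ t τ, t ≤ P.eval k ∧ Post τ ∧ Run ok p σ t τ

variable {k : ℕ} {ok : ℝ → Prop} {P P₁ P₂ : ℕ[X]} {p q : Program} {Post Mid : Memory → Prop}
  {σ : Memory}

theorem Halts.imp (h : Halts k ok P p Mid σ) (hm : ∀ τ, Mid τ → Post τ) : Halts k ok P p Post σ :=
  let ⟨t, τ, ht, hτ, hr⟩ := h
  ⟨t, τ, ht, hm τ hτ, hr⟩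

theorem halts_skip (h : Post σ) : Halts k ok 1 .skip Post σ :=
  ⟨1, σ, by simp, h, .skip σ⟩

theorem halts_setIdx {A : ℕ} {i j e : IExpr}
    (h : Post (σ.setIdx A (i.eval σ) (j.eval σ) (e.eval σ)))
    {c : ℕ} (hc : i.cost + j.cost + e.cost + 1 = c := by rfl) :
    Halts k ok (c : ℕ[X]) (.setIdx A i j e) Post σ :=
  ⟨_, _, by rw [eval_natCast, hc]; simp, h, .setIdx A i j e σ⟩

theorem halts_setNum {A : ℕ} {i j : IExpr} {e : NExpr} (he : e.Within ok σ)
    (h : Post (σ.setNum A (i.eval σ) (j.eval σ) (e.eval σ)))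
    {c : ℕ} (hc : i.cost + j.cost + e.cost + 1 = c := by rfl) :
    Halts k ok (c : ℕ[X]) (.setNum A i j e) Post σ :=
  ⟨_, _, by rw [eval_natCast, hc]; simp, h, .setNum A i j e σ he⟩

theorem halts_seq (h : Halts k ok P₁ p (Halts k ok P₂ q Post) σ) :
    Halts k ok (P₁ + P₂) (.seq p q) Post σ := by
  obtain ⟨s, τ, hs, ⟨t, υ, ht, hυ, hq⟩, hp⟩ := h
  exact ⟨s + t, υ, by rw [eval_add]; omega, hυ, .seq hp hq⟩

theorem halts_cond {b : Test} (hw : b.Within ok σ) (hp : b.Holds σ → Halts k ok P₁ p Post σ)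
    (hq : ¬ b.Holds σ → Halts k ok P₂ q Post σ) :
    Halts k ok (P₁ + P₂ + (b.cost : ℕ[X])) (.cond b p q) Post σ := by
  by_cases hb : b.Holds σ
  · obtain ⟨t, τ, ht, hτ, hr⟩ := hp hb
    exact ⟨_, τ, by rw [eval_add, eval_add, eval_natCast]; simp only [Nat.cast_id]; omega, hτ,
      .condTrue hw hb hr⟩
  · obtain ⟨t, τ, ht, hτ, hr⟩ := hq hb
    exact ⟨_, τ, by rw [eval_add, eval_add, eval_natCast]; simp only [Nat.cast_id]; omega, hτ,
      .condFalse hw hb hr⟩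

/-- Total correctness of loops, with a bound `M(k)` for the number of rounds. -/
theorem halts_loop {b : Test} (I : Memory → Prop) (μ : Memory → ℕ) (M : ℕ[X])
    (hw : ∀ τ, I τ → b.Within ok τ)
    (hstep : ∀ τ, I τ → b.Holds τ → Halts k ok P p (fun υ => I υ ∧ μ υ < μ τ) τ)
    (hσ : I σ) (hM : μ σ ≤ M.eval k) (hpost : ∀ τ, I τ → ¬ b.Holds τ → Post τ) :
    Halts k ok ((M + 1) * (P + (b.cost : ℕ[X]))) (.loop b p) Post σ := by
  have key : ∀ (N : ℕ) (τ : Memory), I τ → μ τ ≤ N →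
      ∃ t υ, t ≤ (N + 1) * (P.eval k + b.cost) ∧ Post υ ∧ Run ok (.loop b p) τ t υ := by
    intro N
    induction N with
    | zero =>
      intro τ hτ hμ
      by_cases hb : b.Holds τ
      · obtain ⟨_, υ, _, ⟨_, hυ⟩, _⟩ := hstep τ hτ hb
        omega
      · exact ⟨_, τ, by simp, hpost τ hτ hb, .loopDone (hw τ hτ) hb⟩
    | succ N ih =>
      intro τ hτ hμ
      by_cases hb : b.Holds τ
      · obtain ⟨s, υ, hs, ⟨hυ, hlt⟩, hr⟩ := hstep τ hτ hb
        obtain ⟨t, φ, ht, hφ, hr'⟩ := ih υ hυ (by omega)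
        refine ⟨_, φ, ?_, hφ, .loopStep (hw τ hτ) hb hr hr'⟩
        rw [add_mul _ 1]
        omega
      · refine ⟨_, τ, ?_, hpost τ hτ hb, .loopDone (hw τ hτ) hb⟩
        rw [add_mul _ 1]
        omega
  obtain ⟨t, υ, ht, hυ, hr⟩ := key _ σ hσ hM
  exact ⟨t, υ, by simpa [eval_mul, eval_add, eval_natCast] using ht, hυ, hr⟩

/-- The index variable with name `v`. -/
abbrev var (v : ℕ) : IExpr := .get v (.lit 0) (.lit 0)

/-- `for v < N do p`. -/
def forLoop (v : ℕ) (N : IExpr) (p : Program) : Program :=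
  .seq (.setIdx v (.lit 0) (.lit 0) (.lit 0))
    (.loop (.not (.idxLe N (var v)))
      (.seq p (.setIdx v (.lit 0) (.lit 0) (.add (var v) (.lit 1)))))

/-- The number of steps of a `for` loop with at most `k + 1` rounds of at most `P(k)` steps. -/
noncomputable def forTime (N : IExpr) (P : ℕ[X]) : ℕ[X] :=
  ((4 : ℕ) : ℕ[X]) + (X + 1 + 1) * (P + ((8 : ℕ) : ℕ[X]) + ((N.cost + 5 : ℕ) : ℕ[X]))

/-- The invariant has to fix the counter and the value of the bound in each round, so the body may
use the counter but must leave it intact. Allowing `k + 1` rounds instead of `k` admits loops with a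
single round for every `k`. -/
theorem halts_forLoop {v : ℕ} {N : IExpr} (I : ℕ → Memory → Prop) (r : ℕ) (hr : r ≤ k + 1)
    (hI : ∀ i τ, I i τ → τ.idx v 0 0 = i ∧ N.eval τ = r)
    (hstart : I 0 (σ.setIdx v 0 0 0))
    (hstep : ∀ i < r, ∀ τ, I i τ →
      Halts k ok P p (fun υ => I (i + 1) (υ.setIdx v 0 0 (υ.idx v 0 0 + 1))) τ)
    (hpost : ∀ τ, I r τ → Post τ) :
    Halts k ok (forTime N P) (forLoop v N p) Post σ := by
  have hloop : Halts k ok ((X + 1 + 1) * (P + ((8 : ℕ) : ℕ[X]) + ((N.cost + 5 : ℕ) : ℕ[X])))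
      (.loop (.not (.idxLe N (var v)))
        (.seq p (.setIdx v (.lit 0) (.lit 0) (.add (var v) (.lit 1))))) Post
      (σ.setIdx v 0 0 0) := by
    have := halts_loop (k := k) (ok := ok) (P := P + ((8 : ℕ) : ℕ[X])) (σ := σ.setIdx v 0 0 0)
      (p := .seq p (.setIdx v (.lit 0) (.lit 0) (.add (var v) (.lit 1))))
      (b := .not (.idxLe N (var v))) (Post := Post)
      (fun τ => ∃ i ≤ r, I i τ) (fun τ => r - τ.idx v 0 0) (X + 1) (fun _ _ => trivial) ?_
      ⟨0, Nat.zero_le _, hstart⟩ ?_ ?_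
    · exact this
    · rintro τ ⟨i, hi, hτ⟩ hb
      obtain ⟨hv, hN⟩ := hI i τ hτ
      have hir : i < r := by
        simp only [Test.Holds, IExpr.eval, hv, hN] at hb
        omega
      refine halts_seq ((hstep i hir τ hτ).imp fun υ hυ => ?_)
      refine halts_setIdx ?_
      refine ⟨⟨i + 1, hir, hυ⟩, ?_⟩
      have := (hI _ _ hυ).1
      simp only [IExpr.eval]
      rw [this, hv]
      omega
    · simp
      omega
    · rintro τ ⟨i, hi, hτ⟩ hb
      obtain ⟨hv, hN⟩ := hI i τ hτ
      have : i = r := by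
        simp only [Test.Holds, IExpr.eval, hv, hN] at hb
        omega
      exact hpost τ (this ▸ hτ)
  exact halts_seq (halts_setIdx hloop)

/-- Outside of the index arrays in `S` and the number arrays in `T`, the memory `τ` is the memory
`σ`. -/
structure Agree (S T : Set ℕ) (σ τ : Memory) : Prop where
  idx : ∀ A, A ∉ S → τ.idx A = σ.idx A
  num : ∀ A, A ∉ T → τ.num A = σ.num A

theorem Agree.refl (S T : Set ℕ) (σ : Memory) : Agree S T σ σ := ⟨fun _ _ => rfl, fun _ _ => rfl⟩

@[simp] theorem setIdx_num (σ : Memory) (A i j v : ℕ) : (σ.setIdx A i j v).num = σ.num := rfl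

@[simp] theorem setNum_idx (σ : Memory) (A i j : ℕ) (v : ℝ) : (σ.setNum A i j v).idx = σ.idx := rfl

theorem setIdx_idx (σ : Memory) (A i j v A' i' j' : ℕ) : (σ.setIdx A i j v).idx A' i' j' =
    if A' = A ∧ i' = i ∧ j' = j then v else σ.idx A' i' j' := rfl

theorem setIdx_idx_ne (σ : Memory) {A A' : ℕ} (i j v : ℕ) (h : A' ≠ A) :
    (σ.setIdx A i j v).idx A' = σ.idx A' := by
  funext i' j'
  simp [setIdx_idx, h]

theorem setIdx_idx_self (σ : Memory) (A i j v : ℕ) : (σ.setIdx A i j v).idx A i j = v := by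
  simp [setIdx_idx]

theorem setNum_num_ne (σ : Memory) {A A' : ℕ} (i j : ℕ) (v : ℝ) (h : A' ≠ A) :
    (σ.setNum A i j v).num A' = σ.num A' := by
  funext i' j'
  simp [Memory.setNum, h]

theorem setNum_num_self (σ : Memory) (A i j : ℕ) (v : ℝ) : (σ.setNum A i j v).num A i j = v := by
  simp [Memory.setNum]

theorem Agree.setIdx {S T : Set ℕ} {σ τ : Memory} (h : Agree S T σ τ) {A : ℕ} (hA : A ∈ S)
    (i j v : ℕ) : Agree S T σ (τ.setIdx A i j v) where
  idx A' hA' := by rw [setIdx_idx_ne _ _ _ _ (by rintro rfl; exact hA' hA), h.idx A' hA']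
  num A' hA' := h.num A' hA'

theorem Agree.setNum {S T : Set ℕ} {σ τ : Memory} (h : Agree S T σ τ) {A : ℕ} (hA : A ∈ T)
    (i j : ℕ) (v : ℝ) : Agree S T σ (τ.setNum A i j v) where
  idx := h.idx
  num A' hA' := by rw [setNum_num_ne _ _ _ _ (by rintro rfl; exact hA' hA), h.num A' hA']

/-- `for i < R, j < C do (p; for l < L do q)` with counters `1`, `2`, `3` for `i`, `j`, `l`. -/
def table (R C L : IExpr) (p q : Program) : Program :=
  forLoop 1 R (forLoop 2 C (.seq p (forLoop 3 L q)))

/-- The number of steps of `table` if `p` and `q` run at most `P(k)` and `Q(k)` steps. -/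
noncomputable def tableTime (R C L : IExpr) (P Q : ℕ[X]) : ℕ[X] :=
  forTime R (forTime C (P + forTime L Q))

/-- A table is filled in by computing its entries one after the other. Here `cell i j τ x` says that
the entry in position `(i, j)` of memory `τ` is `x`. -/
theorem halts_table {α : Type} {S T : Set ℕ} (hS : {1, 2, 3} ⊆ S) {R C L : IExpr} {p q : Program}
    {Pp Pq : ℕ[X]} (cell : ℕ → ℕ → Memory → α)
    (hcell : ∀ i j τ, ∀ D ∈ ({1, 2, 3} : Set ℕ), ∀ v, cell i j (τ.setIdx D 0 0 v) = cell i j τ)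
    (r s t : ℕ) (hr : r ≤ k + 1) (hs : s ≤ k + 1) (ht : t ≤ k + 1)
    (I : ℕ → ℕ → ℕ → α → Prop)
    (hR : ∀ τ, Agree S T σ τ → R.eval τ = r) (hC : ∀ τ, Agree S T σ τ → C.eval τ = s)
    (hL : ∀ τ, Agree S T σ τ → L.eval τ = t)
    (hp : ∀ i < r, ∀ j < s, ∀ τ, Agree S T σ τ → τ.idx 1 0 0 = i → τ.idx 2 0 0 = j →
      Halts k ok Pp p (fun υ => Agree S T σ υ ∧ υ.idx 1 = τ.idx 1 ∧ υ.idx 2 = τ.idx 2 ∧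
        (∀ i' j', (i', j') ≠ (i, j) → cell i' j' υ = cell i' j' τ) ∧ I i j 0 (cell i j υ)) τ)
    (hq : ∀ i < r, ∀ j < s, ∀ l < t, ∀ τ, Agree S T σ τ →
      τ.idx 1 0 0 = i → τ.idx 2 0 0 = j → τ.idx 3 0 0 = l → I i j l (cell i j τ) →
      Halts k ok Pq q (fun υ => Agree S T σ υ ∧ υ.idx 1 = τ.idx 1 ∧ υ.idx 2 = τ.idx 2 ∧
        υ.idx 3 = τ.idx 3 ∧ (∀ i' j', (i', j') ≠ (i, j) → cell i' j' υ = cell i' j' τ) ∧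
        I i j (l + 1) (cell i j υ)) τ)
    (hpost : ∀ τ, Agree S T σ τ → (∀ i < r, ∀ j < s, I i j t (cell i j τ)) → Post τ) :
    Halts k ok (tableTime R C L Pp Pq) (table R C L p q) Post σ := by
  have c1 : ∀ i j τ v, cell i j (τ.setIdx 1 0 0 v) = cell i j τ :=
    fun i j τ => hcell i j τ 1 (by simp)
  have c2 : ∀ i j τ v, cell i j (τ.setIdx 2 0 0 v) = cell i j τ :=
    fun i j τ => hcell i j τ 2 (by simp)
  have c3 : ∀ i j τ v, cell i j (τ.setIdx 3 0 0 v) = cell i j τ :=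
    fun i j τ => hcell i j τ 3 (by simp)
  refine halts_forLoop (fun i τ => Agree S T σ τ ∧ τ.idx 1 0 0 = i ∧
    ∀ i' < i, ∀ j < s, I i' j t (cell i' j τ)) r hr (fun i τ h => ⟨h.2.1, hR τ h.1⟩)
    ⟨(Agree.refl S T σ).setIdx (hS (by simp)) _ _ _, setIdx_idx_self _ _ _ _ _, by simp⟩ ?_
    (fun τ h => hpost τ h.1 h.2.2)
  rintro i hi τ ⟨hτ, hτi, hdone⟩
  refine halts_forLoop (fun j υ => Agree S T σ υ ∧ υ.idx 1 0 0 = i ∧ υ.idx 2 0 0 = j ∧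
    (∀ i' < i, ∀ j < s, I i' j t (cell i' j υ)) ∧ ∀ j' < j, I i j' t (cell i j' υ)) s hs
    (fun j υ h => ⟨h.2.2.1, hC υ h.1⟩)
    ⟨hτ.setIdx (hS (by simp)) _ _ _, by rw [setIdx_idx_ne _ _ _ _ (by simp), hτi],
      setIdx_idx_self _ _ _ _ _, by simpa only [c2] using hdone, by simp⟩ ?_ ?_
  · rintro j hj τ ⟨hτ, hτi, hτj, hdone, hrow⟩
    refine halts_seq ((hp i hi j hj τ hτ hτi hτj).imp ?_)
    rintro υ ⟨hυ, hυ1, hυ2, hυc, hI⟩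
    have hυi : υ.idx 1 0 0 = i := by rw [hυ1, hτi]
    have hυj : υ.idx 2 0 0 = j := by rw [hυ2, hτj]
    have hdone' : ∀ i' < i, ∀ j < s, I i' j t (cell i' j υ) := fun i' hi' j' hj' => by
      rw [hυc _ _ (by simp; omega)]; exact hdone i' hi' j' hj'
    have hrow' : ∀ j' < j, I i j' t (cell i j' υ) := fun j' hj' => by
      rw [hυc _ _ (by simp; omega)]; exact hrow j' hj'
    refine halts_forLoop (fun l φ => Agree S T σ φ ∧ φ.idx 1 0 0 = i ∧ φ.idx 2 0 0 = j ∧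
      φ.idx 3 0 0 = l ∧ (∀ i' < i, ∀ j < s, I i' j t (cell i' j φ)) ∧
      (∀ j' < j, I i j' t (cell i j' φ)) ∧ I i j l (cell i j φ)) t ht
      (fun l φ h => ⟨h.2.2.2.1, hL φ h.1⟩)
      ⟨hυ.setIdx (hS (by simp)) _ _ _, by rw [setIdx_idx_ne _ _ _ _ (by simp), hυi],
        by rw [setIdx_idx_ne _ _ _ _ (by simp), hυj],
        setIdx_idx_self _ _ _ _ _, by simpa only [c3] using hdone', by simpa only [c3] using hrow',
        by simpa only [c3] using hI⟩ ?_ ?_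
    · rintro l hl φ ⟨hφ, hφi, hφj, hφl, hd, hr, hI⟩
      refine (hq i hi j hj l hl φ hφ hφi hφj hφl hI).imp ?_
      rintro ψ ⟨hψ, hψ1, hψ2, hψ3, hψc, hIψ⟩
      refine ⟨hψ.setIdx (hS (by simp)) _ _ _, by rw [setIdx_idx_ne _ _ _ _ (by simp), hψ1, hφi],
        by rw [setIdx_idx_ne _ _ _ _ (by simp), hψ2, hφj],
        by rw [setIdx_idx_self, hψ3, hφl], ?_, ?_, ?_⟩
      · intro i' hi' j' hj'
        rw [c3, hψc _ _ (by simp; omega)]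
        exact hd i' hi' j' hj'
      · intro j' hj'
        rw [c3, hψc _ _ (by simp; omega)]
        exact hr j' hj'
      · rw [c3]; exact hIψ
    · rintro φ ⟨hφ, hφi, hφj, hφl, hd, hr, hI⟩
      refine ⟨hφ.setIdx (hS (by simp)) _ _ _, by rw [setIdx_idx_ne _ _ _ _ (by simp), hφi],
        by rw [setIdx_idx_self, hφj], by simpa only [c2] using hd, ?_⟩
      intro j' hj'
      rw [c2]
      rcases Nat.lt_succ_iff_lt_or_eq.1 hj' with h | rfl
      · exact hr j' h
      · exact hI
  · rintro υ ⟨hυ, hυi, hυj, hdone, hrow⟩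
    refine ⟨hυ.setIdx (hS (by simp)) _ _ _, by rw [setIdx_idx_self, hυi], ?_⟩
    intro i' hi' j hj
    rw [c1]
    rcases Nat.lt_succ_iff_lt_or_eq.1 hi' with h | rfl
    · exact hdone i' h j hj
    · exact hrow j hj

/-- Fill in index array `A`: `A[i][j] := e₀; for l < L do (if b then A[i][j] := e)`. -/
def tableI (A : ℕ) (R C L : IExpr) (e₀ : IExpr) (b : Test) (e : IExpr) : Program :=
  table R C L (.setIdx A (var 1) (var 2) e₀) (.cond b (.setIdx A (var 1) (var 2) e) .skip)

/-- Fill in number array `A`: `A[i][j] := e₀; for l < L do (if b then A[i][j] := e)`. -/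
def tableN (A : ℕ) (R C L : IExpr) (e₀ : NExpr) (b : Test) (e : NExpr) : Program :=
  table R C L (.setNum A (var 1) (var 2) e₀) (.cond b (.setNum A (var 1) (var 2) e) .skip)

/-- The number of steps of `tableI` and `tableN`, given the costs of the expressions. -/
noncomputable def fillTime (R C L : IExpr) (c₀ cb c : ℕ) : ℕ[X] :=
  tableTime R C L ((3 + 3 + c₀ + 1 : ℕ) : ℕ[X]) (((3 + 3 + c + 1 : ℕ) : ℕ[X]) + 1 + (cb : ℕ[X]))

/-- Here `I i j l x` is the invariant for a single entry: `x` is an admissible value of it after `l`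
rounds of the innermost loop. Entries already finished are protected because each round writes only
to the current position. -/
theorem halts_tableI {A : ℕ} (hA : A ≠ 1 ∧ A ≠ 2 ∧ A ≠ 3) {R C L e₀ e : IExpr} {b : Test}
    (r s t : ℕ) (hr : r ≤ k + 1) (hs : s ≤ k + 1) (ht : t ≤ k + 1)
    (I : ℕ → ℕ → ℕ → ℕ → Prop)
    (hR : ∀ τ, Agree {A, 1, 2, 3} ∅ σ τ → R.eval τ = r)
    (hC : ∀ τ, Agree {A, 1, 2, 3} ∅ σ τ → C.eval τ = s)
    (hL : ∀ τ, Agree {A, 1, 2, 3} ∅ σ τ → L.eval τ = t)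
    (hp : ∀ i < r, ∀ j < s, ∀ τ, Agree {A, 1, 2, 3} ∅ σ τ → τ.idx 1 0 0 = i → τ.idx 2 0 0 = j →
      I i j 0 (e₀.eval τ))
    (hq : ∀ i < r, ∀ j < s, ∀ l < t, ∀ τ, Agree {A, 1, 2, 3} ∅ σ τ →
      τ.idx 1 0 0 = i → τ.idx 2 0 0 = j → τ.idx 3 0 0 = l → I i j l (τ.idx A i j) →
      b.Within ok τ ∧ (b.Holds τ → I i j (l + 1) (e.eval τ)) ∧
        (¬ b.Holds τ → I i j (l + 1) (τ.idx A i j)))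
    (hpost : ∀ τ, Agree {A, 1, 2, 3} ∅ σ τ → (∀ i < r, ∀ j < s, I i j t (τ.idx A i j)) → Post τ) :
    Halts k ok (fillTime R C L e₀.cost b.cost e.cost) (tableI A R C L e₀ b e) Post σ := by
  obtain ⟨hA1, hA2, hA3⟩ := hA
  refine halts_table (S := {A, 1, 2, 3}) (T := ∅) (by simp) (fun i j τ => τ.idx A i j) ?_
    r s t hr hs ht I
    hR hC hL ?_ ?_ hpost
  · rintro i j τ D hD v
    have : A ≠ D := by rintro rfl; simp [hA1, hA2, hA3] at hD
    simp [setIdx_idx, this]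
  · intro i hi j hj τ hτ h1 h2
    refine halts_setIdx ?_
    refine ⟨hτ.setIdx (by simp) _ _ _, setIdx_idx_ne _ _ _ _ hA1.symm,
      setIdx_idx_ne _ _ _ _ hA2.symm, ?_, ?_⟩
    · intro i' j' hne
      simp only [IExpr.eval, h1, h2, setIdx_idx, true_and]
      rw [if_neg (by simpa using hne)]
    · simpa [IExpr.eval, h1, h2, setIdx_idx_self] using hp i hi j hj τ hτ h1 h2
  · intro i hi j hj l hl τ hτ h1 h2 h3 hI
    obtain ⟨hw, ht, hf⟩ := hq i hi j hj l hl τ hτ h1 h2 h3 hI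
    refine halts_cond hw (fun hb => ?_) (fun hb => ?_)
    · refine halts_setIdx ?_
      refine ⟨hτ.setIdx (by simp) _ _ _, setIdx_idx_ne _ _ _ _ hA1.symm,
        setIdx_idx_ne _ _ _ _ hA2.symm, setIdx_idx_ne _ _ _ _ hA3.symm, ?_, ?_⟩
      · intro i' j' hne
        simp only [IExpr.eval, h1, h2, setIdx_idx, true_and]
        rw [if_neg (by simpa using hne)]
      · simpa [IExpr.eval, h1, h2, setIdx_idx_self] using ht hb
    · exact halts_skip ⟨hτ, rfl, rfl, rfl, fun _ _ _ => rfl, hf hb⟩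

theorem halts_tableN {B : ℕ} {R C L : IExpr} {e₀ e : NExpr} {b : Test}
    (r s t : ℕ) (hr : r ≤ k + 1) (hs : s ≤ k + 1) (ht : t ≤ k + 1)
    (I : ℕ → ℕ → ℕ → ℝ → Prop)
    (hR : ∀ τ, Agree {1, 2, 3} {B} σ τ → R.eval τ = r)
    (hC : ∀ τ, Agree {1, 2, 3} {B} σ τ → C.eval τ = s)
    (hL : ∀ τ, Agree {1, 2, 3} {B} σ τ → L.eval τ = t)
    (hp : ∀ i < r, ∀ j < s, ∀ τ, Agree {1, 2, 3} {B} σ τ → τ.idx 1 0 0 = i → τ.idx 2 0 0 = j →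
      e₀.Within ok τ ∧ I i j 0 (e₀.eval τ))
    (hq : ∀ i < r, ∀ j < s, ∀ l < t, ∀ τ, Agree {1, 2, 3} {B} σ τ →
      τ.idx 1 0 0 = i → τ.idx 2 0 0 = j → τ.idx 3 0 0 = l → I i j l (τ.num B i j) →
      b.Within ok τ ∧ (b.Holds τ → e.Within ok τ ∧ I i j (l + 1) (e.eval τ)) ∧
        (¬ b.Holds τ → I i j (l + 1) (τ.num B i j)))
    (hpost : ∀ τ, Agree {1, 2, 3} {B} σ τ → (∀ i < r, ∀ j < s, I i j t (τ.num B i j)) → Post τ) :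
    Halts k ok (fillTime R C L e₀.cost b.cost e.cost) (tableN B R C L e₀ b e) Post σ := by
  refine halts_table (S := {1, 2, 3}) (T := {B}) (by simp) (fun i j τ => τ.num B i j)
    (fun _ _ _ _ _ _ => rfl) r s t hr hs ht I hR hC hL ?_ ?_ hpost
  · intro i hi j hj τ hτ h1 h2
    obtain ⟨hw, hI⟩ := hp i hi j hj τ hτ h1 h2
    refine halts_setNum hw ?_
    refine ⟨hτ.setNum (by simp) _ _ _, rfl, rfl, ?_, ?_⟩
    · intro i' j' hne
      simp only [IExpr.eval, h1, h2, Memory.setNum, true_and]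
      rw [if_neg (by simpa using hne)]
    · simpa [IExpr.eval, h1, h2, setNum_num_self] using hI
  · intro i hi j hj l hl τ hτ h1 h2 h3 hI
    obtain ⟨hw, ht, hf⟩ := hq i hi j hj l hl τ hτ h1 h2 h3 hI
    refine halts_cond hw (fun hb => ?_) (fun hb => ?_)
    · refine halts_setNum (ht hb).1 ?_
      refine ⟨hτ.setNum (by simp) _ _ _, rfl, rfl, rfl, ?_, ?_⟩
      · intro i' j' hne
        simp only [IExpr.eval, h1, h2, Memory.setNum, true_and]
        rw [if_neg (by simpa using hne)]
      · simpa [IExpr.eval, h1, h2, setNum_num_self] using (ht hb).2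
    · exact halts_skip ⟨hτ, rfl, rfl, rfl, fun _ _ _ => rfl, hf hb⟩

end RAM

/-! ### Timed building blocks: maps, sums, counts, local search -/

namespace RAM

open Polynomial

variable {k : ℕ} {ok : ℝ → Prop} {P P₁ P₂ : ℕ[X]} {p q : Program} {Post Mid : Memory → Prop}
  {σ : Memory}

/-- The test that always succeeds. -/
def Test.yes : Test := .idxLe (.lit 0) (.lit 0)

theorem Test.yes_holds (σ : Memory) : Test.yes.Holds σ := le_refl 0

theorem Test.yes_within (ok : ℝ → Prop) (σ : Memory) : Test.yes.Within ok σ := trivial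

/-- A program together with a polynomial bound for its number of steps. -/
structure Timed where
  /-- The program. -/
  prog : Program
  /-- The bound. -/
  time : ℕ[X]

/-- Started in `σ`, the program of `p` halts within its time bound in a memory satisfying `Post`. -/
def Runs (k : ℕ) (ok : ℝ → Prop) (p : Timed) (Post : Memory → Prop) (σ : Memory) : Prop :=
  Halts k ok p.time p.prog Post σ

/-- Sequential composition. -/
noncomputable def Timed.seq (p q : Timed) : Timed := ⟨.seq p.prog q.prog, p.time + q.time⟩

theorem runs_seq {p q : Timed} (h : Runs k ok p (Runs k ok q Post) σ) :
    Runs k ok (p.seq q) Post σ :=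
  halts_seq h

/-- `A[i][j] := e`, once. -/
noncomputable def Timed.setIdx (A : ℕ) (i j e : IExpr) : Timed :=
  ⟨.setIdx A i j e, ((i.cost + j.cost + e.cost + 1 : ℕ) : ℕ[X])⟩

theorem runs_setIdx {A : ℕ} {i j e : IExpr}
    (h : Post (σ.setIdx A (i.eval σ) (j.eval σ) (e.eval σ))) :
    Runs k ok (.setIdx A i j e) Post σ :=
  halts_setIdx h

/-- Nothing. -/
noncomputable def Timed.skip : Timed := ⟨.skip, 1⟩

/-- `A[i][j] := e`. -/
noncomputable def mapI (A : ℕ) (R C e : IExpr) : Timed :=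
  ⟨tableI A R C (.lit 0) e Test.yes (.lit 0),
    fillTime R C (.lit 0) e.cost Test.yes.cost (IExpr.lit 0).cost⟩

/-- `A[i][j] := ∑ l < L, e`. -/
noncomputable def sumI (A : ℕ) (R C L e : IExpr) : Timed :=
  ⟨tableI A R C L (.lit 0) Test.yes (.add (.get A (var 1) (var 2)) e),
    fillTime R C L (IExpr.lit 0).cost Test.yes.cost (IExpr.add (.get A (var 1) (var 2)) e).cost⟩

/-- `A[i][j] := #{l < L | b}`. -/
noncomputable def countI (A : ℕ) (R C L : IExpr) (b : Test) : Timed :=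
  ⟨tableI A R C L (.lit 0) b (.add (.get A (var 1) (var 2)) (.lit 1)),
    fillTime R C L (IExpr.lit 0).cost b.cost (IExpr.add (.get A (var 1) (var 2)) (.lit 1)).cost⟩

/-- `A[i][j] := if b then e else 0`. -/
noncomputable def iteI (A : ℕ) (R C : IExpr) (b : Test) (e : IExpr) : Timed :=
  ⟨tableI A R C (.lit 1) (.lit 0) b e, fillTime R C (.lit 1) (IExpr.lit 0).cost b.cost e.cost⟩

/-- `A[i][j] := e`. -/
noncomputable def mapN (A : ℕ) (R C : IExpr) (e : NExpr) : Timed :=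
  ⟨tableN A R C (.lit 0) e Test.yes (.ofIdx (.lit 0)),
    fillTime R C (.lit 0) e.cost Test.yes.cost (NExpr.ofIdx (.lit 0)).cost⟩

/-- `A[i][j] := e₀ + ∑ l < L, e`. -/
noncomputable def sumN (A : ℕ) (R C L : IExpr) (e₀ e : NExpr) : Timed :=
  ⟨tableN A R C L e₀ Test.yes (.add (.get A (var 1) (var 2)) e),
    fillTime R C L e₀.cost Test.yes.cost (NExpr.add (.get A (var 1) (var 2)) e).cost⟩

/-- Index arrays with sums as entries. -/
theorem halts_sumI {A : ℕ} (hA : A ≠ 1 ∧ A ≠ 2 ∧ A ≠ 3) {R C L e : IExpr}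
    (r s t : ℕ) (hr : r ≤ k + 1) (hs : s ≤ k + 1) (ht : t ≤ k + 1) (F : ℕ → ℕ → ℕ → ℕ)
    (hR : ∀ τ, Agree {A, 1, 2, 3} ∅ σ τ → R.eval τ = r)

    (hC : ∀ τ, Agree {A, 1, 2, 3} ∅ σ τ → C.eval τ = s)
    (hL : ∀ τ, Agree {A, 1, 2, 3} ∅ σ τ → L.eval τ = t)
    (hF : ∀ i < r, ∀ j < s, ∀ l < t, ∀ τ, Agree {A, 1, 2, 3} ∅ σ τ →
      τ.idx 1 0 0 = i → τ.idx 2 0 0 = j → τ.idx 3 0 0 = l → e.eval τ = F i j l)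
    (hpost : ∀ τ, Agree {A, 1, 2, 3} ∅ σ τ →
      (∀ i < r, ∀ j < s, τ.idx A i j = ∑ l ∈ Finset.range t, F i j l) → Post τ) :
    Runs k ok (sumI A R C L e) Post σ := by
  refine halts_tableI (ok := ok) (k := k) (σ := σ) (Post := Post) hA r s t hr hs ht
    (fun i j l x => x = ∑ l ∈ Finset.range l, F i j l) hR hC hL ?_ ?_ hpost
  · intros; simp [IExpr.eval]
  · intro i hi j hj l hl τ hτ h1 h2 h3 hI
    refine ⟨Test.yes_within _ _, fun _ => ?_, fun hb => absurd (Test.yes_holds _) hb⟩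
    simp only [IExpr.eval, h1, h2, hF i hi j hj l hl τ hτ h1 h2 h3, Finset.sum_range_succ]
    rw [hI]

/-- Index arrays with single values as entries. -/
theorem halts_mapI {A : ℕ} (hA : A ≠ 1 ∧ A ≠ 2 ∧ A ≠ 3) {R C e : IExpr}
    (r s : ℕ) (hr : r ≤ k + 1) (hs : s ≤ k + 1) (F : ℕ → ℕ → ℕ)
    (hR : ∀ τ, Agree {A, 1, 2, 3} ∅ σ τ → R.eval τ = r)

    (hC : ∀ τ, Agree {A, 1, 2, 3} ∅ σ τ → C.eval τ = s)
    (hF : ∀ i < r, ∀ j < s, ∀ τ, Agree {A, 1, 2, 3} ∅ σ τ →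
      τ.idx 1 0 0 = i → τ.idx 2 0 0 = j → e.eval τ = F i j)
    (hpost : ∀ τ, Agree {A, 1, 2, 3} ∅ σ τ →
      (∀ i < r, ∀ j < s, τ.idx A i j = F i j) → Post τ) :
    Runs k ok (mapI A R C e) Post σ :=
  -- The innermost loop has no rounds, so the entry keeps its initial value.
  halts_tableI (ok := ok) (k := k) (σ := σ) (Post := Post) hA r s 0 hr hs (Nat.zero_le _)
    (fun i j l x => x = F i j) hR hC (fun _ _ => rfl) hF (fun _ _ _ _ l hl => absurd hl (by omega))
    hpost

/-- Index arrays that count how often a test succeeds. -/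
theorem halts_count {A : ℕ} (hA : A ≠ 1 ∧ A ≠ 2 ∧ A ≠ 3) {R C L : IExpr} {b : Test}
    (r s t : ℕ) (hr : r ≤ k + 1) (hs : s ≤ k + 1) (ht : t ≤ k + 1) (T : ℕ → ℕ → ℕ → Prop)
    [∀ i j, DecidablePred (T i j)] (hR : ∀ τ, Agree {A, 1, 2, 3} ∅ σ τ → R.eval τ = r)

    (hC : ∀ τ, Agree {A, 1, 2, 3} ∅ σ τ → C.eval τ = s)
    (hL : ∀ τ, Agree {A, 1, 2, 3} ∅ σ τ → L.eval τ = t)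
    (hT : ∀ i < r, ∀ j < s, ∀ l < t, ∀ τ, Agree {A, 1, 2, 3} ∅ σ τ →
      τ.idx 1 0 0 = i → τ.idx 2 0 0 = j → τ.idx 3 0 0 = l →
      b.Within ok τ ∧ (b.Holds τ ↔ T i j l))
    (hpost : ∀ τ, Agree {A, 1, 2, 3} ∅ σ τ →
      (∀ i < r, ∀ j < s, τ.idx A i j = ((Finset.range t).filter (T i j)).card) → Post τ) :
    Runs k ok (countI A R C L b) Post σ := by
  refine halts_tableI (ok := ok) (k := k) (σ := σ) (Post := Post) hA r s t hr hs ht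
    (fun i j l x => x = ((Finset.range l).filter (T i j)).card) hR hC hL ?_ ?_ hpost
  · intros; simp [IExpr.eval]
  · intro i hi j hj l hl τ hτ h1 h2 h3 hI
    obtain ⟨hw, hb⟩ := hT i hi j hj l hl τ hτ h1 h2 h3
    refine ⟨hw, fun h => ?_, fun h => ?_⟩
    · rw [Finset.range_add_one, Finset.filter_insert, if_pos (hb.1 h),
        Finset.card_insert_of_notMem (by simp), ← hI]
      simp [IExpr.eval, h1, h2]
    · rw [Finset.range_add_one, Finset.filter_insert, if_neg (fun h' => h (hb.2 h')), ← hI]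

theorem halts_iteI {A : ℕ} (hA : A ≠ 1 ∧ A ≠ 2 ∧ A ≠ 3) {R C e : IExpr} {b : Test}
    (r s : ℕ) (hr : r ≤ k + 1) (hs : s ≤ k + 1) (T : ℕ → ℕ → Prop)
    [∀ i j, Decidable (T i j)] (F : ℕ → ℕ → ℕ) (hR : ∀ τ, Agree {A, 1, 2, 3} ∅ σ τ → R.eval τ = r)

    (hC : ∀ τ, Agree {A, 1, 2, 3} ∅ σ τ → C.eval τ = s)
    (hF : ∀ i < r, ∀ j < s, ∀ τ, Agree {A, 1, 2, 3} ∅ σ τ →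
      τ.idx 1 0 0 = i → τ.idx 2 0 0 = j →
      b.Within ok τ ∧ (b.Holds τ ↔ T i j) ∧ e.eval τ = F i j)
    (hpost : ∀ τ, Agree {A, 1, 2, 3} ∅ σ τ →
      (∀ i < r, ∀ j < s, τ.idx A i j = if T i j then F i j else 0) → Post τ) :
    Runs k ok (iteI A R C b e) Post σ := by
  -- The innermost loop has exactly one round and serves as a conditional: the entry is 0 before it.
  refine halts_tableI (ok := ok) (k := k) (σ := σ) (Post := Post) hA r s 1 hr hs (by omega)
    (fun i j l x => x = if l = 1 ∧ T i j then F i j else 0) hR hC (fun _ _ => rfl) ?_ ?_ ?_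
  · intros; simp [IExpr.eval]
  · intro i hi j hj l hl τ hτ h1 h2 h3 hI
    obtain ⟨hw, hb, he⟩ := hF i hi j hj τ hτ h1 h2
    obtain rfl : l = 0 := by omega
    refine ⟨hw, fun h => ?_, fun h => ?_⟩
    · rw [if_pos ⟨rfl, hb.1 h⟩, he]
    · rw [hI, if_neg (by simp), if_neg fun h' => h (hb.2 h'.2)]
  · intro τ hτ h
    exact hpost τ hτ fun i hi j hj => by simpa using h i hi j hj

/-- Number arrays with single values as entries. -/
theorem halts_mapN {B : ℕ} {R C : IExpr} {e : NExpr}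
    (r s : ℕ) (hr : r ≤ k + 1) (hs : s ≤ k + 1) (F : ℕ → ℕ → ℝ)
    (hR : ∀ τ, Agree {1, 2, 3} {B} σ τ → R.eval τ = r)

    (hC : ∀ τ, Agree {1, 2, 3} {B} σ τ → C.eval τ = s)
    (hF : ∀ i < r, ∀ j < s, ∀ τ, Agree {1, 2, 3} {B} σ τ →
      τ.idx 1 0 0 = i → τ.idx 2 0 0 = j → e.Within ok τ ∧ e.eval τ = F i j)
    (hpost : ∀ τ, Agree {1, 2, 3} {B} σ τ → (∀ i < r, ∀ j < s, τ.num B i j = F i j) → Post τ) :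
    Runs k ok (mapN B R C e) Post σ :=
  halts_tableN (ok := ok) (k := k) (σ := σ) (Post := Post) r s 0 hr hs (Nat.zero_le _)
    (fun i j l x => x = F i j) hR hC (fun _ _ => rfl) hF (fun _ _ _ _ l hl => absurd hl (by omega))
    hpost

/-- Number arrays with an initial value plus a sum as entries. -/
theorem halts_sumN {B : ℕ} {R C L : IExpr} {e₀ e : NExpr}
    (r s t : ℕ) (hr : r ≤ k + 1) (hs : s ≤ k + 1) (ht : t ≤ k + 1) (a : ℕ → ℕ → ℝ)
    (F : ℕ → ℕ → ℕ → ℝ)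
    (hR : ∀ τ, Agree {1, 2, 3} {B} σ τ → R.eval τ = r)

    (hC : ∀ τ, Agree {1, 2, 3} {B} σ τ → C.eval τ = s)
    (hL : ∀ τ, Agree {1, 2, 3} {B} σ τ → L.eval τ = t)
    (ha : ∀ i < r, ∀ j < s, ∀ τ, Agree {1, 2, 3} {B} σ τ →
      τ.idx 1 0 0 = i → τ.idx 2 0 0 = j → e₀.Within ok τ ∧ e₀.eval τ = a i j)
    (hF : ∀ i < r, ∀ j < s, ∀ l < t, ∀ τ, Agree {1, 2, 3} {B} σ τ →
      τ.idx 1 0 0 = i → τ.idx 2 0 0 = j → τ.idx 3 0 0 = l → e.Within ok τ ∧ e.eval τ = F i j l)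
    (hok : ∀ i < r, ∀ j < s, ∀ l ≤ t, ok (a i j + ∑ l' ∈ Finset.range l, F i j l'))
    (hpost : ∀ τ, Agree {1, 2, 3} {B} σ τ →
      (∀ i < r, ∀ j < s, τ.num B i j = a i j + ∑ l ∈ Finset.range t, F i j l) → Post τ) :
    Runs k ok (sumN B R C L e₀ e) Post σ := by
  refine halts_tableN (ok := ok) (k := k) (σ := σ) (Post := Post) r s t hr hs ht
    (fun i j l x => x = a i j + ∑ l ∈ Finset.range l, F i j l) hR hC hL ?_ ?_ hpost
  · intro i hi j hj τ hτ h1 h2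
    simpa using ha i hi j hj τ hτ h1 h2
  · intro i hi j hj l hl τ hτ h1 h2 h3 hI
    obtain ⟨hw, he⟩ := hF i hi j hj l hl τ hτ h1 h2 h3
    have hval : NExpr.eval τ (.add (.get B (var 1) (var 2)) e) =
        a i j + ∑ l ∈ Finset.range (l + 1), F i j l := by
      simp only [NExpr.eval, IExpr.eval, h1, h2, he, Finset.sum_range_succ, ← add_assoc]
      rw [hI]
    refine ⟨Test.yes_within _ _, fun _ => ⟨⟨?_, hw, ?_⟩, hval⟩,
      fun hb => absurd (Test.yes_holds _) hb⟩
    · have := hok i hi j hj l hl.le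
      simp only [NExpr.Within, NExpr.eval, IExpr.eval, h1, h2]
      rwa [hI]
    · rw [hval]
      exact hok i hi j hj (l + 1) hl

/-- Set the counters to zero. -/
def resetCounters : Program :=
  .seq (.setIdx 1 (.lit 0) (.lit 0) (.lit 0))
    (.seq (.setIdx 2 (.lit 0) (.lit 0) (.lit 0)) (.setIdx 3 (.lit 0) (.lit 0) (.lit 0)))

/-- The number of steps of `resetCounters`. -/
noncomputable def resetTime : ℕ[X] := ((4 : ℕ) : ℕ[X]) + (((4 : ℕ) : ℕ[X]) + ((4 : ℕ) : ℕ[X]))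

theorem halts_resetCounters
    (h : Post (((σ.setIdx 1 0 0 0).setIdx 2 0 0 0).setIdx 3 0 0 0)) :
    Halts k ok resetTime resetCounters Post σ :=
  halts_seq (halts_setIdx (halts_seq (halts_setIdx (halts_setIdx h))))

/-- Local search: look for `i, h < n` and `j < m` with `T(i, j, h)`; if such a triple is found,
perform `p` and start again. If for some `i` there is none, go on with the next `i` if `D(i)` holds,
and otherwise perform `q` and start again. The polynomial `M` bounds the number of times that `p` or
`q` is performed. -/
noncomputable def scan (n m : IExpr) (T D : Test) (p q : Timed) (M : ℕ[X]) : Timed where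
  prog := .seq resetCounters (.loop (.not (.idxLe n (var 1)))
    (.cond (.not (.idxLe m (var 2)))
      (.cond (.not (.idxLe n (var 3)))
        (.cond T (.seq p.prog resetCounters)
          (.setIdx 3 (.lit 0) (.lit 0) (.add (var 3) (.lit 1))))
        (.seq (.setIdx 2 (.lit 0) (.lit 0) (.add (var 2) (.lit 1)))
          (.setIdx 3 (.lit 0) (.lit 0) (.lit 0))))
      (.cond D (.seq (.setIdx 1 (.lit 0) (.lit 0) (.add (var 1) (.lit 1)))
          (.seq (.setIdx 2 (.lit 0) (.lit 0) (.lit 0)) (.setIdx 3 (.lit 0) (.lit 0) (.lit 0))))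
        (.seq q.prog resetCounters))))
  time := resetTime + ((((M + 1) * ((X + 1) * ((X + 1) * (X + 2)))) + 1) *
    ((p.time + resetTime + ((8 : ℕ) : ℕ[X]) + (T.cost : ℕ[X]) +
        (((8 : ℕ) : ℕ[X]) + ((4 : ℕ) : ℕ[X])) + ((Test.not (.idxLe n (var 3))).cost : ℕ[X]) +
      (((8 : ℕ) : ℕ[X]) + (((4 : ℕ) : ℕ[X]) + ((4 : ℕ) : ℕ[X])) + (q.time + resetTime) +
        (D.cost : ℕ[X])) +
      ((Test.not (.idxLe m (var 2))).cost : ℕ[X])) + ((Test.not (.idxLe n (var 1))).cost : ℕ[X])))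

/-- The counters enumerate triples lexicographically, and everything enumerated so far is known to
be inadmissible for the current state. A change of state destroys this knowledge, so the enumeration
restarts, but each change lowers `pot`. The state is seen only through `view`, which ignores the
counters. -/
theorem halts_scan {β : Type} {S : Set ℕ} (hS : {1, 2, 3} ⊆ S) (view : Memory → β)
    (hview : ∀ τ, ∀ D ∈ ({1, 2, 3} : Set ℕ), ∀ v, view (τ.setIdx D 0 0 v) = view τ)
    {en em : IExpr} {T D : Test} {p q : Timed} (n m : ℕ) (hnk : n ≤ k) (hmk : m ≤ k)
    (Inv : β → Prop) (adm : ℕ → ℕ → ℕ → β → Prop) (done : ℕ → β → Prop) (pot : β → ℕ) (M : ℕ[X])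
    (hn : ∀ τ, Agree S ∅ σ τ → en.eval τ = n) (hm : ∀ τ, Agree S ∅ σ τ → em.eval τ = m)
    (hT : ∀ i < n, ∀ j < m, ∀ h < n, ∀ τ, Agree S ∅ σ τ → τ.idx 1 0 0 = i → τ.idx 2 0 0 = j →
      τ.idx 3 0 0 = h → T.Within ok τ ∧ (T.Holds τ ↔ adm i j h (view τ)))
    (hD : ∀ i < n, ∀ τ, Agree S ∅ σ τ → τ.idx 1 0 0 = i →
      D.Within ok τ ∧ (D.Holds τ ↔ done i (view τ)))
    (hp : ∀ i < n, ∀ j < m, ∀ h < n, ∀ τ, Agree S ∅ σ τ → τ.idx 1 0 0 = i → τ.idx 2 0 0 = j →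
      τ.idx 3 0 0 = h → Inv (view τ) → adm i j h (view τ) →
      Runs k ok p (fun υ => Agree S ∅ σ υ ∧ Inv (view υ) ∧ pot (view υ) < pot (view τ)) τ)
    (hq : ∀ i < n, ∀ τ, Agree S ∅ σ τ → τ.idx 1 0 0 = i → Inv (view τ) → ¬ done i (view τ) →
      (∀ j < m, ∀ h < n, ¬ adm i j h (view τ)) →
      Runs k ok q (fun υ => Agree S ∅ σ υ ∧ Inv (view υ) ∧ pot (view υ) < pot (view τ)) τ)
    (hσ : Inv (view σ)) (hM : pot (view σ) ≤ M.eval k)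
    (hpost : ∀ τ, Agree S ∅ σ τ → Inv (view τ) →
      (∀ i < n, done i (view τ) ∧ ∀ j < m, ∀ h < n, ¬ adm i j h (view τ)) → Post τ) :
    Runs k ok (scan en em T D p q M) Post σ := by
  have c1 : ∀ τ v, view (τ.setIdx 1 0 0 v) = view τ := fun τ => hview τ 1 (by simp)
  have c2 : ∀ τ v, view (τ.setIdx 2 0 0 v) = view τ := fun τ => hview τ 2 (by simp)
  have c3 : ∀ τ v, view (τ.setIdx 3 0 0 v) = view τ := fun τ => hview τ 3 (by simp)
  have hS1 : 1 ∈ S := hS (by simp)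
  have hS2 : 2 ∈ S := hS (by simp)
  have hS3 : 3 ∈ S := hS (by simp)
  let I : Memory → Prop := fun τ => Agree S ∅ σ τ ∧ Inv (view τ) ∧
    τ.idx 1 0 0 ≤ n ∧ τ.idx 2 0 0 ≤ m ∧ τ.idx 3 0 0 ≤ n ∧
    (∀ i < τ.idx 1 0 0, done i (view τ) ∧ ∀ j < m, ∀ h < n, ¬ adm i j h (view τ)) ∧
    (∀ j < τ.idx 2 0 0, ∀ h < n, ¬ adm (τ.idx 1 0 0) j h (view τ)) ∧
    (∀ h < τ.idx 3 0 0, ¬ adm (τ.idx 1 0 0) (τ.idx 2 0 0) h (view τ))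
  -- The number of lexicographic steps that remain. The weights are large enough for an increment of
  -- one counter to outweigh resetting the later ones to zero.
  let rank : Memory → ℕ := fun τ => (n - τ.idx 1 0 0) * ((m + 1) * (n + 2)) +
    (m - τ.idx 2 0 0) * (n + 2) + (n - τ.idx 3 0 0)
  let Y := (n + 1) * ((m + 1) * (n + 2))
  have hrank : ∀ τ, rank τ < Y := by
    intro τ
    have h1 : (n - τ.idx 1 0 0) * ((m + 1) * (n + 2)) ≤ n * ((m + 1) * (n + 2)) :=
      Nat.mul_le_mul_right _ (Nat.sub_le _ _)
    have h2 : (m - τ.idx 2 0 0) * (n + 2) ≤ m * (n + 2) := Nat.mul_le_mul_right _ (Nat.sub_le _ _)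
    have h3 : Y = n * ((m + 1) * (n + 2)) + m * (n + 2) + (n + 2) := by
      simp only [Y]; ring
    simp only [rank]
    omega
  -- Since `rank` stays below `Y`, a drop of `pot` lowers this measure however the counters are
  -- reset.
  let μ : Memory → ℕ := fun τ => pot (view τ) * Y + rank τ
  have hdec : ∀ τ υ, pot (view υ) < pot (view τ) → μ υ < μ τ := by
    intro τ υ h
    have : (pot (view υ) + 1) * Y ≤ pot (view τ) * Y := Nat.mul_le_mul_right _ h
    have h2 := hrank υ
    rw [add_mul] at this
    simp only [μ]
    omega
  have hstart : ∀ υ, Agree S ∅ σ υ → Inv (view υ) →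
      I (((υ.setIdx 1 0 0 0).setIdx 2 0 0 0).setIdx 3 0 0 0) := by
    intro υ hυ hI
    refine ⟨((hυ.setIdx hS1 _ _ _).setIdx hS2 _ _ _).setIdx hS3 _ _ _, ?_, ?_⟩
    · simpa only [c1, c2, c3] using hI
    · simp [setIdx_idx]
  have hrestart : ∀ τ υ, pot (view υ) < pot (view τ) →
      μ (((υ.setIdx 1 0 0 0).setIdx 2 0 0 0).setIdx 3 0 0 0) < μ τ := by
    intro τ υ h
    exact hdec _ _ (by simpa only [c1, c2, c3] using h)
  refine halts_seq (halts_resetCounters (halts_loop I μ _ (fun _ _ => trivial) ?_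
    (hstart σ (Agree.refl _ _ _) hσ) ?_ ?_))
  · rintro τ ⟨hτ, hI, hi, hj, hh, hd, ha, hb⟩ hlt
    replace hlt : τ.idx 1 0 0 < n := by
      simpa [Test.Holds, IExpr.eval, hn τ hτ] using hlt
    refine halts_cond trivial (fun hjm => ?_) (fun hjm => ?_)
    · replace hjm : τ.idx 2 0 0 < m := by
        simpa [Test.Holds, IExpr.eval, hm τ hτ] using hjm
      refine halts_cond trivial (fun hhn => ?_) (fun hhn => ?_)
      · replace hhn : τ.idx 3 0 0 < n := by
          simpa [Test.Holds, IExpr.eval, hn τ hτ] using hhn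
        obtain ⟨hw, hiff⟩ := hT _ hlt _ hjm _ hhn τ hτ rfl rfl rfl
        refine halts_cond hw (fun hadm => ?_) (fun hadm => ?_)
        · refine halts_seq ((hp _ hlt _ hjm _ hhn τ hτ rfl rfl rfl hI (hiff.1 hadm)).imp ?_)
          rintro υ ⟨hυ, hIυ, hpot⟩
          exact halts_resetCounters ⟨hstart υ hυ hIυ, hrestart τ υ hpot⟩
        · have hna := fun h => hadm (hiff.2 h)
          refine halts_setIdx ?_
          refine ⟨⟨hτ.setIdx hS3 _ _ _, by simpa only [IExpr.eval, c3] using hI, ?_⟩, ?_⟩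
          · simp only [IExpr.eval, c3, setIdx_idx]
            simp only [OfNat.one_ne_ofNat, Nat.reduceEqDiff, false_and,
              ↓reduceIte, and_self]
            refine ⟨hi, hj, hhn, hd, ha, fun h hlt' => ?_⟩
            rcases Nat.lt_succ_iff_lt_or_eq.1 hlt' with h' | rfl
            · exact hb h h'
            · exact hna
          · simp only [μ, rank, IExpr.eval, c3, setIdx_idx]
            simp only [OfNat.one_ne_ofNat, Nat.reduceEqDiff, false_and,
              ↓reduceIte, and_self]
            omega
      · replace hhn : n = τ.idx 3 0 0 := by
          refine le_antisymm ?_ hh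
          simpa [Test.Holds, IExpr.eval, hn τ hτ] using hhn
        refine halts_seq (halts_setIdx (halts_setIdx ?_))
        refine ⟨⟨(hτ.setIdx hS2 _ _ _).setIdx hS3 _ _ _,
          by simpa only [IExpr.eval, c2, c3] using hI, ?_⟩, ?_⟩
        · simp only [IExpr.eval, c2, c3, setIdx_idx]
          simp only [OfNat.one_ne_ofNat, Nat.reduceEqDiff, false_and,
              ↓reduceIte, and_self]
          refine ⟨hi, hjm, Nat.zero_le _, hd, fun j hlt' => ?_, by simp⟩
          rcases Nat.lt_succ_iff_lt_or_eq.1 hlt' with h' | rfl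
          · exact ha j h'
          · rw [hhn]; exact hb
        · simp only [μ, rank, IExpr.eval, c2, c3, setIdx_idx]
          simp only [OfNat.one_ne_ofNat, Nat.reduceEqDiff, false_and,
              ↓reduceIte, and_self]
          have : (m - τ.idx 2 0 0) * (n + 2) = (m - (τ.idx 2 0 0 + 1)) * (n + 2) + (n + 2) := by
            rw [← Nat.succ_mul]; congr 1; omega
          omega
    · replace hjm : τ.idx 2 0 0 = m := by
        refine le_antisymm hj ?_
        simpa [Test.Holds, IExpr.eval, hm τ hτ] using hjm
      rw [hjm] at ha
      obtain ⟨hw, hiff⟩ := hD _ hlt τ hτ rfl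
      refine halts_cond hw (fun hdn => ?_) (fun hdn => ?_)
      · refine halts_seq (halts_setIdx (halts_seq (halts_setIdx (halts_setIdx ?_))))
        refine ⟨⟨((hτ.setIdx hS1 _ _ _).setIdx hS2 _ _ _).setIdx hS3 _ _ _,
          by simpa only [IExpr.eval, c1, c2, c3] using hI, ?_⟩, ?_⟩
        · simp only [IExpr.eval, c1, c2, c3, setIdx_idx]
          simp only [OfNat.one_ne_ofNat, Nat.reduceEqDiff,
            false_and, ↓reduceIte, and_self]
          refine ⟨hlt, Nat.zero_le _, Nat.zero_le _, fun i hlt' => ?_, by simp, by simp⟩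
          rcases Nat.lt_succ_iff_lt_or_eq.1 hlt' with h' | rfl
          · exact hd i h'
          · exact ⟨hiff.1 hdn, ha⟩
        · simp only [μ, rank, IExpr.eval, c1, c2, c3, setIdx_idx]
          simp only [OfNat.one_ne_ofNat, Nat.reduceEqDiff,
            false_and, ↓reduceIte, and_self]
          have h1 : (n - τ.idx 1 0 0) * ((m + 1) * (n + 2)) =
              (n - (τ.idx 1 0 0 + 1)) * ((m + 1) * (n + 2)) + (m + 1) * (n + 2) := by
            rw [← Nat.succ_mul]; congr 1; omega
          have h2 : (m + 1) * (n + 2) = m * (n + 2) + (n + 2) := by ring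
          simp only [Nat.sub_zero]
          omega
      · refine halts_seq ((hq _ hlt τ hτ rfl hI (fun h => hdn (hiff.2 h)) ha).imp ?_)
        rintro υ ⟨hυ, hIυ, hpot⟩
        exact halts_resetCounters ⟨hstart υ hυ hIυ, hrestart τ υ hpot⟩
  · have h1 : Y ≤ (k + 1) * ((k + 1) * (k + 2)) := by
      simp only [Y]; gcongr
    have h2 := hrank (((σ.setIdx 1 0 0 0).setIdx 2 0 0 0).setIdx 3 0 0 0)
    simp only [eval_mul, eval_add, eval_X, eval_one, eval_ofNat, μ, c1, c2, c3]
    calc _ ≤ M.eval k * Y + Y := by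
          have := Nat.mul_le_mul_right Y hM
          omega
      _ = (M.eval k + 1) * Y := by ring
      _ ≤ _ := Nat.mul_le_mul_left _ h1
  · rintro τ ⟨hτ, hI, hi, hj, hh, hd, ha, hb⟩ hlt
    replace hlt : n = τ.idx 1 0 0 := by
      refine le_antisymm ?_ hi
      simpa [Test.Holds, IExpr.eval, hn τ hτ] using hlt
    refine hpost τ hτ hI ?_
    rw [hlt]
    simpa only [← hlt] using hd

end RAM

/-! ### Competitive equilibria from balanced allocations -/

namespace Chores

variable {n m : ℕ} {c x : Fin n → Fin m → ℝ}

/-- A competitive equilibrium with equal incomes is envy-free. -/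
theorem envyFree_of_equilibrium (p : Fin m → ℝ) (α : Fin n → ℝ) (E : ℝ)
    (hx : ∀ i j, 0 ≤ x i j) (hle : ∀ i j, α i * p j ≤ c i j)
    (heq : ∀ i j, x i j ≠ 0 → c i j = α i * p j) (hE : ∀ i, ∑ j, p j * x i j = E) :
    EnvyFree c x := by
  intro i h
  -- `α i` is a lower bound for the ratio of cost to price, attained on the agent's own bundle; so
  -- this bundle costs `α i * E`, and any other costs at least as much.
  calc bundleCost (c i) (x i) = α i * ∑ j, p j * x i j := by
        rw [bundleCost, Finset.mul_sum]
        refine Finset.sum_congr rfl fun j _ => ?_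
        by_cases h0 : x i j = 0
        · simp [h0]
        · rw [heq i j h0]; ring
    _ = α i * ∑ j, p j * x h j := by rw [hE, hE]
    _ ≤ bundleCost (c i) (x h) := by
        rw [bundleCost, Finset.mul_sum]
        refine Finset.sum_le_sum fun j _ => ?_
        rw [← mul_assoc]
        exact mul_le_mul_of_nonneg_right (hle i j) (hx h j)

/-- A competitive equilibrium is fractionally Pareto optimal. -/
theorem fracParetoOptimal_of_equilibrium (p : Fin m → ℝ) (α : Fin n → ℝ) (hα : ∀ i, 0 < α i)
    (hx : ∀ j, ∑ i, x i j = 1) (hle : ∀ i j, α i * p j ≤ c i j)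
    (heq : ∀ i j, x i j ≠ 0 → c i j = α i * p j) : FracParetoOptimal c x := by
  rintro y ⟨hy, hy1⟩ ⟨hall, h, hlt⟩
  have hcost : ∀ i, (α i)⁻¹ * bundleCost (c i) (x i) = ∑ j, p j * x i j := by
    intro i
    rw [bundleCost, Finset.mul_sum]
    refine Finset.sum_congr rfl fun j _ => ?_
    by_cases h0 : x i j = 0
    · simp [h0]
    · rw [heq i j h0]
      field_simp [(hα i).ne']
  have hcost' : ∀ i, ∑ j, p j * y i j ≤ (α i)⁻¹ * bundleCost (c i) (y i) := by
    intro i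
    rw [bundleCost, Finset.mul_sum]
    refine Finset.sum_le_sum fun j _ => ?_
    rw [← mul_assoc]
    refine mul_le_mul_of_nonneg_right ?_ (hy i j).1
    rw [le_inv_mul_iff₀ (hα i)]
    exact hle i j
  have htot : ∀ z : Fin n → Fin m → ℝ, (∀ j, ∑ i, z i j = 1) →
      ∑ i, ∑ j, p j * z i j = ∑ j, p j := by
    intro z hz
    rw [Finset.sum_comm]
    refine Finset.sum_congr rfl fun j _ => ?_
    rw [← Finset.mul_sum, hz, mul_one]
  -- With weights `(α i)⁻¹`, total cost equals the total price for `x` and is at least the total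
  -- price for every allocation, while a dominating one would lower it.
  have h1 : ∑ i, (α i)⁻¹ * bundleCost (c i) (y i) < ∑ i, (α i)⁻¹ * bundleCost (c i) (x i) :=
    Finset.sum_lt_sum
      (fun i _ => mul_le_mul_of_nonneg_left (hall i) (inv_nonneg.2 (hα i).le))
      ⟨h, Finset.mem_univ _, mul_lt_mul_of_pos_left hlt (inv_pos.2 (hα h))⟩
  have h2 : ∑ j, p j ≤ ∑ i, (α i)⁻¹ * bundleCost (c i) (y i) := by
    rw [← htot y hy1]
    exact Finset.sum_le_sum fun i _ => hcost' i
  rw [Finset.sum_congr rfl fun i _ => hcost i, htot x hx] at h1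
  exact absurd h1 (not_lt.2 h2)

open Classical in
/-- From a balanced allocation `f` of the chores that are easy for somebody (with loads `e`), an
equilibrium with equal incomes arises by doubling the role of prices: the agents outside of `low`
are paid `b` instead of `a` for their chores, and pass on their surplus to the agents in `low`. -/
theorem equilibrium_of_balanced {a b : ℝ} (hn : 0 < n) (ha : 0 < a) (hab : a ≤ b)
    (hc : ∀ i j, c i j = a ∨ c i j = b) (f : Fin n → Fin m → ℝ) (e : Fin n → ℝ)
    (hf0 : ∀ i j, 0 ≤ f i j) (hfa : ∀ i j, f i j ≠ 0 → c i j = a)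
    (hcol : ∀ j, (∃ i, c i j = a) → ∑ i, f i j = 1) (he : ∀ i, e i = ∑ j, f i j)
    (hbal : ∀ h i j, f h j ≠ 0 → c i j = a → e h ≤ e i)
    (K : ℝ) (hK : K = ∑ j, if ∃ i, c i j = a then 0 else 1)
    (S : Fin n → ℝ) (hS : ∀ i, S i = b * K + ∑ h, (if e h ≤ e i then a else b) * e h)
    (low : Fin n → Prop) (hlow : ∀ i, low i ↔ n * (a * e i) ≤ S i)
    (E : ℝ) (hE : E = (b * K + ∑ h, (if low h then a else b) * e h) / n)
    (ρ : Fin n → ℝ) (hρ : ∀ i, ρ i = if low i then 1 else E / (b * e i))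
    (W : ℝ) (hW : W = ∑ h, if low h then E - a * e h else 0)
    (w : Fin n → ℝ) (hw : ∀ i, w i = if low i then (E - a * e i) / W else 0)
    (r : Fin m → ℝ) (hr : ∀ j, r j = 1 - ∑ i, f i j * ρ i)
    (hx : ∀ i j, x i j = f i j * ρ i + r j * w i) :
    IsAllocation x ∧ EnvyFree c x ∧ FracParetoOptimal c x := by
  have hb : 0 < b := ha.trans_le hab
  have hn' : (0 : ℝ) < n := Nat.cast_pos.2 hn
  have he0 : ∀ i, 0 ≤ e i := fun i => by rw [he]; exact Finset.sum_nonneg fun j _ => hf0 i j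
  have hK0 : 0 ≤ K := by
    rw [hK]; exact Finset.sum_nonneg fun j _ => by split_ifs <;> norm_num
  -- `S i` is the total price if the threshold between the prices a and b is put at the load of
  -- agent `i`. It falls as the threshold rises, so `low` is closed under passing to smaller loads.
  have hSanti : ∀ i h, e i ≤ e h → S h ≤ S i := by
    intro i h hih
    rw [hS, hS]
    gcongr with t _
    · exact he0 t
    · split_ifs with h1 h2 h2
      · exact le_rfl
      · exact hab
      · exact absurd (h2.trans hih) h1
      · exact le_rfl
  have hup : ∀ i h, e i ≤ e h → low h → low i := by
    intro i h hih hl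
    rw [hlow] at hl ⊢
    refine le_trans ?_ (hl.trans (hSanti i h hih))
    gcongr
  have hnE : n * E = b * K + ∑ h, (if low h then a else b) * e h := by
    rw [hE]; field_simp
  have hlowE : ∀ i, low i → a * e i ≤ E := by
    intro i hi
    -- For the low agent `t` with the largest load, every low agent is also below the threshold of
    -- `S t`, hence `S t ≤ n * E`.
    obtain ⟨t, ht, hmax⟩ := Finset.exists_max_image (Finset.univ.filter low) e
      ⟨i, by simpa using hi⟩
    have ht' : low t := by simpa using ht
    have h1 : e i ≤ e t := hmax i (by simpa using hi)
    have h2 : S t ≤ n * E := by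
      rw [hnE, hS]
      gcongr with h _
      · exact he0 h
      · split_ifs with h1 h2 h2
        · exact le_rfl
        · exact hab
        · exact absurd (hmax h (by simpa using h2)) h1
        · exact le_rfl
    have h3 := ((hlow t).1 ht').trans h2
    have h4 : a * e t ≤ E := le_of_mul_le_mul_left h3 hn'
    exact le_trans (by gcongr) h4
  have hhighE : ∀ i, ¬ low i → E ≤ b * e i := by
    intro i hi
    obtain ⟨t, ht, hmin⟩ := Finset.exists_min_image (Finset.univ.filter fun i => ¬ low i) e
      ⟨i, by simpa using hi⟩
    have ht' : ¬ low t := by simpa using ht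
    have h1 : e t ≤ e i := hmin i (by simpa using hi)
    -- Here `t` is a least loaded agent that is not low. The prices in `n * E` and `S t` can differ
    -- only for agents whose load ties with that of `t`, and there are at most `n` of them.
    have h2 : n * E ≤ S t + ∑ h : Fin n, (b - a) * e t := by
      rw [hnE, hS, add_assoc, ← Finset.sum_add_distrib]
      gcongr with h _
      split_ifs with h1 h2 h2
      · nlinarith [he0 t]
      · nlinarith [he0 t]
      · have : e t ≤ e h := hmin h (by simpa using h1)
        have : e h = e t := le_antisymm h2 this
        rw [this]; linarith
      · nlinarith [he0 t]
    have h3 : S t < n * (a * e t) := by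
      rw [hlow] at ht'; exact not_le.1 ht'
    rw [Finset.sum_const, Finset.card_univ, Fintype.card_fin, nsmul_eq_mul] at h2
    have h4 : n * E ≤ n * (b * e t) := by nlinarith
    exact (le_of_mul_le_mul_left h4 hn').trans (by gcongr)
  -- An agent without load is always low, so the division by `b * e i` in `ρ i` is genuine wherever
  -- it is used.
  have hhigh0 : ∀ i, ¬ low i → 0 < e i := by
    intro i hi
    refine lt_of_le_of_ne (he0 i) fun h0 => hi ?_
    rw [hlow, ← h0, hS]
    have : 0 ≤ ∑ h, (if e h ≤ 0 then a else b) * e h :=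
      Finset.sum_nonneg fun h _ => mul_nonneg (by split_ifs <;> linarith) (he0 h)
    have := mul_nonneg hb.le hK0
    rw [← h0]
    linarith
  have hE0 : 0 ≤ E := by
    have : 0 ≤ n * E := by
      rw [hnE]
      have : 0 ≤ ∑ h, (if low h then a else b) * e h :=
        Finset.sum_nonneg fun h _ => mul_nonneg (by split_ifs <;> linarith) (he0 h)
      have := mul_nonneg hb.le hK0
      linarith
    exact nonneg_of_mul_nonneg_right this hn'
  have hρ0 : ∀ i, 0 ≤ ρ i := by
    intro i; rw [hρ]; split_ifs
    · norm_num
    · exact div_nonneg hE0 (mul_nonneg hb.le (he0 i))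
  have hρ1 : ∀ i, ρ i ≤ 1 := by
    intro i; rw [hρ]; split_ifs with h
    · exact le_rfl
    · exact div_le_one_of_le₀ (hhighE i h) (mul_nonneg hb.le (he0 i))
  have hcol' : ∀ j, ¬ (∃ i, c i j = a) → ∀ i, f i j = 0 := by
    intro j hj i
    by_contra h
    exact hj ⟨i, hfa i j h⟩
  have hcolle : ∀ j, ∑ i, f i j = if ∃ i, c i j = a then 1 else 0 := by
    intro j
    split_ifs with h
    · exact hcol j h
    · exact Finset.sum_eq_zero fun i _ => hcol' j h i
  have hr0 : ∀ j, 0 ≤ r j := by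
    intro j
    rw [hr, sub_nonneg]
    calc ∑ i, f i j * ρ i ≤ ∑ i, f i j :=
          Finset.sum_le_sum fun i _ => mul_le_of_le_one_right (hf0 i j) (hρ1 i)
      _ ≤ 1 := by rw [hcolle]; split_ifs <;> norm_num
  -- If a low agent finds `j` easy, then by balancedness all holders of `j` have at most that load,
  -- so they are low and keep everything.
  have hrhard : ∀ j, r j ≠ 0 → ∀ i, c i j = a → ¬ low i := by
    intro j hj i hij hi
    apply hj
    rw [hr, ← hcol j ⟨i, hij⟩, ← Finset.sum_sub_distrib]
    refine Finset.sum_eq_zero fun h _ => ?_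
    by_cases h0 : f h j = 0
    · simp [h0]
    · have : low h := hup h i (hbal h i j h0 hij) hi
      rw [hρ, if_pos this]; ring
  -- The incomes missing to low agents are worth exactly what is redistributed at price b, because
  -- `n * E` is the sum of all prices.
  have hWr : W = b * ∑ j, r j := by
    have h1 : ∑ j, r j = K + ∑ i, e i * (1 - ρ i) := by
      have : ∀ j, r j = (if ∃ i, c i j = a then 0 else 1) + ∑ i, f i j * (1 - ρ i) := by
        intro j
        simp only [mul_sub, mul_one, Finset.sum_sub_distrib, hcolle, hr]
        split_ifs <;> ring
      simp only [this, Finset.sum_add_distrib, ← hK]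
      rw [Finset.sum_comm]
      simp only [← Finset.sum_mul, ← he]
    have h2 : ∀ i, b * (e i * (1 - ρ i)) = (if low i then E - a * e i else 0) - E +
        (if low i then a else b) * e i := by
      intro i
      rw [hρ]
      split_ifs with h
      · ring
      · have := (hhigh0 i h).ne'
        field_simp
        ring
    rw [h1, mul_add, Finset.mul_sum, Finset.sum_congr rfl fun i _ => h2 i, Finset.sum_add_distrib,
      Finset.sum_sub_distrib, ← hW, Finset.sum_const, Finset.card_univ, Fintype.card_fin,
      nsmul_eq_mul, hnE]
    ring
  have hW0 : 0 ≤ W := by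
    rw [hWr]; exact mul_nonneg hb.le (Finset.sum_nonneg fun j _ => hr0 j)
  have hw0 : ∀ i, 0 ≤ w i := by
    intro i; rw [hw]; split_ifs with h
    · exact div_nonneg (sub_nonneg.2 (hlowE i h)) hW0
    · exact le_rfl
  have hx0 : ∀ i j, 0 ≤ x i j := fun i j => by
    rw [hx]; exact add_nonneg (mul_nonneg (hf0 i j) (hρ0 i)) (mul_nonneg (hr0 j) (hw0 i))
  -- If `W = 0`, there is nothing to redistribute, and the value of the quotient `w i` does not
  -- matter.
  have hrW : ∀ j, W = 0 → r j = 0 := by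
    intro j h0
    rw [hWr, mul_eq_zero, or_iff_right hb.ne'] at h0
    exact (Finset.sum_eq_zero_iff_of_nonneg fun j _ => hr0 j).1 h0 j (Finset.mem_univ j)
  have hsum : ∀ j, ∑ i, x i j = 1 := by
    intro j
    simp only [hx, Finset.sum_add_distrib, ← Finset.mul_sum]
    have h1 : ∑ i, f i j * ρ i = 1 - r j := by rw [hr]; ring
    rw [h1]
    by_cases h0 : W = 0
    · rw [hrW j h0]; ring
    · have : ∑ i, w i = 1 := by
        have : ∀ i, w i = (if low i then E - a * e i else 0) / W := by
          intro i; rw [hw]; split_ifs <;> simp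
        rw [Finset.sum_congr rfl fun i _ => this i, ← Finset.sum_div, ← hW, div_self h0]
      rw [this]; ring
  have hdist : ∀ i j, x i j ≠ 0 → f i j ≠ 0 ∨ (r j ≠ 0 ∧ low i) := by
    intro i j h
    by_contra hcon
    push Not at hcon
    apply h
    rw [hx, hcon.1]
    by_cases h0 : r j = 0
    · simp [h0]
    · rw [hw, if_neg (hcon.2 h0)]; simp
  -- Chores that are easy for nobody get price b, as the condition is then vacuous. Low agents have
  -- ratio 1 between cost and price, the others a / b.
  let p : Fin m → ℝ := fun j => if ∀ i, c i j = a → ¬ low i then b else a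
  let α : Fin n → ℝ := fun i => if low i then 1 else a / b
  have hα : ∀ i, 0 < α i := fun i => by
    simp only [α]; split_ifs
    · norm_num
    · exact div_pos ha hb
  have hp_easy : ∀ i j, f i j ≠ 0 → p j = if low i then a else b := by
    intro i j hij
    simp only [p]
    by_cases hi : low i
    · rw [if_pos hi, if_neg]
      intro h
      exact h i (hfa i j hij) hi
    · rw [if_neg hi, if_pos]
      intro h hh hl
      exact hi (hup i h (hbal i h j hij hh) hl)
  have hp_hard : ∀ j, r j ≠ 0 → p j = b := fun j hj => if_pos (hrhard j hj)
  have hle : ∀ i j, α i * p j ≤ c i j := by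
    intro i j
    have hac : a ≤ c i j := by rcases hc i j with h | h <;> rw [h]; exact hab
    simp only [α, p]
    split_ifs with h1 h2 h2
    · rw [one_mul]
      rcases hc i j with h | h
      · exact absurd h1 (h2 i h)
      · rw [h]
    · rw [one_mul]; exact hac
    · rw [div_mul_cancel₀ _ hb.ne']; exact hac
    · refine le_trans ?_ hac
      exact mul_le_of_le_one_left ha.le (div_le_one_of_le₀ hab hb.le)
  have heq : ∀ i j, x i j ≠ 0 → c i j = α i * p j := by
    intro i j hij
    rcases hdist i j hij with h | ⟨h, hl⟩
    · rw [hfa i j h, hp_easy i j h]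
      simp only [α]
      split_ifs with h1
      · rw [one_mul]
      · rw [div_mul_cancel₀ _ hb.ne']
    · rw [hp_hard j h]
      simp only [α, if_pos hl, one_mul]
      rcases hc i j with h' | h'
      · exact absurd hl (hrhard j h i h')
      · exact h'
  have hinc : ∀ i, ∑ j, p j * x i j = E := by
    intro i
    have h1 : ∀ j, p j * x i j = (if low i then a else b) * ρ i * f i j + b * w i * r j := by
      intro j
      have e1 : p j * f i j = (if low i then a else b) * f i j := by
        by_cases h0 : f i j = 0
        · simp [h0]
        · rw [hp_easy i j h0]
      have e2 : p j * r j = b * r j := by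
        by_cases h0 : r j = 0
        · simp [h0]
        · rw [hp_hard j h0]
      rw [hx]
      linear_combination ρ i * e1 + w i * e2
    rw [Finset.sum_congr rfl fun j _ => h1 j, Finset.sum_add_distrib, ← Finset.mul_sum,
      ← Finset.mul_sum, ← he]
    have h2 : b * w i * ∑ j, r j = W * w i := by rw [hWr]; ring
    rw [h2, hw, hρ]
    split_ifs with h
    · by_cases h0 : W = 0
      · have hz : ∀ h, 0 ≤ (if low h then E - a * e h else 0) := by
          intro h; split_ifs with hl
          · exact sub_nonneg.2 (hlowE h hl)
          · exact le_rfl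
        rw [hW] at h0
        have := (Finset.sum_eq_zero_iff_of_nonneg fun h _ => hz h).1 h0 i (Finset.mem_univ i)
        rw [if_pos h] at this
        rw [hW, h0]
        linarith
      · field_simp
        ring
    · have := (hhigh0 i h).ne'
      field_simp
      ring
  refine ⟨⟨fun i j => ⟨hx0 i j, ?_⟩, hsum⟩, envyFree_of_equilibrium p α E hx0 hle heq hinc,
    fracParetoOptimal_of_equilibrium p α hα hsum hle heq⟩
  rw [← hsum j]
  exact Finset.single_le_sum (f := fun i => x i j) (fun i _ => hx0 i j) (Finset.mem_univ i)

end Chores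

/-! ### Integral assignments of units, ranks and blocks -/

namespace Chores

open Finset

/-- `f` with the value at `(i, j)` replaced by `v`. -/
def upd (f : ℕ → ℕ → ℕ) (i j v : ℕ) : ℕ → ℕ → ℕ :=
  fun i' j' => if i' = i ∧ j' = j then v else f i' j'

/-- Agent `i` hands over one unit of chore `j` to agent `h`. -/
def moveUnit (y : ℕ → ℕ → ℕ) (i j h : ℕ) : ℕ → ℕ → ℕ :=
  upd (upd y i j (y i j - 1)) h j (upd y i j (y i j - 1) h j + 1)

/-- One unit of load is shifted from agent `i` to agent `h`. -/
def moveLoad (l : ℕ → ℕ → ℕ) (i h : ℕ) : ℕ → ℕ → ℕ := moveUnit l i 0 h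

/-- `y` assigns `u j` units of each chore `j < m` that is adjacent to some agent to adjacent agents
`i < n`, with loads `l i 0`. -/
structure Assigns (n m : ℕ) (adj : ℕ → ℕ → Prop) (u : ℕ → ℕ) (y l : ℕ → ℕ → ℕ) : Prop where
  supp : ∀ i < n, ∀ j < m, 0 < y i j → adj i j
  col : ∀ j < m, (∃ i < n, adj i j) → ∑ i ∈ range n, y i j = u j
  load : ∀ i < n, l i 0 = ∑ j ∈ range m, y i j

variable {n m : ℕ} {adj : ℕ → ℕ → Prop} {u : ℕ → ℕ} {y l : ℕ → ℕ → ℕ}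

theorem moveUnit_apply {i j h : ℕ} (hih : i ≠ h) (i' j' : ℕ) : moveUnit y i j h i' j' =
    if i' = i ∧ j' = j then y i j - 1 else if i' = h ∧ j' = j then y h j + 1 else y i' j' := by
  unfold moveUnit upd
  by_cases hj : j' = j <;> by_cases h1 : i' = i <;> by_cases h2 : i' = h <;> grind

/-- Free of truncated subtraction, this form can be summed over rows and columns. -/
theorem moveUnit_add {i j h : ℕ} (hih : i ≠ h) (hy : 0 < y i j) (i' j' : ℕ) :
    moveUnit y i j h i' j' + (if i' = i ∧ j' = j then 1 else 0) =
      y i' j' + (if i' = h ∧ j' = j then 1 else 0) := by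
  rw [moveUnit_apply hih]
  grind

theorem Assigns.move (ha : Assigns n m adj u y l) {i j h : ℕ} (hi : i < n) (hj : j < m) (hh : h < n)
    (hih : i ≠ h) (hy : 0 < y i j) (hadj : adj h j) :
    Assigns n m adj u (moveUnit y i j h) (moveLoad l i h) where
  supp i' hi' j' hj' h0 := by
    rw [moveUnit_apply hih] at h0
    split_ifs at h0 with h1 h2
    · rw [h1.1, h1.2]; exact ha.supp i hi j hj hy
    · rw [h2.1, h2.2]; exact hadj
    · exact ha.supp i' hi' j' hj' h0
  col j' hj' hex := by
    rw [← ha.col j' hj' hex]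
    have := Finset.sum_congr (rfl : range n = range n)
      fun i' (_ : i' ∈ range n) => moveUnit_add hih hy i' j'
    rw [sum_add_distrib, sum_add_distrib] at this
    by_cases hjj : j' = j
    · simpa [hjj, hi, hh] using this
    · simpa [hjj] using this
  load i' hi' := by
    have hl : 0 < l i 0 := by
      rw [ha.load i hi]
      exact hy.trans_le (single_le_sum (f := fun j => y i j) (fun _ _ => Nat.zero_le _)
        (mem_range.2 hj))
    have h1 := moveUnit_add (y := l) (j := 0) hih hl i' 0
    have := Finset.sum_congr (rfl : range m = range m)
      fun j' (_ : j' ∈ range m) => moveUnit_add hih hy i' j'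
    rw [sum_add_distrib, sum_add_distrib, ← ha.load i' hi'] at this
    have e1 : ∀ t, ∑ j' ∈ range m, (if i' = t ∧ j' = j then 1 else 0) =
        if i' = t then 1 else 0 := by
      intro t
      by_cases ht : i' = t <;> simp [ht, hj]
    rw [e1, e1] at this
    simp only [and_true] at h1
    unfold moveLoad
    omega

theorem Assigns.sum_load_le (ha : Assigns n m adj u y l) :
    ∑ i ∈ range n, l i 0 ≤ ∑ j ∈ range m, u j := by
  rw [Finset.sum_congr rfl fun i hi => ha.load i (mem_range.1 hi), sum_comm]
  refine sum_le_sum fun j hj => ?_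
  by_cases hex : ∃ i < n, adj i j
  · exact (ha.col j (mem_range.1 hj) hex).le
  · rw [sum_eq_zero]
    · exact Nat.zero_le _
    · intro i hi
      by_contra h0
      exact hex ⟨i, mem_range.1 hi, ha.supp i (mem_range.1 hi) j (mem_range.1 hj)
        (Nat.pos_of_ne_zero h0)⟩

theorem sum_range_two {M : Type} [AddCommMonoid M] (f : ℕ → M) {i h : ℕ} (hi : i < n) (hh : h < n)
    (hih : i ≠ h) :
    ∑ t ∈ range n, f t = f i + (f h + ∑ t ∈ ((range n).erase i).erase h, f t) := by
  rw [add_sum_erase _ _ (by simp [hh, hih.symm]), add_sum_erase _ _ (by simp [hi])]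

/-- By convexity of the square; the difference of two excludes that the two loads are merely
exchanged, which would leave the sum unchanged. -/
theorem sum_sq_moveLoad_lt {i h : ℕ} (hi : i < n) (hh : h < n) (hlt : l h 0 + 2 ≤ l i 0) :
    ∑ t ∈ range n, moveLoad l i h t 0 ^ 2 < ∑ t ∈ range n, l t 0 ^ 2 := by
  have hih : i ≠ h := by rintro rfl; omega
  rw [sum_range_two _ hi hh hih, sum_range_two _ hi hh hih]
  have e : ∑ t ∈ ((range n).erase i).erase h, moveLoad l i h t 0 ^ 2 =
      ∑ t ∈ ((range n).erase i).erase h, l t 0 ^ 2 := by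
    refine sum_congr rfl fun t ht => ?_
    simp only [mem_erase] at ht
    simp [moveLoad, moveUnit_apply hih, ht.1, ht.2.1]
  have e1 : moveLoad l i h i 0 = l i 0 - 1 := by simp [moveLoad, moveUnit_apply hih]
  have e2 : moveLoad l i h h 0 = l h 0 + 1 := by simp [moveLoad, moveUnit_apply hih, hih.symm]
  rw [e, e1, e2]
  obtain ⟨d, hd⟩ := Nat.exists_eq_add_of_le hlt
  rw [hd]
  have : l h 0 + 2 + d - 1 = l h 0 + 1 + d := by omega
  rw [this]
  nlinarith

open Classical in
/-- The number of agents `t` above agent `i` for which nobody has exactly one unit less than `t`. -/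
noncomputable def rank (n : ℕ) (l : ℕ → ℕ → ℕ) (i : ℕ) : ℕ :=
  ((range n).filter fun t =>
    l i 0 < l t 0 ∧ ((range n).filter fun s => l s 0 + 1 = l t 0).card = 0).card

/-- If `t` is counted for `h` but not for `i`, then the load of `t` is exactly one more than that of
`h`, so `h` shows that `t` is not at the bottom of a run. In particular, loads in blocks of
different rank differ by at least two. -/
theorem rank_le_rank {i h : ℕ} (hhn : h < n) (hih : l i 0 ≤ l h 0 + 1) :
    rank n l h ≤ rank n l i := by
  classical
  refine card_le_card fun t ht => ?_
  simp only [mem_filter, mem_range] at ht ⊢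
  refine ⟨ht.1, ?_, ht.2.2⟩
  obtain ⟨-, hlt, hbot⟩ := ht
  rcases Nat.lt_or_ge (l i 0) (l t 0) with h1 | h1
  · exact h1
  · exfalso
    rw [card_eq_zero] at hbot
    have : h ∈ (range n).filter fun s => l s 0 + 1 = l t 0 := by
      simp only [mem_filter, mem_range]
      omega
    rw [hbot] at this
    simp at this

/-- Between two agents of equal rank there is no gap: each value between their loads is the load of
some agent, and there are only `n` agents. -/
theorem load_le_of_rank_eq {i h : ℕ} (hhn : h < n) (hrank : rank n l i = rank n l h) :
    l h 0 < l i 0 + n := by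
  classical
  by_contra hcon
  have key : ∀ d, l i 0 + d ≤ l h 0 → ∃ t < n, l t 0 + d = l h 0 := by
    intro d
    induction d with
    | zero => exact fun _ => ⟨h, hhn, rfl⟩
    | succ d ih =>
      intro hd
      obtain ⟨t, ht, htd⟩ := ih (by omega)
      have hbot : ¬ ((range n).filter fun s => l s 0 + 1 = l t 0).card = 0 := by
        intro h0
        -- If no load is one below that of `t`, then `t` is counted in the rank of `i` but not in
        -- that of `h`.
        have hsub : ((range n).filter fun t => l h 0 < l t 0 ∧
            ((range n).filter fun s => l s 0 + 1 = l t 0).card = 0) ⊂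
            (range n).filter fun t => l i 0 < l t 0 ∧
            ((range n).filter fun s => l s 0 + 1 = l t 0).card = 0 := by
          refine (ssubset_iff_of_subset fun s hs => ?_).2 ⟨t, ?_, ?_⟩
          · simp only [mem_filter, mem_range] at hs ⊢
            exact ⟨hs.1, by omega, hs.2.2⟩
          · simp only [mem_filter, mem_range]
            exact ⟨ht, by omega, h0⟩
          · simp only [mem_filter, mem_range, not_and]
            omega
        have := card_lt_card hsub
        unfold rank at hrank
        omega
      obtain ⟨s, hs⟩ := card_pos.1 (Nat.pos_of_ne_zero hbot)
      simp only [mem_filter, mem_range] at hs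
      exact ⟨s, hs.1, by omega⟩
  -- A distance of at least `n` gives `n + 1` different loads of `n` agents.
  have hsub : (range (n + 1)).image (fun d => l h 0 - d) ⊆ (range n).image fun t => l t 0 := by
    intro v hv
    simp only [mem_image, mem_range] at hv ⊢
    obtain ⟨d, hd, rfl⟩ := hv
    obtain ⟨t, ht, h1⟩ := key d (by omega)
    exact ⟨t, ht, by omega⟩
  have h1 := card_le_card hsub
  rw [card_image_of_injOn] at h1
  · have := h1.trans card_image_le
    simp at this
  · intro d hd d' hd' hdd
    simp only [coe_range, Set.mem_Iio] at hd hd'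
    simp only at hdd
    omega

/-- A partition of the agents into blocks (with equal rank) such that the chores of a block can be
distributed evenly among its agents. -/
structure Blocks (n m : ℕ) (E : ℕ → ℕ → Prop) (rk size cap u : ℕ → ℕ) : Prop where
  rk_eq : ∀ i < n, ∀ h < n, ∀ j < m, E i j → E h j → rk i = rk h
  u_eq : ∀ i < n, ∀ j < m, E i j → u j = size i
  cap_eq : ∀ i < n, ∀ h < n, rk i = rk h → cap i = cap h
  size_eq : ∀ i < n, size i = #{h ∈ range n | rk h = rk i}
  cap_sum : ∀ i < n, ∀ C : Finset ℕ, (∀ j, j ∈ C ↔ j < m ∧ ∃ h < n, E h j ∧ rk h = rk i) →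
    #C = cap i
  hall : ∀ i < n, ∀ S T : Finset ℕ, (∀ h ∈ S, h < n ∧ rk h = rk i) →
    (∀ j ∈ T, j < m ∧ (∃ h < n, E h j ∧ rk h = rk i) ∧ ∀ h < n, E h j → h ∈ S) →
    #T * size i ≤ cap i * #S

/-- The adjacency between chores and the agents in their blocks. -/
def blockAdj (n : ℕ) (adj : ℕ → ℕ → Prop) (l : ℕ → ℕ → ℕ) (i j : ℕ) : Prop :=
  adj i j ∧ ∀ h < n, adj h j → rank n l h ≤ rank n l i

open Classical in
/-- The number of agents in the block of agent `i`. -/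
noncomputable def blockSize (n : ℕ) (l : ℕ → ℕ → ℕ) (i : ℕ) : ℕ :=
  #{h ∈ range n | rank n l h = rank n l i}

/-- Chore `j` belongs to the block of agent `i`. -/
def blockMem (n : ℕ) (adj : ℕ → ℕ → Prop) (l : ℕ → ℕ → ℕ) (i j : ℕ) : Prop :=
  ∃ h < n, blockAdj n adj l h j ∧ rank n l h = rank n l i

open Classical in
/-- The number of chores in the block of agent `i`. -/
noncomputable def blockCap (n m : ℕ) (adj : ℕ → ℕ → Prop) (l : ℕ → ℕ → ℕ) (i : ℕ) : ℕ :=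
  #{j ∈ range m | blockMem n adj l i j}

open Classical in
/-- The number of agents in the block of chore `j`. -/
noncomputable def blockUnits (n : ℕ) (adj : ℕ → ℕ → Prop) (l : ℕ → ℕ → ℕ) (j : ℕ) : ℕ :=
  #{i ∈ range n | blockMem n adj l i j}

theorem blockAdj_rank_eq {i h j : ℕ} (hi : i < n) (hh : h < n) (h1 : blockAdj n adj l i j)
    (h2 : blockAdj n adj l h j) : rank n l i = rank n l h :=
  le_antisymm (h2.2 i hi h1.1) (h1.2 h hh h2.1)

/-- In `y`, no unit can be moved to an agent with a load that is smaller by at least two. -/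
def Stable (n m : ℕ) (adj : ℕ → ℕ → Prop) (y l : ℕ → ℕ → ℕ) : Prop :=
  ∀ i < n, ∀ j < m, ∀ h < n, 0 < y i j → adj h j → l i 0 ≤ l h 0 + 1

/-- Stability forbids a holder of `j` to be two or more units above another agent adjacent to `j`,
so no adjacent agent has higher rank. -/
theorem blockAdj_of_pos (ha : Assigns n m adj u y l) (hs : Stable n m adj y l) {i j : ℕ} (hi : i < n)
    (hj : j < m) (hy : 0 < y i j) : blockAdj n adj l i j :=
  ⟨ha.supp i hi j hj hy, fun h hh hadj => rank_le_rank hh (hs i hi j hj h hh hy hadj)⟩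

/-- All `N` units of a chore lie in the block of the chore, and no units of other chores do. -/
theorem sum_block_load {N : ℕ} (ha : Assigns n m adj (fun _ => N) y l) (hs : Stable n m adj y l)
    (i : ℕ) :
    ∑ h ∈ range n with rank n l h = rank n l i, l h 0 = N * blockCap n m adj l i := by
  classical
  have h1 : ∀ h ∈ (range n).filter (fun h => rank n l h = rank n l i),
      l h 0 = ∑ j ∈ range m, y h j :=
    fun h hh => ha.load h (mem_range.1 (mem_filter.1 hh).1)
  rw [sum_congr rfl h1, sum_comm, blockCap, card_filter, mul_sum]
  refine sum_congr rfl fun j hj => ?_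
  rw [mem_range] at hj
  split_ifs with hmem
  · obtain ⟨t, ht, htj, htr⟩ := hmem
    rw [mul_one, ← ha.col j hj ⟨t, ht, htj.1⟩, sum_filter]
    refine sum_congr rfl fun h hh => ?_
    rw [mem_range] at hh
    split_ifs with hr
    · rfl
    · by_contra h0
      exact hr ((blockAdj_rank_eq hh ht (blockAdj_of_pos ha hs hh hj
        (Nat.pos_of_ne_zero (Ne.symm h0))) htj).trans htr)
  · rw [mul_zero]
    refine sum_eq_zero fun h hh => ?_
    rw [mem_filter, mem_range] at hh
    by_contra h0
    exact hmem ⟨h, hh.1, blockAdj_of_pos ha hs hh.1 hj (Nat.pos_of_ne_zero h0), hh.2⟩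

theorem blockSize_le (i : ℕ) : blockSize n l i ≤ n := by
  classical
  exact (card_filter_le _ _).trans (by simp)

theorem blockCap_le (i : ℕ) : blockCap n m adj l i ≤ m := by
  classical
  exact (card_filter_le _ _).trans (by simp)

theorem blockUnits_le (j : ℕ) : blockUnits n adj l j ≤ n := by
  classical
  exact (card_filter_le _ _).trans (by simp)

theorem blockSize_pos {i : ℕ} (hi : i < n) : 0 < blockSize n l i := by
  classical
  exact card_pos.2 ⟨i, by simp [hi]⟩

theorem blockCap_congr {i h : ℕ} (hr : rank n l i = rank n l h) :
    blockCap n m adj l i = blockCap n m adj l h := by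
  classical
  unfold blockCap
  congr 1
  ext j
  rw [mem_filter, mem_filter]
  simp only [blockMem, hr]

theorem blockSize_congr {i h : ℕ} (hr : rank n l i = rank n l h) :
    blockSize n l i = blockSize n l h := by
  simp only [blockSize, hr]

/-- In a stable assignment of sufficiently many units, blocks of higher rank have smaller
averages. -/
theorem blockCap_mul_le {N : ℕ} (hN : 0 < N) (ha : Assigns n m adj (fun _ => N) y l)
    (hs : Stable n m adj y l) {i h : ℕ} (hrank : rank n l i ≤ rank n l h) :
    blockCap n m adj l h * blockSize n l i ≤ blockCap n m adj l i * blockSize n l h := by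
  classical
  rcases hrank.eq_or_lt with heq | hlt
  · rw [blockCap_congr heq, blockSize_congr heq]
  · refine Nat.le_of_mul_le_mul_left ?_ hN
    rw [← mul_assoc, ← mul_assoc, ← sum_block_load ha hs, ← sum_block_load ha hs, blockSize,
      blockSize, card_eq_sum_ones, card_eq_sum_ones, sum_mul_sum, sum_mul_sum, sum_comm]
    refine sum_le_sum fun s hs' => sum_le_sum fun t ht' => ?_
    rw [mem_filter, mem_range] at hs' ht'
    rw [mul_one, mul_one]
    by_contra hcon
    have := rank_le_rank (n := n) (l := l) (i := s) (h := t) ht'.1 (by omega)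
    omega

/-- The Hall condition is the point. The agents in `S` hold all units of `T`, and each of them is
less than `n` above any load in the block, hence near the average. This yields the inequality up to
an error of at most n³, which is smaller than the number of units per chore and therefore disappears
by integrality. -/
theorem blocks_of_stable (ha : Assigns n m adj (fun _ => n * (n * n) + 1) y l)
    (hs : Stable n m adj y l) :
    Blocks n m (blockAdj n adj l) (rank n l) (blockSize n l) (blockCap n m adj l)
      (blockUnits n adj l) where
  rk_eq i hi h hh j hj h1 h2 := blockAdj_rank_eq hi hh h1 h2
  u_eq i hi j hj hE := by
    classical
    unfold blockUnits blockSize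
    congr 1
    refine filter_congr fun t ht => ?_
    constructor
    · rintro ⟨h, hh, hhE, hr⟩
      rw [← hr, blockAdj_rank_eq hh hi hhE hE]
    · intro hr
      exact ⟨i, hi, hE, hr.symm⟩
  cap_eq i hi h hh hr := blockCap_congr hr
  size_eq i hi := by
    classical
    unfold blockSize
    congr
  cap_sum i hi C hC := by
    classical
    unfold blockCap
    congr 1
    ext j
    rw [hC, mem_filter, mem_range]
    rfl
  hall i hi S T hS hT := by
    classical
    set N := n * (n * n) + 1 with hN
    have h1 : N * #T ≤ ∑ h ∈ S, l h 0 := by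
      calc N * #T = ∑ j ∈ T, ∑ h ∈ S, y h j := by
            rw [mul_comm, ← smul_eq_mul, ← sum_const]
            refine sum_congr rfl fun j hj => ?_
            obtain ⟨hjm, ⟨t, ht, htE, -⟩, hall⟩ := hT j hj
            rw [← ha.col j hjm ⟨t, ht, htE.1⟩]
            refine (sum_subset (fun h hh => mem_range.2 (hS h hh).1) fun h hh hhS => ?_).symm
            by_contra h0
            rw [mem_range] at hh
            exact hhS (hall h hh (blockAdj_of_pos ha hs hh hjm (Nat.pos_of_ne_zero h0)))
        _ = ∑ h ∈ S, ∑ j ∈ T, y h j := sum_comm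
        _ ≤ ∑ h ∈ S, l h 0 := by
            refine sum_le_sum fun h hh => ?_
            rw [ha.load h (hS h hh).1]
            exact sum_le_sum_of_subset fun j hj => mem_range.2 (hT j hj).1
    -- Compare the load of `h` with every load in the block and sum: at most `n` comparisons, each
    -- with error at most `n`.
    have h2 : ∀ h ∈ S, l h 0 * blockSize n l i ≤ N * blockCap n m adj l i + n * n := by
      intro h hh
      obtain ⟨hhn, hr⟩ := hS h hh
      rw [← sum_block_load ha hs i]
      calc l h 0 * blockSize n l i = ∑ t ∈ range n with rank n l t = rank n l i, l h 0 := by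
            rw [sum_const, smul_eq_mul, mul_comm]
            unfold blockSize
            congr
        _ ≤ ∑ t ∈ range n with rank n l t = rank n l i, (l t 0 + n) := by
            refine sum_le_sum fun t ht => ?_
            rw [mem_filter] at ht
            exact (load_le_of_rank_eq hhn (ht.2.trans hr.symm)).le
        _ ≤ _ := by
            rw [sum_add_distrib, sum_const, smul_eq_mul]
            gcongr
            exact (card_filter_le _ _).trans (by simp)
    have hcard : #S ≤ n := by
      have := card_le_card (fun h hh => mem_range.2 (hS h hh).1 : S ⊆ range n)
      simpa using this
    have h3 : N * (#T * blockSize n l i) ≤ #S * (N * blockCap n m adj l i + n * n) := by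
      calc N * (#T * blockSize n l i) ≤ (∑ h ∈ S, l h 0) * blockSize n l i := by
            rw [← mul_assoc]; exact Nat.mul_le_mul_right _ h1
        _ = ∑ h ∈ S, l h 0 * blockSize n l i := sum_mul _ _ _
        _ ≤ ∑ h ∈ S, (N * blockCap n m adj l i + n * n) := sum_le_sum h2
        _ = _ := by rw [sum_const, smul_eq_mul]
    -- This determines the number of units per chore.
    have h4 : #S * (n * n) < N := by
      have := Nat.mul_le_mul_right (n * n) hcard
      omega
    have h5 : N * (#T * blockSize n l i) < N * (blockCap n m adj l i * #S + 1) := by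
      calc _ ≤ _ := h3
        _ = N * (blockCap n m adj l i * #S) + #S * (n * n) := by ring
        _ < N * (blockCap n m adj l i * #S) + N := by omega
        _ = _ := by ring
    have := Nat.lt_of_mul_lt_mul_left h5
    omega

end Chores

/-! ### Push-relabel search for an even distribution in each block -/

namespace Chores

open Finset

variable {n m : ℕ} {E : ℕ → ℕ → Prop} {rk size cap u : ℕ → ℕ} {y l H : ℕ → ℕ → ℕ}

/-- The invariant of the push-relabel search for an even distribution of the chores in each block:
agents with a positive height `H i 0` carry at least their share `cap i`, and units can be handed
over only to agents that are at most one step lower. -/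
structure Preflow (n m : ℕ) (E : ℕ → ℕ → Prop) (cap u : ℕ → ℕ) (y l H : ℕ → ℕ → ℕ) : Prop where
  assigns : Assigns n m E u y l
  valid : ∀ i < n, ∀ j < m, ∀ h < n, 0 < y i j → E h j → H i 0 ≤ H h 0 + 1
  full : ∀ i < n, 0 < H i 0 → cap i ≤ l i 0
  height : ∀ i < n, H i 0 ≤ n

/-- Gap argument: above an unoccupied height, the agents of the block of `i` hold only chores that
nobody below may take over. They all carry at least their share and `i` carries more, which violates
the Hall condition. -/
theorem Preflow.height_lt (hB : Blocks n m E rk size cap u) (hP : Preflow n m E cap u y l H) {i : ℕ}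
    (hi : i < n) (hex : cap i < l i 0) : H i 0 < n := by
  classical
  by_contra hcon
  -- The `n - 1` agents other than `i` cannot occupy all heights from 0 to `n - 1`, and `i` is above
  -- them.
  have hv : ∃ v < n, ∀ h < n, H h 0 ≠ v := by
    have hcard : #(((range n).erase i).image fun h => H h 0) < #(range n) := by
      refine card_image_le.trans_lt ?_
      rw [card_erase_of_mem (mem_range.2 hi), card_range]
      omega
    obtain ⟨v, hv, hv'⟩ := exists_mem_notMem_of_card_lt_card hcard
    rw [mem_range] at hv
    refine ⟨v, hv, fun h hh heq => ?_⟩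
    by_cases hih : h = i
    · rw [hih] at heq; omega
    · exact hv' (mem_image.2 ⟨h, mem_erase.2 ⟨hih, mem_range.2 hh⟩, heq⟩)
  obtain ⟨v, hvn, hv⟩ := hv
  set S := (range n).filter fun h => rk h = rk i ∧ v < H h 0 with hSdef
  set T := (range m).filter fun j => ∃ h ∈ S, 0 < y h j with hTdef
  have hS : ∀ h, h ∈ S ↔ h < n ∧ rk h = rk i ∧ v < H h 0 := by simp [hSdef]
  have hT : ∀ j ∈ T, j < m ∧ (∃ h < n, E h j ∧ rk h = rk i) ∧ ∀ h < n, E h j → h ∈ S := by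
    intro j hj
    simp only [hTdef, mem_filter, mem_range] at hj
    obtain ⟨hjm, h, hh, hy⟩ := hj
    rw [hS] at hh
    have hE := hP.assigns.supp h hh.1 j hjm hy
    refine ⟨hjm, ⟨h, hh.1, hE, hh.2.1⟩, fun t ht htE => (hS t).2 ⟨ht, ?_, ?_⟩⟩
    · rw [hB.rk_eq t ht h hh.1 j hjm htE hE, hh.2.1]
    -- Along an admissible transfer the height drops by at most one, so it cannot jump across the
    -- empty height `v`.
    · have h1 := hP.valid h hh.1 j hjm t ht hy htE
      have h2 := hv t ht
      omega
  have hhall := hB.hall i hi S T (fun h hh => ⟨((hS h).1 hh).1, ((hS h).1 hh).2.1⟩) hT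
  have h1 : ∑ h ∈ S, l h 0 ≤ #T * size i := by
    calc ∑ h ∈ S, l h 0 = ∑ h ∈ S, ∑ j ∈ T, y h j := by
          refine sum_congr rfl fun h hh => ?_
          rw [hP.assigns.load h ((hS h).1 hh).1]
          refine (sum_subset (filter_subset _ _) fun j hj hjT => ?_).symm
          by_contra h0
          exact hjT (mem_filter.2 ⟨hj, h, hh, Nat.pos_of_ne_zero h0⟩)
      _ = ∑ j ∈ T, ∑ h ∈ S, y h j := sum_comm
      _ ≤ ∑ j ∈ T, size i := by
          refine sum_le_sum fun j hj => ?_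
          obtain ⟨hjm, ⟨h, hh, hhE, hhr⟩, -⟩ := hT j hj
          have h2 : u j = size i := by
            rw [hB.u_eq h hh j hjm hhE, hB.size_eq h hh, hB.size_eq i hi, hhr]
          rw [← h2, ← hP.assigns.col j hjm ⟨h, hh, hhE⟩]
          exact sum_le_sum_of_subset (filter_subset _ _)
      _ = _ := by rw [sum_const, smul_eq_mul]
  have h2 : cap i * #S < ∑ h ∈ S, l h 0 := by
    rw [mul_comm, ← smul_eq_mul, ← sum_const]
    refine sum_lt_sum (fun h hh => ?_) ⟨i, (hS i).2 ⟨hi, rfl, by omega⟩, hex⟩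
    rw [hS] at hh
    rw [hB.cap_eq i hi h hh.1 hh.2.1.symm]
    exact hP.full h hh.1 (by omega)
  omega

/-- The giver had an excess and so keeps its share. The receiver is lower than the giver, so
validity for the unit received is inherited from the giver. -/
theorem Preflow.move (hP : Preflow n m E cap u y l H) {i j h : ℕ} (hi : i < n) (hj : j < m)
    (hh : h < n) (hy : 0 < y i j) (hadj : E h j) (hex : cap i < l i 0) (hH : H h 0 < H i 0) :
    Preflow n m E cap u (moveUnit y i j h) (moveLoad l i h) H := by
  have hih : i ≠ h := by rintro rfl; omega
  refine ⟨hP.assigns.move hi hj hh hih hy hadj, fun i' hi' j' hj' h' hh' hy' hE' => ?_,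
    fun i' hi' h0 => ?_, hP.height⟩
  · rw [moveUnit_apply hih] at hy'
    split_ifs at hy' with h1 h2
    · rw [h1.1]; rw [h1.2] at hE'
      exact hP.valid i hi j hj h' hh' hy hE'
    · rw [h2.1]; rw [h2.2] at hE'
      have := hP.valid i hi j hj h' hh' hy hE'
      omega
    · exact hP.valid i' hi' j' hj' h' hh' hy' hE'
  · unfold moveLoad
    rw [moveUnit_apply hih]
    have := hP.full i' hi' h0
    split_ifs with h1 h2
    · rw [h1.1]; omega
    · rw [h2.1] at this ⊢; omega
    · exact this

/-- As no possible receiver is lower than `i`, one more step of height keeps transfers valid; the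
excess guarantees the share that positive height requires, and bounds the height through
`Preflow.height_lt`. -/
theorem Preflow.raise (hB : Blocks n m E rk size cap u) (hP : Preflow n m E cap u y l H) {i : ℕ}
    (hi : i < n) (hex : cap i < l i 0)
    (hno : ∀ j < m, ∀ h < n, ¬ (0 < y i j ∧ E h j ∧ H h 0 < H i 0)) :
    Preflow n m E cap u y l (upd H i 0 (H i 0 + 1)) := by
  have hup : ∀ t, upd H i 0 (H i 0 + 1) t 0 = if t = i then H i 0 + 1 else H t 0 := by
    intro t; simp [upd]
  refine ⟨hP.assigns, fun i' hi' j hj h hh hy hE => ?_, fun t ht h0 => ?_, fun t ht => ?_⟩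
  · rw [hup, hup]
    have h1 := hP.valid i' hi' j hj h hh hy hE
    split_ifs with h2 h3 h3
    · omega
    · have := hno j hj h hh
      rw [h2] at hy
      simp only [hy, hE, true_and, not_lt] at this
      omega
    · rw [h3] at h1; omega
    · exact h1
  · rw [hup] at h0
    split_ifs at h0 with h1
    · rw [h1]; exact hex.le
    · exact hP.full t ht h0
  · rw [hup]
    split_ifs with h1
    · exact hP.height_lt hB hi hex
    · exact hP.height t ht

/-- The potential of the push-relabel search. -/
def heightPot (n U : ℕ) (l H : ℕ → ℕ → ℕ) : ℕ :=
  ∑ i ∈ range n, ((n - H i 0) * (U + 1) + l i 0 * H i 0)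

/-- The moved unit is now counted with a smaller height. -/
theorem heightPot_move {U i h : ℕ} (hi : i < n) (hh : h < n) (hl : 0 < l i 0) (hH : H h 0 < H i 0) :
    heightPot n U (moveLoad l i h) H < heightPot n U l H := by
  have hih : i ≠ h := by rintro rfl; omega
  unfold heightPot
  rw [sum_range_two _ hi hh hih, sum_range_two _ hi hh hih]
  have e : ∑ t ∈ ((range n).erase i).erase h, ((n - H t 0) * (U + 1) + moveLoad l i h t 0 * H t 0) =
      ∑ t ∈ ((range n).erase i).erase h, ((n - H t 0) * (U + 1) + l t 0 * H t 0) := by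
    refine sum_congr rfl fun t ht => ?_
    simp only [mem_erase] at ht
    simp [moveLoad, moveUnit_apply hih, ht.1, ht.2.1]
  have e1 : moveLoad l i h i 0 = l i 0 - 1 := by simp [moveLoad, moveUnit_apply hih]
  have e2 : moveLoad l i h h 0 = l h 0 + 1 := by simp [moveLoad, moveUnit_apply hih, hih.symm]
  rw [e, e1, e2]
  obtain ⟨d, hd⟩ := Nat.exists_eq_succ_of_ne_zero hl.ne'
  rw [hd, Nat.succ_sub_one, Nat.succ_mul, Nat.succ_mul]
  omega

/-- The first term loses `U + 1`, while the second gains only the load of `i`, at most `U`. -/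
theorem heightPot_raise {U i : ℕ} (hi : i < n) (hl : l i 0 ≤ U) (hH : H i 0 < n) :
    heightPot n U l (upd H i 0 (H i 0 + 1)) < heightPot n U l H := by
  unfold heightPot
  rw [← add_sum_erase _ _ (mem_range.2 hi), ← add_sum_erase _ _ (mem_range.2 hi)]
  have e : ∑ t ∈ (range n).erase i, ((n - upd H i 0 (H i 0 + 1) t 0) * (U + 1) +
      l t 0 * upd H i 0 (H i 0 + 1) t 0) =
      ∑ t ∈ (range n).erase i, ((n - H t 0) * (U + 1) + l t 0 * H t 0) := by
    refine sum_congr rfl fun t ht => ?_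
    simp [upd, (mem_erase.1 ht).1]
  have e1 : upd H i 0 (H i 0 + 1) i 0 = H i 0 + 1 := by simp [upd]
  have e2 : (n - H i 0) * (U + 1) = (n - (H i 0 + 1)) * (U + 1) + (U + 1) := by
    rw [← Nat.succ_mul]; congr 1; omega
  rw [e, e1, e2, mul_add_one (l i 0)]
  omega

/-- The units of a block number `cap i * size i`, which is also the sum of the shares of its agents;
so no agent can be below its share. -/
theorem Preflow.load_eq (hB : Blocks n m E rk size cap u) (hP : Preflow n m E cap u y l H)
    (hle : ∀ i < n, l i 0 ≤ cap i) {i : ℕ} (hi : i < n) : l i 0 = cap i := by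
  classical
  set B := (range n).filter fun h => rk h = rk i with hBdef
  set C := (range m).filter fun j => ∃ h < n, E h j ∧ rk h = rk i with hCdef
  have hsum : ∑ h ∈ B, l h 0 = ∑ h ∈ B, cap h := by
    calc ∑ h ∈ B, l h 0 = ∑ h ∈ B, ∑ j ∈ C, y h j := by
          refine sum_congr rfl fun h hh => ?_
          simp only [hBdef, mem_filter, mem_range] at hh
          rw [hP.assigns.load h hh.1]
          refine (sum_subset (filter_subset _ _) fun j hj hjC => ?_).symm
          by_contra h0
          exact hjC (mem_filter.2 ⟨hj, h, hh.1,
            hP.assigns.supp h hh.1 j (mem_range.1 hj) (Nat.pos_of_ne_zero h0), hh.2⟩)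
      _ = ∑ j ∈ C, ∑ h ∈ B, y h j := sum_comm
      _ = ∑ j ∈ C, size i := by
          refine sum_congr rfl fun j hj => ?_
          simp only [hCdef, mem_filter, mem_range] at hj
          obtain ⟨hjm, h, hh, hhE, hhr⟩ := hj
          have h2 : u j = size i := by
            rw [hB.u_eq h hh j hjm hhE, hB.size_eq h hh, hB.size_eq i hi, hhr]
          rw [← h2, ← hP.assigns.col j hjm ⟨h, hh, hhE⟩]
          refine sum_subset (filter_subset _ _) fun t ht htB => ?_
          by_contra h0
          rw [mem_range] at ht
          refine htB (mem_filter.2 ⟨mem_range.2 ht, ?_⟩)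
          rw [← hhr]
          exact hB.rk_eq t ht h hh j hjm (hP.assigns.supp t ht j hjm (Nat.pos_of_ne_zero h0)) hhE
      _ = #B * cap i := by
          rw [sum_const, smul_eq_mul, hB.size_eq i hi, mul_comm,
            hB.cap_sum i hi C (by simp [hCdef])]
      _ = ∑ h ∈ B, cap h := by
          rw [← smul_eq_mul, ← sum_const]
          refine sum_congr rfl fun h hh => ?_
          simp only [hBdef, mem_filter, mem_range] at hh
          exact hB.cap_eq i hi h hh.1 hh.2.symm
  refine (sum_eq_sum_iff_of_le fun h hh => hle h (mem_range.1 (mem_filter.1 hh).1)).1 hsum i ?_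
  exact mem_filter.2 ⟨mem_range.2 hi, rfl⟩

end Chores

/-! ### Programs for initial assignments and moves of units -/

namespace RAM

open Polynomial Chores

variable {k : ℕ} {ok : ℝ → Prop} {Post : Memory → Prop} {σ : Memory} {n m : ℕ}

theorem Agree.mono {S S' T T' : Set ℕ} {σ τ : Memory} (h : Agree S T σ τ) (hS : S ⊆ S')
    (hT : T ⊆ T') : Agree S' T' σ τ :=
  ⟨fun A hA => h.idx A fun hA' => hA (hS hA'), fun A hA => h.num A fun hA' => hA (hT hA')⟩

theorem Agree.trans {S T : Set ℕ} {σ τ υ : Memory} (h : Agree S T σ τ) (h' : Agree S T τ υ) :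
    Agree S T σ υ :=
  ⟨fun A hA => (h'.idx A hA).trans (h.idx A hA), fun A hA => (h'.num A hA).trans (h.num A hA)⟩

/-- The number of agents. -/
abbrev numAgents : IExpr := var 0

/-- The number of chores. -/
abbrev numChores : IExpr := .get 0 (.lit 0) (.lit 1)

/-- `e < f`. -/
abbrev Test.idxLt (e f : IExpr) : Test := .idxLe (.add e (.lit 1)) f

/-- Give all units of each chore to the first adjacent agent. -/
noncomputable def distribute (adj units first y load : ℕ) : Timed :=
  .seq (countI first numAgents numChores numAgents
      (.and (.idxLt (.lit 0) (.get adj (var 3) (var 2))) (.idxLt (var 3) (var 1))))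
    (.seq (iteI y numAgents numChores
        (.and (.idxLt (.lit 0) (.get adj (var 1) (var 2)))
          (.idxLe (.get first (var 1) (var 2)) (.lit 0)))
        (.get units (var 2) (.lit 0)))
      (sumI load numAgents (.lit 1) numChores (.get y (var 1) (var 3))))

/-- The array `first` counts the adjacent agents before agent `i`; an adjacent agent with count zero
is the unique recipient. -/
theorem halts_distribute {adj units first y load : ℕ} (hnm : n + m ≤ k)
    (hn : σ.idx 0 0 0 = n) (hm : σ.idx 0 0 1 = m) (h0 : 4 ≤ adj) (h1 : 4 ≤ units) (h2 : 4 ≤ first)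
    (h3 : 4 ≤ y) (h4 : 4 ≤ load) (had : adj ≠ first ∧ adj ≠ y) (hu : units ≠ first ∧ units ≠ y)
    (hy : y ≠ first ∧ y ≠ load)
    (hpost : ∀ τ, Agree {first, y, load, 1, 2, 3} ∅ σ τ →
      Assigns n m (fun i j => 0 < σ.idx adj i j) (fun j => σ.idx units j 0) (τ.idx y) (τ.idx load) →
      Post τ) :
    Runs k ok (distribute adj units first y load) Post σ := by
  classical
  have hk1 : n ≤ k + 1 := by omega
  have hk2 : m ≤ k + 1 := by omega
  refine runs_seq (halts_count ⟨by omega, by omega, by omega⟩ n m n hk1 hk2 hk1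
    (fun i j h => 0 < σ.idx adj h j ∧ h < i) ?_ ?_ ?_ ?_ ?_)
  · intro τ hτ; simp [IExpr.eval, hτ.idx 0 (by simp; omega), hn]
  · intro τ hτ; simp [IExpr.eval, hτ.idx 0 (by simp; omega), hm]
  · intro τ hτ; simp [IExpr.eval, hτ.idx 0 (by simp; omega), hn]
  · intro i hi j hj l hl τ hτ e1 e2 e3
    refine ⟨⟨trivial, trivial⟩, ?_⟩
    simp [Test.Holds, IExpr.eval, e1, e2, e3, hτ.idx adj (by simp; omega), Nat.succ_le_iff]
  intro τ₁ a₁ f₁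
  refine runs_seq (halts_iteI ⟨by omega, by omega, by omega⟩ n m hk1 hk2
    (fun i j => 0 < σ.idx adj i j ∧ τ₁.idx first i j = 0) (fun i j => σ.idx units j 0) ?_ ?_ ?_ ?_)
  · intro τ hτ; simp [IExpr.eval, hτ.idx 0 (by simp; omega), a₁.idx 0 (by simp; omega), hn]
  · intro τ hτ; simp [IExpr.eval, hτ.idx 0 (by simp; omega), a₁.idx 0 (by simp; omega), hm]
  · intro i hi j hj τ hτ e1 e2
    refine ⟨⟨trivial, trivial⟩, ?_, ?_⟩
    · simp [Test.Holds, IExpr.eval, e1, e2, hτ.idx adj (by simp; omega),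
        a₁.idx adj (by simp; omega), hτ.idx first (by simp; omega), Nat.succ_le_iff]
    · simp [IExpr.eval, e2, hτ.idx units (by simp; omega), a₁.idx units (by simp; omega)]
  intro τ₂ a₂ f₂
  refine halts_sumI ⟨by omega, by omega, by omega⟩ n 1 m hk1 (by omega) hk2
    (fun i _ j => τ₂.idx y i j) ?_ ?_ ?_ ?_ ?_
  · intro τ hτ
    simp [IExpr.eval, hτ.idx 0 (by simp; omega), a₁.idx 0 (by simp; omega),
      a₂.idx 0 (by simp; omega), hn]
  · intro τ hτ; rfl
  · intro τ hτ
    simp [IExpr.eval, hτ.idx 0 (by simp; omega), a₁.idx 0 (by simp; omega),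
      a₂.idx 0 (by simp; omega), hm]
  · intro i hi j hj l hl τ hτ e1 e2 e3
    simp [IExpr.eval, e1, e3, hτ.idx y (by simp; omega)]
  intro τ₃ a₃ f₃
  have hy3 : τ₃.idx y = τ₂.idx y := a₃.idx y (by simp; omega)
  refine hpost τ₃ ?_ ⟨?_, ?_, ?_⟩
  · refine (a₁.mono ?_ (by simp)).trans ((a₂.mono ?_ (by simp)).trans (a₃.mono ?_ (by simp))) <;>
    · intro x hx
      simp only [Set.mem_insert_iff, Set.mem_singleton_iff] at hx ⊢
      tauto
  · intro i hi j hj hpos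
    rw [hy3, f₂ i hi j hj] at hpos
    split_ifs at hpos with h
    · exact h.1
    · exact absurd hpos (lt_irrefl _)
  · intro j hj hex
    have hex' : ∃ i, i < n ∧ 0 < σ.idx adj i j := hex
    set i₀ := Nat.find hex' with hi₀
    obtain ⟨hlt, hpos⟩ := Nat.find_spec hex'
    have hiff : ∀ i < n, (0 < σ.idx adj i j ∧ τ₁.idx first i j = 0) ↔ i = i₀ := by
      intro i hi
      rw [f₁ i hi j hj, Finset.card_eq_zero, Finset.filter_eq_empty_iff]
      constructor
      · rintro ⟨h1, h2⟩
        refine le_antisymm (not_lt.1 fun h => ?_) (Nat.find_min' hex' ⟨hi, h1⟩)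
        exact h2 (Finset.mem_range.2 hlt) ⟨hpos, h⟩
      · rintro rfl
        exact ⟨hpos, fun h hh ⟨h1, h2⟩ => Nat.find_min hex' h2 ⟨Finset.mem_range.1 hh, h1⟩⟩
    rw [hy3, Finset.sum_congr rfl fun i hi => f₂ i (Finset.mem_range.1 hi) j hj,
      Finset.sum_congr rfl fun i hi => if_congr (hiff i (Finset.mem_range.1 hi)) rfl rfl,
      Finset.sum_ite_eq', if_pos (Finset.mem_range.2 hlt)]
  · intro i hi
    rw [hy3, f₃ i hi 0 (by omega)]

/-- Hand over one unit of chore `j` from agent `i` to agent `h`; here `i`, `j`, `h` are the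
counters. -/
noncomputable def moveProg (y load : ℕ) : Timed :=
  .seq (.setIdx y (var 1) (var 2) (.sub (.get y (var 1) (var 2)) (.lit 1)))
    (.seq (.setIdx y (var 3) (var 2) (.add (.get y (var 3) (var 2)) (.lit 1)))
      (.seq (.setIdx load (var 1) (.lit 0) (.sub (.get load (var 1) (.lit 0)) (.lit 1)))
        (.setIdx load (var 3) (.lit 0) (.add (.get load (var 3) (.lit 0)) (.lit 1)))))

theorem setIdx_idx_upd (τ : Memory) (A i j v : ℕ) :
    (τ.setIdx A i j v).idx A = upd (τ.idx A) i j v := by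
  funext i' j'
  simp [setIdx_idx, upd]

theorem halts_moveProg {y load i j h : ℕ} (h1 : 4 ≤ y) (h2 : 4 ≤ load) (hne : y ≠ load)
    (hi : σ.idx 1 0 0 = i) (hj : σ.idx 2 0 0 = j) (hh : σ.idx 3 0 0 = h)
    (hpost : ∀ τ, Agree {y, load} ∅ σ τ → τ.idx y = moveUnit (σ.idx y) i j h →
      τ.idx load = moveLoad (σ.idx load) i h → Post τ) :
    Runs k ok (moveProg y load) Post σ := by
  refine runs_seq (runs_setIdx (runs_seq (runs_setIdx (runs_seq (runs_setIdx
    (runs_setIdx ?_))))))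
  have ny1 : 1 ≠ y := by omega
  have ny2 : 2 ≠ y := by omega
  have ny3 : 3 ≠ y := by omega
  have nl3 : 3 ≠ load := by omega
  simp only [IExpr.eval, setIdx_idx_ne _ _ _ _ ny1, setIdx_idx_ne _ _ _ _ ny2,
    setIdx_idx_ne _ _ _ _ ny3, setIdx_idx_ne _ _ _ _ nl3, hi, hj, hh,
    setIdx_idx_ne _ _ _ _ hne.symm,
    setIdx_idx_upd]
  refine hpost _ ((((((Agree.refl _ _ _).setIdx ?_ _ _ _).setIdx ?_ _ _ _).setIdx ?_ _ _ _)).setIdx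
    ?_ _ _ _) ?_ ?_
  · simp
  · simp
  · simp
  · simp
  · simp only [setIdx_idx_ne _ _ _ _ hne, setIdx_idx_upd]
    rfl
  · simp only [setIdx_idx_upd, setIdx_idx_ne _ _ _ _ hne.symm]
    rfl

end RAM

/-! ### Balanced allocations from stable assignments and preflows -/

namespace Chores

open Finset

theorem Assigns.congr {n m : ℕ} {adj adj' : ℕ → ℕ → Prop} {u u' : ℕ → ℕ} {y l : ℕ → ℕ → ℕ}
    (ha : Assigns n m adj u y l) (hadj : ∀ i < n, ∀ j < m, adj i j ↔ adj' i j)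
    (hu : ∀ j < m, u j = u' j) : Assigns n m adj' u' y l where
  supp i hi j hj hy := (hadj i hi j hj).1 (ha.supp i hi j hj hy)
  col j hj hex := by
    obtain ⟨i, hi, hE⟩ := hex
    rw [ha.col j hj ⟨i, hi, (hadj i hi j hj).2 hE⟩, hu j hj]
  load := ha.load

/-- `y i j / size i` is a balanced fractional allocation of the chores adjacent to some agent, with
loads `cap i / size i`. -/
structure Balanced (n m : ℕ) (adj : ℕ → ℕ → Prop) (y : ℕ → ℕ → ℕ) (size cap : ℕ → ℕ) : Prop where
  size_pos : ∀ i < n, 0 < size i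
  size_le : ∀ i < n, size i ≤ n
  cap_le : ∀ i < n, cap i ≤ m
  supp : ∀ i < n, ∀ j < m, 0 < y i j → adj i j
  col : ∀ j < m, (∃ i < n, adj i j) → ∃ s, 0 < s ∧ s ≤ n ∧ ∑ i ∈ range n, y i j = s ∧
    ∀ i < n, 0 < y i j → size i = s
  load : ∀ i < n, ∑ j ∈ range m, y i j = cap i
  balanced : ∀ h < n, ∀ i < n, ∀ j < m, 0 < y h j → adj i j → cap h * size i ≤ cap i * size h

theorem exists_blockAdj {n : ℕ} {adj : ℕ → ℕ → Prop} {l : ℕ → ℕ → ℕ} {i j : ℕ} (hi : i < n)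
    (hadj : adj i j) : ∃ h < n, blockAdj n adj l h j := by
  classical
  obtain ⟨h, hh, hmax⟩ := exists_max_image ((range n).filter fun h => adj h j) (rank n l)
    ⟨i, by simp [hi, hadj]⟩
  simp only [mem_filter, mem_range] at hh hmax
  exact ⟨h, hh.1, hh.2, fun t ht htj => hmax t ⟨ht, htj⟩⟩

/-- Loads are equal within a block. A chore goes to the block of highest rank among its adjacent
agents, and by `blockCap_mul_le` that block has the smallest average among theirs. -/
theorem balanced_of_preflow {n m N : ℕ} {adj : ℕ → ℕ → Prop} {y l y' l' H : ℕ → ℕ → ℕ}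
    (hN : N = n * (n * n) + 1) (ha : Assigns n m adj (fun _ => N) y l) (hs : Stable n m adj y l)
    (hP : Preflow n m (blockAdj n adj l) (blockCap n m adj l) (blockUnits n adj l) y' l' H)
    (hle : ∀ i < n, l' i 0 ≤ blockCap n m adj l i) :
    Balanced n m adj y' (blockSize n l) (blockCap n m adj l) := by
  have hB := blocks_of_stable (hN ▸ ha) hs
  refine ⟨fun i hi => blockSize_pos hi, fun i _ => blockSize_le i, fun i _ => blockCap_le i,
    fun i hi j hj hy => (hP.assigns.supp i hi j hj hy).1, fun j hj hex => ?_, fun i hi => ?_,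
    fun h hh i hi j hj hy hadj => ?_⟩
  · obtain ⟨i, hi, hadj⟩ := hex
    obtain ⟨h, hh, hE⟩ := exists_blockAdj (l := l) hi hadj
    refine ⟨blockSize n l h, blockSize_pos hh, blockSize_le h, ?_, fun t ht hy => ?_⟩
    · rw [hP.assigns.col j hj ⟨h, hh, hE⟩, hB.u_eq h hh j hj hE]
    · rw [← hB.u_eq h hh j hj hE, ← hB.u_eq t ht j hj (hP.assigns.supp t ht j hj hy)]
  · rw [← hP.assigns.load i hi, hP.load_eq hB hle hi]
  · exact blockCap_mul_le (by omega) ha hs ((hP.assigns.supp h hh j hj hy).2 i hi hadj)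

end Chores

/-! ### Program for the rough distribution -/

namespace RAM

open Polynomial Chores

variable {k : ℕ} {ok : ℝ → Prop} {Post : Memory → Prop} {σ : Memory} {n m : ℕ}

theorem Agree.trans_singleton {S T : Set ℕ} {A : ℕ} {σ τ υ : Memory} (h : Agree S T σ τ)
    (h' : Agree {A, 1, 2, 3} ∅ τ υ) (hS : {A, 1, 2, 3} ⊆ S) : Agree S T σ υ :=
  h.trans (h'.mono hS (Set.empty_subset _))

/-- Distribute a large number of units of each chore such that loads of agents adjacent to the same
chore differ by at most one. -/
noncomputable def roughProg : Timed :=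
  .seq (sumI 5 (.lit 1) (.lit 1) numAgents numAgents)
  (.seq (sumI 6 (.lit 1) (.lit 1) numAgents (var 5))
  (.seq (mapI 7 numChores (.lit 1) (.add (var 6) (.lit 1)))
  (.seq (distribute 4 7 8 9 10)
    (scan numAgents numChores
      (.and (.idxLt (.lit 0) (.get 9 (var 1) (var 2)))
        (.and (.idxLt (.lit 0) (.get 4 (var 3) (var 2)))
          (.idxLe (.add (.get 10 (var 3) (.lit 0)) (.lit 2)) (.get 10 (var 1) (.lit 0)))))
      Test.yes (moveProg 9 10) .skip ((X * (X * (X * X) + 1)) ^ 2)))))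

theorem halts_roughProg (hn : σ.idx 0 0 0 = n) (hm : σ.idx 0 0 1 = m)
    (hpost : ∀ τ, Agree {0, 4}ᶜ ∅ σ τ → (∃ y, Assigns n m (fun i j => 0 < σ.idx 4 i j)
        (fun _ => n * (n * n) + 1) y (τ.idx 10) ∧
      Stable n m (fun i j => 0 < σ.idx 4 i j) y (τ.idx 10)) → Post τ) :
    Runs (n + m) ok roughProg Post σ := by
  refine runs_seq (halts_sumI (by simp) 1 1 n (by omega) (by omega) (by omega) (fun _ _ _ => n)
    ?_ ?_ ?_ ?_ ?_)
  · intro τ hτ; rfl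
  · intro τ hτ; rfl
  · intro τ hτ; simp [IExpr.eval, hτ.idx, hn]
  · intro i hi j hj l hl τ hτ e1 e2 e3; simp [IExpr.eval, hτ.idx, hn]
  intro τ₁ a₁ f₁
  refine runs_seq (halts_sumI (by simp) 1 1 n (by omega) (by omega) (by omega)
    (fun _ _ _ => n * n) ?_ ?_ ?_ ?_ ?_)
  · intro τ hτ; rfl
  · intro τ hτ; rfl
  · intro τ hτ; simp [IExpr.eval, hτ.idx, a₁.idx, hn]
  · intro i hi j hj l hl τ hτ e1 e2 e3; simp [IExpr.eval, hτ.idx, f₁]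
  intro τ₂ a₂ f₂
  refine runs_seq (halts_mapI (by simp) m 1 (by omega) (by omega) (fun _ _ => n * (n * n) + 1)
    ?_ ?_ ?_ ?_)
  · intro τ hτ; simp [IExpr.eval, hτ.idx, a₂.idx, a₁.idx, hm]
  · intro τ hτ; rfl
  · intro i hi j hj τ hτ e1 e2; simp [IExpr.eval, hτ.idx, f₂]
  intro τ₃ a₃ f₃
  have g₃ : Agree {0, 4}ᶜ ∅ σ τ₃ := by
    refine (((Agree.refl _ _ _).trans_singleton a₁ ?_).trans_singleton a₂ ?_).trans_singleton a₃ ?_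
    all_goals intro x; simp; omega
  refine runs_seq (halts_distribute (n := n) (m := m) le_rfl (by simp [g₃.idx, hn])
    (by simp [g₃.idx, hm]) (by omega) (by omega) (by omega) (by omega) (by omega) (by omega)
    (by omega) (by omega) ?_)
  intro τ₄ a₄ f₄
  have g₄ : Agree {0, 4}ᶜ ∅ σ τ₄ := g₃.trans (a₄.mono (by intro x; simp; omega) le_rfl)
  rw [g₃.idx 4 (by simp)] at f₄
  replace f₄ := f₄.congr (u' := fun _ => n * (n * n) + 1) (fun _ _ _ _ => Iff.rfl)
    (fun j hj => f₃ j hj 0 (by omega))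
  refine halts_scan (S := {0, 4}ᶜ) (by intro x; simp; omega)
    (fun τ => (τ.idx 9, τ.idx 10)) ?_ n m (by omega) (by omega)
    (fun s => Assigns n m (fun i j => 0 < σ.idx 4 i j) (fun _ => n * (n * n) + 1) s.1 s.2)
    (fun i j h s => 0 < s.1 i j ∧ 0 < σ.idx 4 h j ∧ s.2 h 0 + 2 ≤ s.2 i 0) (fun _ _ => True)
    (fun s => ∑ i ∈ Finset.range n, s.2 i 0 ^ 2)
    _ ?_ ?_ ?_ ?_ ?_ ?_ f₄ ?_ ?_
  · rintro τ D hD v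
    simp only [Set.mem_insert_iff, Set.mem_singleton_iff] at hD
    rw [setIdx_idx_ne _ _ _ _ (by omega), setIdx_idx_ne _ _ _ _ (by omega)]
  · intro τ hτ; simp [IExpr.eval, hτ.idx, g₄.idx, hn]
  · intro τ hτ; simp [IExpr.eval, hτ.idx, g₄.idx, hm]
  · intro i hi j hj h hh τ hτ e1 e2 e3
    refine ⟨⟨trivial, trivial, trivial⟩, ?_⟩
    simp [Test.Holds, IExpr.eval, e1, e2, e3, hτ.idx 4, g₄.idx 4, Nat.succ_le_iff]
  · intro i hi τ hτ e1
    exact ⟨Test.yes_within _ _, by simp [Test.yes_holds]⟩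
  · rintro i hi j hj h hh τ hτ e1 e2 e3 hI ⟨h1, h2, h3⟩
    refine halts_moveProg (by omega) (by omega) (by omega) e1 e2 e3 fun υ hυ b1 b2 => ?_
    simp only [b1, b2]
    refine ⟨hτ.trans (hυ.mono (by intro x; simp; omega) le_rfl), ?_, sum_sq_moveLoad_lt hi hh h3⟩
    exact hI.move hi hj hh (by rintro rfl; simp only at h3; omega) h1 h2
  · intro i hi τ hτ e1 hI hnd
    exact absurd trivial hnd
  -- The sum of squares is at most the square of the total number of units, which is polynomial in
  -- `n` and `m`.
  · simp only [eval_pow, eval_mul, eval_X, eval_add, eval_one]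
    calc ∑ i ∈ Finset.range n, τ₄.idx 10 i 0 ^ 2 ≤ (∑ i ∈ Finset.range n, τ₄.idx 10 i 0) ^ 2 :=
          Finset.sum_sq_le_sq_sum_of_nonneg (fun _ _ => Nat.zero_le _)
      _ ≤ (m * (n * (n * n) + 1)) ^ 2 := by
          gcongr
          simpa using f₄.sum_load_le
      _ ≤ _ := by gcongr <;> omega
  · intro τ hτ hI hstab
    refine hpost τ (g₄.trans hτ) ⟨τ.idx 9, hI, fun i hi j hj h hh hy hadj => ?_⟩
    have := (hstab i hi).2 j hj h hh
    simp only [not_and, not_le] at this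
    have := this hy hadj
    omega

end RAM

/-! ### Programs for the blocks and for the even distribution -/

namespace RAM

open Polynomial Chores

variable {k : ℕ} {ok : ℝ → Prop} {Post : Memory → Prop} {σ : Memory} {n m : ℕ}

/-- Compute the blocks of agents and chores from the loads. -/
noncomputable def blockProg : Timed :=
  .seq (countI 11 numAgents (.lit 1) numAgents
    (.and (.idxLe (.add (.get 10 (var 3) (.lit 0)) (.lit 1)) (.get 10 (var 1) (.lit 0)))
      (.idxLe (.get 10 (var 1) (.lit 0)) (.add (.get 10 (var 3) (.lit 0)) (.lit 1)))))
  (.seq (countI 12 numAgents (.lit 1) numAgents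
    (.and (.idxLt (.get 10 (var 1) (.lit 0)) (.get 10 (var 3) (.lit 0)))
      (.idxLe (.get 11 (var 3) (.lit 0)) (.lit 0))))
  (.seq (countI 13 numAgents numChores numAgents
    (.and (.idxLt (.lit 0) (.get 4 (var 3) (var 2)))
      (.idxLt (.get 12 (var 1) (.lit 0)) (.get 12 (var 3) (.lit 0)))))
  (.seq (countI 14 numAgents numChores (.lit 1)
    (.and (.idxLt (.lit 0) (.get 4 (var 1) (var 2))) (.idxLe (.get 13 (var 1) (var 2)) (.lit 0))))
  (.seq (countI 15 numAgents numChores numAgents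
    (.and (.idxLt (.lit 0) (.get 14 (var 3) (var 2)))
      (.and (.idxLe (.get 12 (var 3) (.lit 0)) (.get 12 (var 1) (.lit 0)))
        (.idxLe (.get 12 (var 1) (.lit 0)) (.get 12 (var 3) (.lit 0))))))
  (.seq (countI 16 numChores (.lit 1) numAgents (.idxLt (.lit 0) (.get 15 (var 3) (var 1))))
  (.seq (countI 17 numAgents (.lit 1) numChores (.idxLt (.lit 0) (.get 15 (var 1) (var 3))))
    (countI 18 numAgents (.lit 1) numAgents
      (.and (.idxLe (.get 12 (var 3) (.lit 0)) (.get 12 (var 1) (.lit 0)))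
        (.idxLe (.get 12 (var 1) (.lit 0)) (.get 12 (var 3) (.lit 0)))))))))))

/-- Array 11 counts the agents one unit below, 12 holds ranks, 13 counts adjacent agents of higher
rank, 14 and 15 are flags for `blockAdj` and `blockMem`, and 16, 17, 18 hold units, capacities and
sizes. -/
theorem halts_blockProg (hn : σ.idx 0 0 0 = n) (hm : σ.idx 0 0 1 = m)
    (hpost : ∀ τ, Agree {0, 4, 10}ᶜ ∅ σ τ →
      (∀ i < n, ∀ j < m, 0 < τ.idx 14 i j ↔
        blockAdj n (fun i j => 0 < σ.idx 4 i j) (σ.idx 10) i j) →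
      (∀ j < m, τ.idx 16 j 0 = blockUnits n (fun i j => 0 < σ.idx 4 i j) (σ.idx 10) j) →
      (∀ i < n, τ.idx 17 i 0 = blockCap n m (fun i j => 0 < σ.idx 4 i j) (σ.idx 10) i) →
      (∀ i < n, τ.idx 18 i 0 = blockSize n (σ.idx 10) i) → Post τ) :
    Runs (n + m) ok blockProg Post σ := by
  classical
  set adj : ℕ → ℕ → Prop := fun i j => 0 < σ.idx 4 i j with hadj
  set l := σ.idx 10 with hl
  refine runs_seq (halts_count (by simp) n 1 n (by omega) (by omega) (by omega)
    (fun h _ s => l s 0 + 1 = l h 0) ?_ ?_ ?_ ?_ ?_)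
  · intro τ hτ; simp [IExpr.eval, hτ.idx, hn]
  · intro τ hτ; rfl
  · intro τ hτ; simp [IExpr.eval, hτ.idx, hn]
  · intro i hi j hj t ht τ hτ e1 e2 e3
    refine ⟨⟨trivial, trivial⟩, ?_⟩
    simp [Test.Holds, IExpr.eval, e1, e3, hτ.idx, ← hl]
    omega
  intro τ₁ a₁ f₁
  refine runs_seq (halts_count (by simp) n 1 n (by omega) (by omega) (by omega)
    (fun i _ t => l i 0 < l t 0 ∧ τ₁.idx 11 t 0 = 0) ?_ ?_ ?_ ?_ ?_)
  · intro τ hτ; simp [IExpr.eval, hτ.idx, a₁.idx, hn]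
  · intro τ hτ; rfl
  · intro τ hτ; simp [IExpr.eval, hτ.idx, a₁.idx, hn]
  · intro i hi j hj t ht τ hτ e1 e2 e3
    refine ⟨⟨trivial, trivial⟩, ?_⟩
    simp [Test.Holds, IExpr.eval, e1, e3, hτ.idx, a₁.idx, ← hl]
  intro τ₂ a₂ f₂
  have r₂ : ∀ i < n, τ₂.idx 12 i 0 = rank n l i := by
    intro i hi
    rw [f₂ i hi 0 (by omega), rank]
    congr 1
    ext t
    rw [Finset.mem_filter, Finset.mem_filter]
    refine and_congr_right fun ht => ?_
    rw [f₁ t (Finset.mem_range.1 ht) 0 (by omega)]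
  refine runs_seq (halts_count (by simp) n m n (by omega) (by omega) (by omega)
    (fun i j h => adj h j ∧ τ₂.idx 12 i 0 < τ₂.idx 12 h 0) ?_ ?_ ?_ ?_ ?_)
  · intro τ hτ; simp [IExpr.eval, hτ.idx, a₂.idx, a₁.idx, hn]
  · intro τ hτ; simp [IExpr.eval, hτ.idx, a₂.idx, a₁.idx, hm]
  · intro τ hτ; simp [IExpr.eval, hτ.idx, a₂.idx, a₁.idx, hn]
  · intro i hi j hj t ht τ hτ e1 e2 e3
    refine ⟨⟨trivial, trivial⟩, ?_⟩
    simp [Test.Holds, IExpr.eval, e1, e2, e3, hτ.idx, a₂.idx, a₁.idx, hadj, Nat.succ_le_iff]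
  intro τ₃ a₃ f₃
  refine runs_seq (halts_count (by simp) n m 1 (by omega) (by omega) (by omega)
    (fun i j _ => adj i j ∧ τ₃.idx 13 i j = 0) ?_ ?_ ?_ ?_ ?_)
  · intro τ hτ; simp [IExpr.eval, hτ.idx, a₃.idx, a₂.idx, a₁.idx, hn]
  · intro τ hτ; simp [IExpr.eval, hτ.idx, a₃.idx, a₂.idx, a₁.idx, hm]
  · intro τ hτ; rfl
  · intro i hi j hj t ht τ hτ e1 e2 e3
    refine ⟨⟨trivial, trivial⟩, ?_⟩
    simp [Test.Holds, IExpr.eval, e1, e2, hτ.idx, a₃.idx, a₂.idx, a₁.idx, hadj, Nat.succ_le_iff]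
  intro τ₄ a₄ f₄
  have r₄ : ∀ i < n, ∀ j < m, 0 < τ₄.idx 14 i j ↔ blockAdj n adj l i j := by
    intro i hi j hj
    rw [f₄ i hi j hj, Finset.card_pos, blockAdj]
    constructor
    · rintro ⟨t, ht⟩
      rw [Finset.mem_filter] at ht
      refine ⟨ht.2.1, fun h hh hE => ?_⟩
      have h0 := ht.2.2
      rw [f₃ i hi j hj, Finset.card_eq_zero, Finset.filter_eq_empty_iff] at h0
      have := h0 (Finset.mem_range.2 hh)
      rw [r₂ i hi, r₂ h hh] at this
      exact not_lt.1 fun hlt => this ⟨hE, hlt⟩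
    · rintro ⟨h1, h2⟩
      refine ⟨0, Finset.mem_filter.2 ⟨by simp, h1, ?_⟩⟩
      rw [f₃ i hi j hj, Finset.card_eq_zero, Finset.filter_eq_empty_iff]
      rintro h hh ⟨hE, hlt⟩
      rw [Finset.mem_range] at hh
      rw [r₂ i hi, r₂ h hh] at hlt
      exact absurd (h2 h hh hE) (not_le.2 hlt)
  refine runs_seq (halts_count (by simp) n m n (by omega) (by omega) (by omega)
    (fun i j h => 0 < τ₄.idx 14 h j ∧ τ₂.idx 12 h 0 = τ₂.idx 12 i 0) ?_ ?_ ?_ ?_ ?_)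
  · intro τ hτ; simp [IExpr.eval, hτ.idx, a₄.idx, a₃.idx, a₂.idx, a₁.idx, hn]
  · intro τ hτ; simp [IExpr.eval, hτ.idx, a₄.idx, a₃.idx, a₂.idx, a₁.idx, hm]
  · intro τ hτ; simp [IExpr.eval, hτ.idx, a₄.idx, a₃.idx, a₂.idx, a₁.idx, hn]
  · intro i hi j hj t ht τ hτ e1 e2 e3
    refine ⟨⟨trivial, trivial, trivial⟩, ?_⟩
    simp [Test.Holds, IExpr.eval, e1, e2, e3, hτ.idx, a₄.idx, a₃.idx, Nat.succ_le_iff,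
      le_antisymm_iff]
  intro τ₅ a₅ f₅
  have r₅ : ∀ i < n, ∀ j < m, 0 < τ₅.idx 15 i j ↔ blockMem n adj l i j := by
    intro i hi j hj
    rw [f₅ i hi j hj, Finset.card_pos, blockMem]
    constructor
    · rintro ⟨h, hh⟩
      rw [Finset.mem_filter, Finset.mem_range] at hh
      obtain ⟨hh, h1, h2⟩ := hh
      exact ⟨h, hh, (r₄ h hh j hj).1 h1, by rw [← r₂ h hh, h2, r₂ i hi]⟩
    · rintro ⟨h, hh, h1, h2⟩
      exact ⟨h, Finset.mem_filter.2 ⟨Finset.mem_range.2 hh, (r₄ h hh j hj).2 h1,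
        by rw [r₂ h hh, h2, r₂ i hi]⟩⟩
  refine runs_seq (halts_count (by simp) m 1 n (by omega) (by omega) (by omega)
    (fun j _ i => 0 < τ₅.idx 15 i j) ?_ ?_ ?_ ?_ ?_)
  · intro τ hτ; simp [IExpr.eval, hτ.idx, a₅.idx, a₄.idx, a₃.idx, a₂.idx, a₁.idx, hm]
  · intro τ hτ; rfl
  · intro τ hτ; simp [IExpr.eval, hτ.idx, a₅.idx, a₄.idx, a₃.idx, a₂.idx, a₁.idx, hn]
  · intro i hi j hj t ht τ hτ e1 e2 e3
    refine ⟨trivial, ?_⟩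
    simp [Test.Holds, IExpr.eval, e1, e3, hτ.idx, Nat.succ_le_iff]
  intro τ₆ a₆ f₆
  refine runs_seq (halts_count (by simp) n 1 m (by omega) (by omega) (by omega)
    (fun i _ j => 0 < τ₅.idx 15 i j) ?_ ?_ ?_ ?_ ?_)
  · intro τ hτ; simp [IExpr.eval, hτ.idx, a₆.idx, a₅.idx, a₄.idx, a₃.idx, a₂.idx, a₁.idx, hn]
  · intro τ hτ; rfl
  · intro τ hτ; simp [IExpr.eval, hτ.idx, a₆.idx, a₅.idx, a₄.idx, a₃.idx, a₂.idx, a₁.idx, hm]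
  · intro i hi j hj t ht τ hτ e1 e2 e3
    refine ⟨trivial, ?_⟩
    simp [Test.Holds, IExpr.eval, e1, e3, hτ.idx, a₆.idx, Nat.succ_le_iff]
  intro τ₇ a₇ f₇
  refine halts_count (by simp) n 1 n (by omega) (by omega) (by omega)
    (fun i _ h => τ₂.idx 12 h 0 = τ₂.idx 12 i 0) ?_ ?_ ?_ ?_ ?_
  · intro τ hτ
    simp [IExpr.eval, hτ.idx, a₇.idx, a₆.idx, a₅.idx, a₄.idx, a₃.idx, a₂.idx, a₁.idx, hn]
  · intro τ hτ; rfl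
  · intro τ hτ
    simp [IExpr.eval, hτ.idx, a₇.idx, a₆.idx, a₅.idx, a₄.idx, a₃.idx, a₂.idx, a₁.idx, hn]
  · intro i hi j hj t ht τ hτ e1 e2 e3
    refine ⟨⟨trivial, trivial⟩, ?_⟩
    simp [Test.Holds, IExpr.eval, e1, e3, hτ.idx, a₇.idx, a₆.idx, a₅.idx, a₄.idx, a₃.idx,
      le_antisymm_iff]
  intro τ₈ a₈ f₈
  refine hpost τ₈ ?_ ?_ ?_ ?_ ?_
  · refine ((((((((Agree.refl _ _ _).trans_singleton a₁ ?_).trans_singleton a₂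
      ?_).trans_singleton a₃ ?_).trans_singleton a₄ ?_).trans_singleton a₅ ?_).trans_singleton a₆
      ?_).trans_singleton a₇ ?_).trans_singleton a₈ ?_
    all_goals intro x; simp; omega
  · intro i hi j hj
    rw [← r₄ i hi j hj]
    simp [a₈.idx, a₇.idx, a₆.idx, a₅.idx]
  · intro j hj
    have h16 : τ₈.idx 16 = τ₆.idx 16 := by simp [a₈.idx, a₇.idx]
    rw [h16, f₆ j hj 0 (by omega), blockUnits]
    congr 1
    ext i
    rw [Finset.mem_filter, Finset.mem_filter]
    exact and_congr_right fun hi => r₅ i (Finset.mem_range.1 hi) j hj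
  · intro i hi
    have h17 : τ₈.idx 17 = τ₇.idx 17 := by simp [a₈.idx]
    rw [h17, f₇ i hi 0 (by omega), blockCap]
    congr 1
    ext j
    rw [Finset.mem_filter, Finset.mem_filter]
    exact and_congr_right fun hj => r₅ i hi j (Finset.mem_range.1 hj)
  · intro i hi
    rw [f₈ i hi 0 (by omega), blockSize]
    congr 1
    ext h
    rw [Finset.mem_filter, Finset.mem_filter]
    refine and_congr_right fun hh => ?_
    rw [r₂ h (Finset.mem_range.1 hh), r₂ i hi]

/-- Distribute the chores of each block evenly among its agents. -/
noncomputable def evenProg : Timed :=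
  .seq (distribute 14 16 19 20 21)
  (.seq (mapI 22 numAgents (.lit 1) (.lit 0))
    (scan numAgents numChores
      (.and (.idxLt (.get 17 (var 1) (.lit 0)) (.get 21 (var 1) (.lit 0)))
        (.and (.idxLt (.lit 0) (.get 20 (var 1) (var 2)))
          (.and (.idxLt (.lit 0) (.get 14 (var 3) (var 2)))
            (.idxLt (.get 22 (var 3) (.lit 0)) (.get 22 (var 1) (.lit 0))))))
      (.idxLe (.get 21 (var 1) (.lit 0)) (.get 17 (var 1) (.lit 0)))
      (moveProg 20 21)
      (.setIdx 22 (var 1) (.lit 0) (.add (.get 22 (var 1) (.lit 0)) (.lit 1)))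
      (X * (X * (X * X + 1) + X * X * X))))

theorem halts_evenProg {E : ℕ → ℕ → Prop} {rk size cap u : ℕ → ℕ}
    (hn : σ.idx 0 0 0 = n) (hm : σ.idx 0 0 1 = m) (hB : Blocks n m E rk size cap u)
    (hu : ∀ j, u j ≤ n)
    (hE : ∀ i < n, ∀ j < m, 0 < σ.idx 14 i j ↔ E i j) (hσu : ∀ j < m, σ.idx 16 j 0 = u j)
    (hcap : ∀ i < n, σ.idx 17 i 0 = cap i)
    (hpost : ∀ τ, Agree {0, 4, 17, 18}ᶜ ∅ σ τ → (∃ l H, Preflow n m E cap u (τ.idx 20) l H ∧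
      ∀ i < n, l i 0 ≤ cap i) → Post τ) :
    Runs (n + m) ok evenProg Post σ := by
  refine runs_seq (halts_distribute (n := n) (m := m) le_rfl hn hm (by omega) (by omega)
    (by omega) (by omega) (by omega) (by omega) (by omega) (by omega) ?_)
  intro τ₁ a₁ f₁
  replace f₁ := f₁.congr hE hσu
  refine runs_seq (halts_mapI (by simp) n 1 (by omega) (by omega) (fun _ _ => 0) ?_ ?_ ?_ ?_)
  · intro τ hτ; simp [IExpr.eval, hτ.idx, a₁.idx, hn]
  · intro τ hτ; rfl
  · intro i hi j hj τ hτ e1 e2; rfl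
  intro τ₂ a₂ f₂
  have g₂ : Agree {0, 4, 14, 17, 18}ᶜ ∅ σ τ₂ := by
    refine (a₁.mono ?_ le_rfl).trans_singleton a₂ ?_ <;> intro x <;> simp <;> omega
  have hP : Preflow n m E cap u (τ₂.idx 20) (τ₂.idx 21) (τ₂.idx 22) := by
    rw [a₂.idx 20 (by simp), a₂.idx 21 (by simp)]
    refine ⟨f₁, fun i hi j hj h hh _ _ => ?_, fun i hi h0 => ?_, fun i hi => ?_⟩
    · rw [f₂ i hi 0 (by omega)]; omega
    · rw [f₂ i hi 0 (by omega)] at h0; omega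
    · rw [f₂ i hi 0 (by omega)]; omega
  refine halts_scan (S := {0, 4, 14, 17, 18}ᶜ) (by intro x; simp; omega)
    (fun τ => (τ.idx 20, τ.idx 21, τ.idx 22)) ?_ n m (by omega) (by omega)
    (fun s => Preflow n m E cap u s.1 s.2.1 s.2.2)
    (fun i j h s => cap i < s.2.1 i 0 ∧ 0 < s.1 i j ∧ E h j ∧ s.2.2 h 0 < s.2.2 i 0)
    (fun i s => s.2.1 i 0 ≤ cap i)
    -- Each chore has at most `n` units, so `m * n` bounds every load.
    (fun s => heightPot n (m * n) s.2.1 s.2.2)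
    _ ?_ ?_ ?_ ?_ ?_ ?_ hP ?_ ?_
  · rintro τ D hD v
    simp only [Set.mem_insert_iff, Set.mem_singleton_iff] at hD
    rw [setIdx_idx_ne _ _ _ _ (by omega), setIdx_idx_ne _ _ _ _ (by omega),
      setIdx_idx_ne _ _ _ _ (by omega)]
  · intro τ hτ; simp [IExpr.eval, hτ.idx, g₂.idx, hn]
  · intro τ hτ; simp [IExpr.eval, hτ.idx, g₂.idx, hm]
  · intro i hi j hj h hh τ hτ e1 e2 e3
    refine ⟨⟨trivial, trivial, trivial, trivial⟩, ?_⟩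
    simp [Test.Holds, IExpr.eval, e1, e2, e3, hτ.idx 14, g₂.idx 14, hτ.idx 17, g₂.idx 17,
      Nat.succ_le_iff, hcap i hi, ← hE h hh j hj]
  · intro i hi τ hτ e1
    refine ⟨trivial, ?_⟩
    simp [Test.Holds, IExpr.eval, e1, hτ.idx 17, g₂.idx 17, hcap i hi]
  · rintro i hi j hj h hh τ hτ e1 e2 e3 hI ⟨h1, h2, h3, h4⟩
    refine halts_moveProg (by omega) (by omega) (by omega) e1 e2 e3 fun υ hυ b1 b2 => ?_
    have b3 : υ.idx 22 = τ.idx 22 := hυ.idx 22 (by simp)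
    simp only [b1, b2, b3]
    exact ⟨hτ.trans (hυ.mono (by intro x; simp; omega) le_rfl), hI.move hi hj hh h2 h3 h1 h4,
      heightPot_move hi hh (by simp only at h1; omega) h4⟩
  · intro i hi τ hτ e1 hI hnd hno
    simp only [not_le] at hnd
    refine runs_setIdx ?_
    simp only [IExpr.eval, e1, setIdx_idx_upd]
    rw [setIdx_idx_ne _ _ _ _ (by omega), setIdx_idx_ne _ _ _ _ (by omega)]
    refine ⟨hτ.setIdx (by simp) _ _ _, hI.raise hB hi hnd fun j hj h hh hcon =>
      hno j hj h hh ⟨hnd, hcon⟩, heightPot_raise hi ?_ (hI.height_lt hB hi hnd)⟩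
    refine le_trans ?_ (hI.assigns.sum_load_le.trans (?_ : _ ≤ m * n))
    · exact Finset.single_le_sum (f := fun i => τ.idx 21 i 0) (fun _ _ => Nat.zero_le _)
        (Finset.mem_range.2 hi)
    · simpa using Finset.sum_le_card_nsmul (Finset.range m) u n fun j _ => hu j
  · simp only [eval_mul, eval_X, eval_add, eval_one, heightPot]
    have h1 : ∀ i ∈ Finset.range n, (n - τ₂.idx 22 i 0) * (m * n + 1) +
        τ₂.idx 21 i 0 * τ₂.idx 22 i 0 ≤ n * (m * n + 1) + m * n * n := by
      intro i hi
      rw [f₂ i (Finset.mem_range.1 hi) 0 (by omega)]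
      simp
    refine (Finset.sum_le_card_nsmul _ _ _ h1).trans ?_
    rw [Finset.card_range, smul_eq_mul]
    gcongr <;> omega
  · intro τ hτ hI hstab
    refine hpost τ ((g₂.trans hτ).mono ?_ le_rfl)
      ⟨τ.idx 21, τ.idx 22, hI, fun i hi => (hstab i hi).1⟩
    intro x; simp; tauto

/-- Compute a balanced allocation of the chores adjacent to some agent. -/
noncomputable def balanceProg : Timed := .seq roughProg (.seq blockProg evenProg)

theorem halts_balanceProg (hn : σ.idx 0 0 0 = n) (hm : σ.idx 0 0 1 = m)
    (hpost : ∀ τ, Agree {0, 4}ᶜ ∅ σ τ → Balanced n m (fun i j => 0 < σ.idx 4 i j) (τ.idx 20)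
      (fun i => τ.idx 18 i 0) (fun i => τ.idx 17 i 0) → Post τ) :
    Runs (n + m) ok balanceProg Post σ := by
  refine runs_seq (halts_roughProg hn hm ?_)
  rintro τ₁ a₁ ⟨y, ha, hs⟩
  refine runs_seq (halts_blockProg (n := n) (m := m) (by simp [a₁.idx, hn]) (by simp [a₁.idx, hm])
    fun τ₂ a₂ h14 h16 h17 h18 => ?_)
  rw [a₁.idx 4 (by simp)] at h14 h16 h17
  refine halts_evenProg (n := n) (m := m) (by simp [a₂.idx, a₁.idx, hn])
    (by simp [a₂.idx, a₁.idx, hm]) (blocks_of_stable ha hs) (fun j => blockUnits_le j) h14 h16 h17 ?_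
  rintro τ₃ a₃ ⟨l, H, hP, hle⟩
  refine hpost τ₃ ((a₁.trans (a₂.mono ?_ le_rfl)).trans (a₃.mono ?_ le_rfl)) ?_
  · intro x; simp; tauto
  · intro x; simp; tauto
  · have hb := balanced_of_preflow rfl ha hs hP hle
    have e17 : ∀ i < n, τ₃.idx 17 i 0 = blockCap n m (fun i j => 0 < σ.idx 4 i j) (τ₁.idx 10) i :=
      fun i hi => by rw [a₃.idx 17 (by simp), h17 i hi]
    have e18 : ∀ i < n, τ₃.idx 18 i 0 = blockSize n (τ₁.idx 10) i :=
      fun i hi => by rw [a₃.idx 18 (by simp), h18 i hi]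
    refine ⟨fun i hi => ?_, fun i hi => ?_, fun i hi => ?_, hb.supp, fun j hj hex => ?_,
      fun i hi => ?_, fun h hh i hi j hj hy hadj => ?_⟩
    · rw [e18 i hi]; exact hb.size_pos i hi
    · rw [e18 i hi]; exact hb.size_le i hi
    · rw [e17 i hi]; exact hb.cap_le i hi
    · obtain ⟨s, h1, h2, h3, h4⟩ := hb.col j hj hex
      exact ⟨s, h1, h2, h3, fun i hi hy => by rw [e18 i hi]; exact h4 i hi hy⟩
    · rw [e17 i hi]; exact hb.load i hi
    · rw [e17 i hi, e17 h hh, e18 i hi, e18 h hh]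
      exact hb.balanced h hh i hi j hj hy hadj

end RAM

/-! ### Sizes of rational numbers and the computation of prices -/

namespace RAM

open Polynomial Chores

/-- If `P` holds, then `v` is a fraction whose numerator and denominator are at most `2 ^ s`. -/
def Fits (P : Prop) (s : ℕ) (v : ℝ) : Prop :=
  P → ∃ (a : ℤ) (b : ℕ), 0 < b ∧ v = a / b ∧ |a| ≤ 2 ^ s ∧ b ≤ 2 ^ s

variable {P : Prop} {s t : ℕ} {v w : ℝ}

theorem Fits.mono (h : Fits P s v) (hst : s ≤ t) : Fits P t v := fun hP => by
  obtain ⟨a, b, hb, hv, ha, hb'⟩ := h hP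
  exact ⟨a, b, hb, hv, ha.trans (by gcongr; norm_num), hb'.trans (by gcongr; norm_num)⟩

theorem fits_natCast {k : ℕ} (hk : k ≤ s) : Fits P s (k : ℝ) := fun _ => by
  have : k ≤ 2 ^ s := (Nat.lt_two_pow_self.le : k ≤ 2 ^ k).trans (by gcongr; norm_num)
  refine ⟨k, 1, by norm_num, by simp, ?_, Nat.one_le_two_pow⟩
  rw [abs_of_nonneg (by positivity)]
  exact_mod_cast this

theorem Fits.mul (hv : Fits P s v) (hw : Fits P t w) : Fits P (s + t) (v * w) := fun hP => by
  obtain ⟨a, b, hb, rfl, ha, hb'⟩ := hv hP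
  obtain ⟨c, d, hd, rfl, hc, hd'⟩ := hw hP
  refine ⟨a * c, b * d, by positivity, by push_cast; field_simp, ?_, ?_⟩
  · rw [abs_mul, pow_add]; gcongr
  · rw [pow_add]; gcongr

/-- Numerator and denominator change places, with the sign moved to the new numerator; zero is its
own inverse by convention. -/
theorem Fits.inv (hv : Fits P s v) : Fits P s v⁻¹ := fun hP => by
  obtain ⟨a, b, hb, rfl, ha, hb'⟩ := hv hP
  rcases eq_or_ne a 0 with rfl | h0
  · exact ⟨0, 1, by norm_num, by simp, by simp, Nat.one_le_two_pow⟩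
  · refine ⟨a.sign * b, a.natAbs, Int.natAbs_pos.2 h0, ?_, ?_, ?_⟩
    · have h1 : (a : ℝ) = a.sign * (a.natAbs : ℝ) := by
        rw [← Int.cast_natCast a.natAbs, ← Int.cast_mul, Int.sign_mul_natAbs]
      have h2 : (a.sign : ℝ) * a.sign = 1 := by
        rcases lt_or_gt_of_ne h0 with h | h
        · rw [Int.sign_eq_neg_one_of_neg h]; norm_num
        · rw [Int.sign_eq_one_of_pos h]; norm_num
      have h3 : (a.natAbs : ℝ) ≠ 0 := by exact_mod_cast (Int.natAbs_pos.2 h0).ne'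
      have h4 : (a : ℝ) ≠ 0 := by exact_mod_cast h0
      rw [inv_div, div_eq_div_iff h4 h3]
      push_cast
      rw [h1]
      linear_combination (-(b : ℝ) * a.natAbs) * h2
    · rw [abs_mul]
      have h1 : |a.sign| = 1 := by
        rcases lt_or_gt_of_ne h0 with h | h
        · rw [Int.sign_eq_neg_one_of_neg h]; norm_num
        · rw [Int.sign_eq_one_of_pos h]; norm_num
      rw [h1, one_mul, abs_of_nonneg (by positivity)]
      exact_mod_cast hb'
    · have : (a.natAbs : ℤ) ≤ 2 ^ s := by rwa [Int.natCast_natAbs]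
      exact_mod_cast this

theorem Fits.div (hv : Fits P s v) (hw : Fits P t w) : Fits P (s + t) (v / w) := by
  rw [div_eq_mul_inv]; exact hv.mul hw.inv

theorem Fits.add (hv : Fits P s v) (hw : Fits P t w) : Fits P (s + t + 1) (v + w) := fun hP => by
  obtain ⟨a, b, hb, rfl, ha, hb'⟩ := hv hP
  obtain ⟨c, d, hd, rfl, hc, hd'⟩ := hw hP
  refine ⟨a * d + c * b, b * d, by positivity, by push_cast; field_simp, ?_, ?_⟩
  · have hd'' : |(d : ℤ)| ≤ 2 ^ t := by rw [abs_of_nonneg (by positivity)]; exact_mod_cast hd'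
    have hb'' : |(b : ℤ)| ≤ 2 ^ s := by rw [abs_of_nonneg (by positivity)]; exact_mod_cast hb'
    calc |a * d + c * b| ≤ |a| * |(d : ℤ)| + |c| * |(b : ℤ)| := by
          rw [← abs_mul, ← abs_mul]; exact abs_add_le _ _
      _ ≤ 2 ^ s * 2 ^ t + 2 ^ t * 2 ^ s := by gcongr
      _ = 2 ^ (s + t + 1) := by ring
  · calc b * d ≤ 2 ^ s * 2 ^ t := by gcongr
      _ = 2 ^ (s + t) := by ring
      _ ≤ _ := Nat.pow_le_pow_right (by norm_num) (by omega)

theorem Fits.neg (hv : Fits P s v) : Fits P s (-v) := fun hP => by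
  obtain ⟨a, b, hb, rfl, ha, hb'⟩ := hv hP
  exact ⟨-a, b, hb, by push_cast; ring, by rwa [abs_neg], hb'⟩

theorem Fits.sub (hv : Fits P s v) (hw : Fits P t w) : Fits P (s + t + 1) (v - w) := by
  rw [sub_eq_add_neg]; exact hv.add hw.neg

/-- Denominators multiply, so each summand adds `d + 1` to the size. The bound stays polynomial as
long as sums are nested to fixed depth. -/
theorem Fits.sum {f : ℕ → ℝ} {d l : ℕ} (hv : Fits P s v) (hf : ∀ i < l, Fits P d (f i)) :
    Fits P (s + l * (d + 1)) (v + ∑ i ∈ Finset.range l, f i) := by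
  induction l with
  | zero => simpa using hv
  | succ l ih =>
    rw [Finset.sum_range_succ, ← add_assoc]
    refine ((ih fun i hi => hf i (by omega)).add (hf l (by omega))).mono (le_of_eq ?_)
    ring

theorem fits_of_bitSize {q : ℚ} (hv : v = q) (hq : bitSize q ≤ s) : Fits P s v := fun _ => by
  have h1 : q.num.natAbs.size ≤ s := by unfold bitSize at hq; omega
  have h2 : q.den.size ≤ s := by unfold bitSize at hq; omega
  refine ⟨q.num, q.den, q.pos, ?_, ?_, (Nat.size_le.1 h2).le⟩
  · rw [hv]; exact_mod_cast (Rat.num_div_den q).symm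
  · have : q.num.natAbs ≤ 2 ^ s := (Nat.size_le.1 h1).le
    rw [Int.abs_eq_natAbs]
    exact_mod_cast this

/-- Reduction to lowest terms only shrinks both parts. A natural number up to `2 ^ s` has at most `s
+ 1` binary digits, and one more bit is for the sign. -/
theorem Fits.exists_rat (hv : Fits P s v) (hP : P) :
    ∃ r : ℚ, v = (r : ℝ) ∧ bitSize r ≤ 2 * s + 3 := by
  obtain ⟨a, b, hb, rfl, ha, hb'⟩ := hv hP
  have hlt : (2 : ℕ) ^ s < 2 ^ (s + 1) := by gcongr <;> norm_num
  refine ⟨(a : ℚ) / ((b : ℤ) : ℚ), by push_cast; rfl, ?_⟩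
  have hb0 : (b : ℤ) ≠ 0 := by exact_mod_cast hb.ne'
  have h1 : ((a : ℚ) / ((b : ℤ) : ℚ)).num.natAbs ≤ a.natAbs := by
    rcases eq_or_ne a 0 with rfl | h0
    · simp
    · rw [← Rat.divInt_eq_div]
      exact Nat.le_of_dvd (Int.natAbs_pos.2 h0) (Int.natAbs_dvd_natAbs.2 (Rat.num_dvd a hb0))
  have h2 : ((a : ℚ) / ((b : ℤ) : ℚ)).den ≤ b := by
    rw [← Rat.divInt_eq_div]
    exact Nat.le_of_dvd hb (by exact_mod_cast Rat.den_dvd a b)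
  have h3 : a.natAbs ≤ 2 ^ s := by
    rw [Int.abs_eq_natAbs] at ha; exact_mod_cast ha
  have h4 := Nat.size_le.2 ((h1.trans h3).trans_lt hlt)
  have h5 := Nat.size_le.2 ((h2.trans hb').trans_lt hlt)
  unfold bitSize
  omega

/-- In memory `σ`, the expression `e` has the value `v`, which has size at most `s`, and all numbers
that occur in its evaluation have size at most `B`. -/
structure HasValue (P : Prop) (B : ℕ) (σ : Memory) (s : ℕ) (e : NExpr) (v : ℝ) : Prop where
  within : e.Within (Fits P B) σ
  eval : e.eval σ = v
  fits : Fits P s v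

variable {B : ℕ} {σ : Memory} {e f : NExpr}

theorem HasValue.add (he : HasValue P B σ s e v) (hf : HasValue P B σ t f w) (hB : s + t + 1 ≤ B) :
    HasValue P B σ (s + t + 1) (.add e f) (v + w) :=
  have heq : NExpr.eval σ (.add e f) = v + w := by simp [NExpr.eval, he.eval, hf.eval]
  ⟨⟨he.within, hf.within, by rw [heq]; exact (he.fits.add hf.fits).mono hB⟩, heq,
    he.fits.add hf.fits⟩

theorem HasValue.sub (he : HasValue P B σ s e v) (hf : HasValue P B σ t f w) (hB : s + t + 1 ≤ B) :
    HasValue P B σ (s + t + 1) (.sub e f) (v - w) :=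
  have heq : NExpr.eval σ (.sub e f) = v - w := by simp [NExpr.eval, he.eval, hf.eval]
  ⟨⟨he.within, hf.within, by rw [heq]; exact (he.fits.sub hf.fits).mono hB⟩, heq,
    he.fits.sub hf.fits⟩

theorem HasValue.mul (he : HasValue P B σ s e v) (hf : HasValue P B σ t f w) (hB : s + t ≤ B) :
    HasValue P B σ (s + t) (.mul e f) (v * w) :=
  have heq : NExpr.eval σ (.mul e f) = v * w := by simp [NExpr.eval, he.eval, hf.eval]
  ⟨⟨he.within, hf.within, by rw [heq]; exact (he.fits.mul hf.fits).mono hB⟩, heq,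
    he.fits.mul hf.fits⟩

theorem HasValue.div (he : HasValue P B σ s e v) (hf : HasValue P B σ t f w) (hB : s + t ≤ B) :
    HasValue P B σ (s + t) (.div e f) (v / w) :=
  have heq : NExpr.eval σ (.div e f) = v / w := by simp [NExpr.eval, he.eval, hf.eval]
  ⟨⟨he.within, hf.within, by rw [heq]; exact (he.fits.div hf.fits).mono hB⟩, heq,
    he.fits.div hf.fits⟩

theorem hasValue_get {A : ℕ} {i j : IExpr} (h : σ.num A (i.eval σ) (j.eval σ) = v)
    (hv : Fits P s v) (hB : s ≤ B) : HasValue P B σ s (.get A i j) v :=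
  ⟨show Fits P B (σ.num A (i.eval σ) (j.eval σ)) by rw [h]; exact hv.mono hB, h, hv⟩

theorem hasValue_ofIdx {i : IExpr} {k : ℕ} (h : i.eval σ = k) (hk : k ≤ s) (hB : s ≤ B) :
    HasValue P B σ s (.ofIdx i) (k : ℝ) :=
  have heq : NExpr.eval σ (.ofIdx i) = (k : ℝ) := by simp [NExpr.eval, h]
  ⟨show Fits P B _ by rw [heq]; exact fits_natCast (hk.trans hB), heq, fits_natCast hk⟩

open Classical in
/-- The equations between the quantities in `equilibrium_of_balanced`, for a balanced allocation
`y i j / size i` with loads `cap i / size i`. -/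
def PriceSpec (n m : ℕ) (a b : ℝ) (adj : ℕ → ℕ → Prop) (y : ℕ → ℕ → ℕ) (size cap : ℕ → ℕ)
    (x : ℕ → ℕ → ℝ) : Prop :=
  ∃ (K E W : ℝ) (e S ρ w r : ℕ → ℝ) (low : ℕ → Prop),
    K = (∑ j ∈ Finset.range m, if ∃ i < n, adj i j then 0 else 1) ∧
    (∀ i < n, e i = cap i / size i) ∧
    (∀ i < n, S i = b * K + ∑ h ∈ Finset.range n, (if e h ≤ e i then a else b) * e h) ∧
    (∀ i < n, low i ↔ n * (a * e i) ≤ S i) ∧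
    E = (b * K + ∑ h ∈ Finset.range n, (if low h then a else b) * e h) / n ∧
    (∀ i < n, ρ i = if low i then 1 else E / (b * e i)) ∧
    W = (∑ h ∈ Finset.range n, if low h then E - a * e h else 0) ∧
    (∀ i < n, w i = if low i then (E - a * e i) / W else 0) ∧
    (∀ j < m, r j = 1 - ∑ i ∈ Finset.range n, y i j / size i * ρ i) ∧
    ∀ i < n, ∀ j < m, x i j = y i j / size i * ρ i + r j * w i

/-- The size of the numbers in `priceProg`, for data of size `L`. -/
def priceSize (L : ℕ) : ℕ := 100 * (L + 1) ^ 3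

/-- `A[i][j] := if b then 1 else 0`. -/
noncomputable abbrev flagI (A : ℕ) (R C : IExpr) (b : Test) : Timed := iteI A R C b (.lit 1)

/-- Entry `i` of a column, where `i` is a counter. -/
abbrev colI (A : ℕ) (v : ℕ) : IExpr := .get A (var v) (.lit 0)

/-- Entry `i` of a column, where `i` is a counter. -/
abbrev colN (A : ℕ) (v : ℕ) : NExpr := .get A (var v) (.lit 0)

/-- The number `A`. -/
abbrev cellN (A : ℕ) : NExpr := .get A (.lit 0) (.lit 0)

/-- The price `a` if `flag` is one, and `b` if it is zero. -/
abbrev priceN (flag : IExpr) : NExpr :=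
  .add (cellN 5) (.mul (.ofIdx flag) (.sub (cellN 3) (cellN 5)))

/-- The fraction of a chore that is assigned by the balanced allocation. -/
abbrev fracN (i j : ℕ) : NExpr := .div (.ofIdx (.get 20 (var i) (var j))) (.ofIdx (colI 18 i))

/-- Compute the equilibrium allocation from the balanced allocation. -/
noncomputable def priceProg : Timed :=
  .seq (countI 23 numChores (.lit 1) numAgents (.idxLt (.lit 0) (.get 4 (var 3) (var 1))))
  (.seq (countI 24 (.lit 1) (.lit 1) numChores (.idxLe (colI 23 3) (.lit 0)))
  (.seq (mapN 6 numAgents (.lit 1) (.div (.ofIdx (colI 17 1)) (.ofIdx (colI 18 1))))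
  (.seq (flagI 26 numAgents numAgents (.numLe (colN 6 2) (colN 6 1)))
  (.seq (sumN 7 numAgents (.lit 1) numAgents (.mul (cellN 5) (.ofIdx (var 24)))
    (.mul (priceN (.get 26 (var 1) (var 3))) (colN 6 3)))
  (.seq (flagI 25 numAgents (.lit 1)
    (.numLe (.mul (.ofIdx numAgents) (.mul (cellN 3) (colN 6 1))) (colN 7 1)))
  (.seq (sumN 8 (.lit 1) (.lit 1) numAgents (.mul (cellN 5) (.ofIdx (var 24)))
    (.mul (priceN (colI 25 3)) (colN 6 3)))
  (.seq (mapN 13 (.lit 1) (.lit 1) (.div (cellN 8) (.ofIdx numAgents)))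
  (.seq (mapN 9 numAgents (.lit 1) (.add (.ofIdx (colI 25 1))
    (.mul (.sub (.ofIdx (.lit 1)) (.ofIdx (colI 25 1)))
      (.div (cellN 13) (.mul (cellN 5) (colN 6 1))))))
  (.seq (sumN 10 (.lit 1) (.lit 1) numAgents (.ofIdx (.lit 0))
    (.mul (.ofIdx (colI 25 3)) (.sub (cellN 13) (.mul (cellN 3) (colN 6 3)))))
  (.seq (mapN 11 numAgents (.lit 1) (.mul (.ofIdx (colI 25 1))
    (.div (.sub (cellN 13) (.mul (cellN 3) (colN 6 1))) (cellN 10))))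
  (.seq (sumN 12 numChores (.lit 1) numAgents (.ofIdx (.lit 1))
    (.sub (.ofIdx (.lit 0)) (.mul (fracN 3 1) (colN 9 3))))
    (mapN 1 numAgents numChores (.add (.mul (fracN 1 2) (colN 9 1))
      (.mul (colN 12 2) (colN 11 1)))))))))))))))

theorem halts_mapN_hasValue {n : ℕ} {A : ℕ} {R C : IExpr} {Post : Memory → Prop} (r s d : ℕ)
    (hr : r ≤ n + 1) (hs : s ≤ n + 1) (F : ℕ → ℕ → ℝ)
    (hR : ∀ τ, Agree {1, 2, 3} {A} σ τ → R.eval τ = r)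
    (hC : ∀ τ, Agree {1, 2, 3} {A} σ τ → C.eval τ = s)
    (hF : ∀ i < r, ∀ j < s, ∀ τ, Agree {1, 2, 3} {A} σ τ →
      τ.idx 1 0 0 = i → τ.idx 2 0 0 = j → HasValue P B τ d e (F i j))
    (hpost : ∀ τ, Agree {1, 2, 3} {A} σ τ → (∀ i < r, ∀ j < s, τ.num A i j = F i j) →
      (∀ i < r, ∀ j < s, Fits P d (F i j)) → Post τ) :
    Runs n (Fits P B) (mapN A R C e) Post σ := by
  refine halts_mapN r s hr hs F hR hC (fun i hi j hj τ hτ h1 h2 =>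
    ⟨(hF i hi j hj τ hτ h1 h2).within, (hF i hi j hj τ hτ h1 h2).eval⟩)
    fun τ hτ h => hpost τ hτ h fun i hi j hj => ?_
  -- The size of `F i j` does not depend on the memory, but is known only through evaluations; `σ`
  -- with its counters set to `i` and `j` is a memory in which to evaluate.
  exact (hF i hi j hj ((σ.setIdx 1 0 0 i).setIdx 2 0 0 j)
    (((Agree.refl _ _ _).setIdx (by simp) _ _ _).setIdx (by simp) _ _ _)
    (by simp [setIdx_idx]) (by simp [setIdx_idx])).fits

theorem halts_sumN_hasValue {n : ℕ} {A : ℕ} {R C N : IExpr} {Post : Memory → Prop}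
    (r s l d₀ d D : ℕ) (hr : r ≤ n + 1) (hs : s ≤ n + 1) (hl : l ≤ n + 1) (a : ℕ → ℕ → ℝ)
    (F : ℕ → ℕ → ℕ → ℝ) (hD : d₀ + l * (d + 1) ≤ D) (hDB : D ≤ B)
    (hR : ∀ τ, Agree {1, 2, 3} {A} σ τ → R.eval τ = r)
    (hC : ∀ τ, Agree {1, 2, 3} {A} σ τ → C.eval τ = s)
    (hN : ∀ τ, Agree {1, 2, 3} {A} σ τ → N.eval τ = l)
    (ha : ∀ i < r, ∀ j < s, ∀ τ, Agree {1, 2, 3} {A} σ τ →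
      τ.idx 1 0 0 = i → τ.idx 2 0 0 = j → HasValue P B τ d₀ e (a i j))
    (hF : ∀ i < r, ∀ j < s, ∀ h < l, ∀ τ, Agree {1, 2, 3} {A} σ τ → τ.idx 1 0 0 = i →
      τ.idx 2 0 0 = j → τ.idx 3 0 0 = h → HasValue P B τ d f (F i j h))
    (hpost : ∀ τ, Agree {1, 2, 3} {A} σ τ →
      (∀ i < r, ∀ j < s, τ.num A i j = a i j + ∑ h ∈ Finset.range l, F i j h) →
      (∀ i < r, ∀ j < s, Fits P D (a i j + ∑ h ∈ Finset.range l, F i j h)) → Post τ) :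
    Runs n (Fits P B) (sumN A R C N e f) Post σ := by
  have hfit : ∀ i < r, ∀ j < s, ∀ l' ≤ l,
      Fits P D (a i j + ∑ h ∈ Finset.range l', F i j h) := by
    intro i hi j hj l' hl'
    have h1 := (ha i hi j hj ((σ.setIdx 1 0 0 i).setIdx 2 0 0 j)
      (((Agree.refl _ _ _).setIdx (by simp) _ _ _).setIdx (by simp) _ _ _)
      (by simp [setIdx_idx]) (by simp [setIdx_idx])).fits
    refine (h1.sum (d := d) fun h hh => (hF i hi j hj h (by omega)
      (((σ.setIdx 1 0 0 i).setIdx 2 0 0 j).setIdx 3 0 0 h)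
      ((((Agree.refl _ _ _).setIdx (by simp) _ _ _).setIdx (by simp) _ _ _).setIdx (by simp) _ _ _)
      (by simp [setIdx_idx]) (by simp [setIdx_idx]) (by simp [setIdx_idx])).fits).mono ?_
    exact (Nat.add_le_add_left (Nat.mul_le_mul_right _ hl') _).trans hD
  exact halts_sumN r s l hr hs hl a F hR hC hN (fun i hi j hj τ hτ h1 h2 =>
    ⟨(ha i hi j hj τ hτ h1 h2).within, (ha i hi j hj τ hτ h1 h2).eval⟩)
    (fun i hi j hj h hh τ hτ h1 h2 h3 =>
      ⟨(hF i hi j hj h hh τ hτ h1 h2 h3).within, (hF i hi j hj h hh τ hτ h1 h2 h3).eval⟩)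
    (fun i hi j hj l' hl' => (hfit i hi j hj l' hl').mono hDB)
    fun τ hτ h => hpost τ hτ h fun i hi j hj => hfit i hi j hj l le_rfl

/-- A flag that selects one of two prices. -/
theorem hasValue_priceN {T : Prop} [Decidable T] {L : ℕ} {a b : ℝ} {flag : IExpr}
    (ha : σ.num 3 0 0 = a) (hb : σ.num 5 0 0 = b) (hfa : Fits P L a) (hfb : Fits P L b)
    (hL : 1 ≤ L) (hB : 4 * L + 2 ≤ B) (h : flag.eval σ = if T then 1 else 0) :
    HasValue P B σ (4 * L + 2) (priceN flag) (if T then a else b) := by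
  have h1 := (hasValue_get (B := B) (A := 5) (i := .lit 0) (j := .lit 0) hb hfb (by omega)).add
    ((hasValue_ofIdx (P := P) (s := L) h (by split_ifs <;> omega) (by omega)).mul
      ((hasValue_get (A := 3) (i := .lit 0) (j := .lit 0) ha hfa (by omega)).sub
        (hasValue_get (A := 5) (i := .lit 0) (j := .lit 0) hb hfb (by omega)) (by omega))
      (by omega)) (by omega)
  refine ⟨h1.within, h1.eval.trans ?_, ?_⟩
  · split_ifs <;> simp
  · have h2 := h1.fits.mono (t := 4 * L + 2) (by omega)
    convert h2 using 1
    split_ifs <;> simp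

/-- Loads `e` have size linear in `L`, the sums giving `S` and `E` make it quadratic, and the sums
giving `W` and `r` make it cubic; no further summation follows. Number arrays 6 to 12 hold `e`, `S`,
the total price, `ρ`, `W`, `w`, `r`, and 13 holds `E`. Cases are selected by multiplying with 0/1
flags, which also cancels quotients with zero denominator. -/
theorem halts_priceProg {n m L : ℕ} {a b : ℝ} {Post : Memory → Prop} (hn : σ.idx 0 0 0 = n)
    (hm : σ.idx 0 0 1 = m) (hn0 : 0 < n) (hL : n + m ≤ L) (ha : σ.num 3 0 0 = a)
    (hb : σ.num 5 0 0 = b) (hfa : Fits P L a) (hfb : Fits P L b)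
    (hbal : Balanced n m (fun i j => 0 < σ.idx 4 i j) (σ.idx 20) (fun i => σ.idx 18 i 0)
      (fun i => σ.idx 17 i 0))
    (hpost : ∀ τ, PriceSpec n m a b (fun i j => 0 < σ.idx 4 i j) (σ.idx 20)
      (fun i => σ.idx 18 i 0) (fun i => σ.idx 17 i 0) (τ.num 1) → Post τ) :
    Runs (n + m) (Fits P (priceSize L)) priceProg Post σ := by
  classical
  set B := priceSize L with hBdef
  set adj : ℕ → ℕ → Prop := fun i j => 0 < σ.idx 4 i j with hadj
  have hB : B = 100 * L ^ 3 + 300 * L ^ 2 + 300 * L + 100 := by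
    simp only [hBdef, priceSize]; ring
  have hL1 : 1 ≤ L := by omega
  refine runs_seq (halts_count (by simp) m 1 n (by omega) (by omega) (by omega)
    (fun j _ i => adj i j) ?_ ?_ ?_ ?_ ?_)
  · intro τ hτ; simp [IExpr.eval, hτ.idx, hm]
  · intro τ hτ; rfl
  · intro τ hτ; simp [IExpr.eval, hτ.idx, hn]
  · intro i hi j hj t ht τ hτ e1 e2 e3
    refine ⟨trivial, ?_⟩
    simp [Test.Holds, IExpr.eval, e1, e3, hτ.idx, hadj, Nat.succ_le_iff]
  intro τ₁ a₁ f₁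
  refine runs_seq (halts_count (by simp) 1 1 m (by omega) (by omega) (by omega)
    (fun _ _ j => τ₁.idx 23 j 0 = 0) ?_ ?_ ?_ ?_ ?_)
  · intro τ hτ; rfl
  · intro τ hτ; rfl
  · intro τ hτ; simp [IExpr.eval, hτ.idx, a₁.idx, hm]
  · intro i hi j hj t ht τ hτ e1 e2 e3
    refine ⟨trivial, ?_⟩
    simp [Test.Holds, IExpr.eval, e3, hτ.idx]
  intro τ₂ a₂ f₂
  set Kn := τ₂.idx 24 0 0 with hKn
  have hKL : Kn ≤ L := by
    rw [hKn, f₂ 0 (by omega) 0 (by omega)]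
    exact (Finset.card_filter_le _ _).trans (by simp; omega)
  have hK : (Kn : ℝ) = ∑ j ∈ Finset.range m, if ∃ i < n, adj i j then 0 else 1 := by
    rw [hKn, f₂ 0 (by omega) 0 (by omega), Finset.card_filter, Nat.cast_sum]
    refine Finset.sum_congr rfl fun j hj => ?_
    rw [f₁ j (Finset.mem_range.1 hj) 0 (by omega)]
    by_cases hex : ∃ i < n, adj i j
    · rw [if_pos hex, if_neg, Nat.cast_zero]
      obtain ⟨i, hi, hE⟩ := hex
      exact Finset.card_ne_zero_of_mem (Finset.mem_filter.2 ⟨Finset.mem_range.2 hi, hE⟩)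
    · rw [if_neg hex, if_pos, Nat.cast_one]
      rw [Finset.card_eq_zero, Finset.filter_eq_empty_iff]
      exact fun i hi hE => hex ⟨i, Finset.mem_range.1 hi, hE⟩
  set e : ℕ → ℝ := fun i => (σ.idx 17 i 0 : ℝ) / σ.idx 18 i 0 with he
  -- With the powers of `L` as atoms, this and the next two inequalities reduce the comparisons of
  -- sizes below to linear arithmetic.
  have hLB : 12 * L ^ 3 + 100 * L ^ 2 + 100 * L + 100 ≤ B := by rw [hB]; omega
  have hQ : L ≤ L ^ 2 := Nat.le_self_pow (by norm_num) L
  have hC : L ^ 2 ≤ L ^ 3 := Nat.pow_le_pow_right hL1 (by norm_num)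
  -- A positive entry is at most the sum of its column, which is the size of a block.
  have hy : ∀ i < n, ∀ j < m, σ.idx 20 i j ≤ L := by
    intro i hi j hj
    rcases Nat.eq_zero_or_pos (σ.idx 20 i j) with h | h
    · omega
    · obtain ⟨s, -, hs, hsum, -⟩ := hbal.col j hj ⟨i, hi, hbal.supp i hi j hj h⟩
      have := Finset.single_le_sum (f := fun i => σ.idx 20 i j) (fun _ _ => Nat.zero_le _)
        (Finset.mem_range.2 hi)
      simp only [hsum] at this
      omega
  refine runs_seq (halts_mapN_hasValue n 1 (L + L) (by omega) (by omega) (fun i _ => e i)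
    ?_ ?_ ?_ ?_)
  · intro τ hτ; simp [IExpr.eval, hτ.idx, a₂.idx, a₁.idx, hn]
  · intro τ hτ; rfl
  · intro i hi j hj τ hτ e1 e2
    have h1 := hbal.cap_le i hi
    have h2 := hbal.size_le i hi
    exact (hasValue_ofIdx (by simp [IExpr.eval, hτ.idx, a₂.idx, a₁.idx, e1])
      (by omega) (by omega)).div (hasValue_ofIdx (by simp [IExpr.eval, hτ.idx, a₂.idx, a₁.idx, e1])
      (by omega) (by omega)) (by omega)
  intro τ₃ a₃ g6 d6
  replace g6 := fun i hi => g6 i hi 0 (by omega)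
  replace d6 := fun i hi => d6 i hi 0 (by omega)
  have n3 : ∀ i, i ≠ 6 → τ₃.num i = σ.num i := fun i hi => by simp [a₃.num, a₂.num, a₁.num, hi]
  have i3 : ∀ i, i ∉ ({1, 2, 3, 23, 24} : Set ℕ) → τ₃.idx i = σ.idx i := fun i hi => by
    simp at hi; simp [a₃.idx, a₂.idx, a₁.idx, hi]
  have k3 : τ₃.idx 24 0 0 = Kn := by simp [a₃.idx, hKn]
  clear_value Kn
  refine runs_seq (halts_iteI (by simp) n n (by omega) (by omega) (fun i h => e h ≤ e i)
    (fun _ _ => 1) ?_ ?_ ?_ ?_)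
  · intro τ hτ; simp [IExpr.eval, hτ.idx, i3, hn]
  · intro τ hτ; simp [IExpr.eval, hτ.idx, i3, hn]
  · intro i hi h hh τ hτ e1 e2
    have v1 : HasValue (P := P) B τ (L + L) (colN 6 2) (e h) :=
      hasValue_get (by simp [IExpr.eval, hτ.num, e2, g6 h hh]) (d6 h hh) (by omega)
    have v2 : HasValue (P := P) B τ (L + L) (colN 6 1) (e i) :=
      hasValue_get (by simp [IExpr.eval, hτ.num, e1, g6 i hi]) (d6 i hi) (by omega)
    refine ⟨⟨v1.within, v2.within⟩, ?_, rfl⟩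
    simp only [Test.Holds, v1.eval, v2.eval]
  intro τ₄ a₄ g26
  have vK : ∀ τ, τ.num 5 = τ₄.num 5 → τ.idx 24 = τ₄.idx 24 → HasValue P B τ (L + L)
      (.mul (cellN 5) (.ofIdx (var 24))) (b * Kn) := fun τ h5 h24 =>
    (hasValue_get (by simp [IExpr.eval, h5, a₄.num, n3, hb]) hfb (by omega)).mul
      (hasValue_ofIdx (by simp [IExpr.eval, h24, a₄.idx, k3]) hKL (by omega)) (by omega)
  set S : ℕ → ℝ := fun i => b * Kn + ∑ h ∈ Finset.range n, (if e h ≤ e i then a else b) * e h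
    with hS
  refine runs_seq (halts_sumN_hasValue n 1 n (L + L) (4 * L + 2 + (L + L)) (6 * L ^ 2 + 5 * L)
    (by omega) (by omega) (by omega) (fun _ _ => b * Kn)
    (fun i _ h => (if e h ≤ e i then a else b) * e h) ?_ (by omega) ?_ ?_ ?_ ?_ ?_ ?_)
  · calc _ ≤ L + L + L * (4 * L + 2 + (L + L) + 1) := by gcongr; omega
      _ = _ := by ring
  · intro τ hτ; simp [IExpr.eval, hτ.idx, a₄.idx, i3, hn]
  · intro τ hτ; rfl
  · intro τ hτ; simp [IExpr.eval, hτ.idx, a₄.idx, i3, hn]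
  · intro i hi j hj τ hτ e1 e2
    exact vK τ (hτ.num 5 (by simp)) (hτ.idx 24 (by simp))
  · intro i hi j hj h hh τ hτ e1 e2 e3
    exact (hasValue_priceN (by simp [hτ.num, a₄.num, n3, ha]) (by simp [hτ.num, a₄.num, n3, hb])
      hfa hfb hL1 (by omega) (by simp [IExpr.eval, hτ.idx, e1, e3, g26 i hi h hh])).mul
      (hasValue_get (by simp [IExpr.eval, hτ.num, a₄.num, e3, g6 h hh]) (d6 h hh) (by omega))
      (by omega)
  intro τ₅ a₅ g7 d7
  replace g7 : ∀ i < n, τ₅.num 7 i 0 = S i := fun i hi => g7 i hi 0 (by omega)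
  replace d7 : ∀ i < n, Fits P (6 * L ^ 2 + 5 * L) (S i) := fun i hi => d7 i hi 0 (by omega)
  set low : ℕ → Prop := fun i => n * (a * e i) ≤ S i with hlow
  refine runs_seq (halts_iteI (by simp) n 1 (by omega) (by omega) (fun i _ => low i)
    (fun _ _ => 1) ?_ ?_ ?_ ?_)
  · intro τ hτ; simp [IExpr.eval, hτ.idx, a₅.idx, a₄.idx, i3, hn]
  · intro τ hτ; rfl
  · intro i hi j hj τ hτ e1 e2
    have v1 : HasValue P B τ (L + (L + (L + L)))
        (.mul (.ofIdx numAgents) (.mul (cellN 3) (colN 6 1))) (n * (a * e i)) :=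
      (hasValue_ofIdx (by simp [IExpr.eval, hτ.idx, a₅.idx, a₄.idx, i3, hn]) (by omega)
        (by omega)).mul ((hasValue_get (by simp [IExpr.eval, hτ.num, a₅.num, a₄.num, n3, ha]) hfa
          (by omega)).mul (hasValue_get
            (by simp [IExpr.eval, hτ.num, a₅.num, a₄.num, e1, g6 i hi]) (d6 i hi) (by omega))
          (by omega)) (by omega)
    have v2 : HasValue P B τ (6 * L ^ 2 + 5 * L) (colN 7 1) (S i) :=
      hasValue_get (by simp [IExpr.eval, hτ.num, e1, g7 i hi]) (d7 i hi) (by omega)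
    refine ⟨⟨v1.within, v2.within⟩, ?_, rfl⟩
    simp only [Test.Holds, v1.eval, v2.eval, hlow]
  intro τ₆ a₆ g25
  replace g25 := fun i hi => g25 i hi 0 (by omega)
  have n6 : ∀ i, i ∉ ({6, 7} : Set ℕ) → τ₆.num i = σ.num i := fun i hi => by
    simp at hi; simp [a₆.num, a₅.num, a₄.num, n3, hi]
  have i6 : ∀ i, i ∉ ({1, 2, 3, 23, 24, 25, 26} : Set ℕ) → τ₆.idx i = σ.idx i := fun i hi => by
    simp at hi; simp [a₆.idx, a₅.idx, a₄.idx, i3, hi]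
  have h6 : ∀ i < n, τ₆.num 6 i 0 = e i := fun i hi => by simp [a₆.num, a₅.num, a₄.num, g6 i hi]
  have vlow : ∀ τ i, i < n → ∀ v, τ.idx v 0 0 = i → τ.idx 25 = τ₆.idx 25 →
      HasValue P B τ L (.ofIdx (colI 25 v)) ((if low i then 1 else 0 : ℕ) : ℝ) :=
    fun τ i hi v h1 h2 => hasValue_ofIdx (by simp [IExpr.eval, h1, h2, g25 i hi])
      (by split_ifs <;> omega) (by omega)
  refine runs_seq (halts_sumN_hasValue 1 1 n (L + L) (4 * L + 2 + (L + L)) (6 * L ^ 2 + 5 * L)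
    (by omega) (by omega) (by omega) (fun _ _ => b * Kn)
    (fun _ _ h => (if low h then a else b) * e h) ?_ (by omega) ?_ ?_ ?_ ?_ ?_ ?_)
  · calc _ ≤ L + L + L * (4 * L + 2 + (L + L) + 1) := by gcongr; omega
      _ = _ := by ring
  · intro τ hτ; rfl
  · intro τ hτ; rfl
  · intro τ hτ; simp [IExpr.eval, hτ.idx, i6, hn]
  · intro i hi j hj τ hτ e1 e2
    exact vK τ (by simp [hτ.num, a₆.num, a₅.num]) (by simp [hτ.idx, a₆.idx, a₅.idx])
  · intro i hi j hj h hh τ hτ e1 e2 e3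
    exact (hasValue_priceN (by simp [hτ.num, n6, ha]) (by simp [hτ.num, n6, hb])
      hfa hfb hL1 (by omega) (by simp [IExpr.eval, hτ.idx, e3, g25 h hh])).mul
      (hasValue_get (by simp [IExpr.eval, hτ.num, e3, h6 h hh]) (d6 h hh) (by omega))
      (by omega)
  intro τ₇ a₇ g8 d8
  replace g8 := g8 0 (by omega) 0 (by omega)
  replace d8 := d8 0 (by omega) 0 (by omega)
  set E : ℝ := (b * Kn + ∑ h ∈ Finset.range n, (if low h then a else b) * e h) / n with hE
  refine runs_seq (halts_mapN_hasValue 1 1 (6 * L ^ 2 + 5 * L + L) (by omega) (by omega)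
    (fun _ _ => E) ?_ ?_ ?_ ?_)
  · intro τ hτ; rfl
  · intro τ hτ; rfl
  · intro i hi j hj τ hτ e1 e2
    exact (hasValue_get (by simp [IExpr.eval, hτ.num, g8]) d8 (by omega)).div
      (hasValue_ofIdx (by simp [IExpr.eval, hτ.idx, a₇.idx, i6, hn]) (by omega) (by omega))
      (by omega)
  intro τ₈ a₈ g13 d13
  replace g13 := g13 0 (by omega) 0 (by omega)
  replace d13 := d13 0 (by omega) 0 (by omega)
  have i8 : ∀ i, i ∉ ({1, 2, 3, 23, 24, 25, 26} : Set ℕ) → τ₈.idx i = σ.idx i := fun i hi => by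
    simp at hi; simp [a₈.idx, a₇.idx, i6, hi]
  have n8 : ∀ i, i ∉ ({6, 7, 8, 13} : Set ℕ) → τ₈.num i = σ.num i := fun i hi => by
    simp at hi; simp [a₈.num, a₇.num, n6, hi]
  have h8 : ∀ i < n, τ₈.num 6 i 0 = e i := fun i hi => by simp [a₈.num, a₇.num, h6 i hi]
  have vE : ∀ τ, τ.num 13 = τ₈.num 13 → HasValue P B τ (6 * L ^ 2 + 5 * L + L) (cellN 13) E :=
    fun τ h => hasValue_get (by simp [IExpr.eval, h, g13]) d13 (by omega)
  have ve : ∀ τ i, i < n → ∀ v, τ.idx v 0 0 = i → τ.num 6 = τ₈.num 6 →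
      HasValue P B τ (L + L) (colN 6 v) (e i) := fun τ i hi v h1 h2 =>
    hasValue_get (by simp [IExpr.eval, h1, h2, h8 i hi]) (d6 i hi) (by omega)
  have vb : ∀ τ, τ.num 5 = τ₈.num 5 → HasValue P B τ L (cellN 5) b := fun τ h =>
    hasValue_get (by simp [IExpr.eval, h, n8, hb]) hfb (by omega)
  have va : ∀ τ, τ.num 3 = τ₈.num 3 → HasValue P B τ L (cellN 3) a := fun τ h =>
    hasValue_get (by simp [IExpr.eval, h, n8, ha]) hfa (by omega)
  have v1 : ∀ τ, HasValue P B τ L (.ofIdx (.lit 1)) ((1 : ℕ) : ℝ) := fun τ =>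
    hasValue_ofIdx rfl hL1 (by omega)
  have v0 : ∀ τ, HasValue P B τ L (.ofIdx (.lit 0)) ((0 : ℕ) : ℝ) := fun τ =>
    hasValue_ofIdx rfl (by omega) (by omega)
  have vy : ∀ τ i j, i < n → j < m → ∀ u v, τ.idx u 0 0 = i → τ.idx v 0 0 = j →
      τ.idx 20 = σ.idx 20 → τ.idx 18 = σ.idx 18 →
      HasValue P B τ (L + L) (fracN u v) (σ.idx 20 i j / σ.idx 18 i 0) := by
    intro τ i j hi hj u v h1 h2 h3 h4
    have := hbal.size_le i hi
    exact (hasValue_ofIdx (by simp [IExpr.eval, h1, h2, h3]) (hy i hi j hj) (by omega)).div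
      (hasValue_ofIdx (by simp [IExpr.eval, h1, h4]) (by omega) (by omega)) (by omega)
  refine runs_seq (halts_mapN_hasValue n 1
    (L + (L + L + 1 + (6 * L ^ 2 + 5 * L + L + (L + (L + L)))) + 1) (by omega) (by omega)
    (fun i _ => ((if low i then 1 else 0 : ℕ) : ℝ) +
      (((1 : ℕ) : ℝ) - ((if low i then 1 else 0 : ℕ) : ℝ)) *
        (E / (b * e i))) ?_ ?_ (fun i hi j hj τ hτ e1 e2 => ?_) ?_)
  · intro τ hτ; simp [IExpr.eval, hτ.idx, i8, hn]
  · intro τ hτ; rfl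
  · have hl := vlow τ i hi 1 e1 (by simp [hτ.idx, a₈.idx, a₇.idx])
    exact hl.add (((v1 τ).sub hl (by omega)).mul ((vE τ (hτ.num 13 (by simp))).div
      ((vb τ (hτ.num 5 (by simp))).mul (ve τ i hi 1 e1 (hτ.num 6 (by simp))) (by omega))
      (by omega)) (by omega)) (by omega)
  intro τ₉ a₉ g9 d9
  replace g9 := fun i hi => g9 i hi 0 (by omega)
  replace d9 := fun i hi => (d9 i hi 0 (by omega)).mono
    (t := 6 * L ^ 2 + 12 * L + 2) (by omega)
  set ρ : ℕ → ℝ := fun i => ((if low i then 1 else 0 : ℕ) : ℝ) +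
    (((1 : ℕ) : ℝ) - ((if low i then 1 else 0 : ℕ) : ℝ)) * (E / (b * e i)) with hρ
  have hsum : ∀ d₀ d D l : ℕ, l ≤ L → d₀ + (L * d + L) ≤ D → d₀ + l * (d + 1) ≤ D := by
    intro d₀ d D l hl h
    refine le_trans (Nat.add_le_add_left (Nat.mul_le_mul_right _ hl) _) ?_
    rwa [Nat.mul_succ]
  refine runs_seq (halts_sumN_hasValue 1 1 n L (L + (6 * L ^ 2 + 5 * L + L + (L + (L + L)) + 1))
    (6 * L ^ 3 + 10 * L ^ 2 + 3 * L) (by omega) (by omega) (by omega) (fun _ _ => ((0 : ℕ) : ℝ))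
    (fun _ _ h => ((if low h then 1 else 0 : ℕ) : ℝ) * (E - a * e h)) ?_ (by omega) ?_ ?_ ?_ ?_
    (fun i hi j hj h hh τ hτ e1 e2 e3 => ?_) ?_)
  · refine hsum _ _ _ _ (by omega) (le_of_eq (by ring))
  · intro τ hτ; rfl
  · intro τ hτ; rfl
  · intro τ hτ; simp [IExpr.eval, hτ.idx, a₉.idx, i8, hn]
  · intro i hi j hj τ hτ e1 e2; exact v0 τ
  · exact (vlow τ h hh 3 e3 (by simp [hτ.idx, a₉.idx, a₈.idx, a₇.idx])).mul
      ((vE τ (by simp [hτ.num, a₉.num])).sub ((va τ (by simp [hτ.num, a₉.num])).mul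
        (ve τ h hh 3 e3 (by simp [hτ.num, a₉.num])) (by omega)) (by omega)) (by omega)
  intro τ₁₀ a₁₀ g10 d10
  replace g10 := g10 0 (by omega) 0 (by omega)
  replace d10 := d10 0 (by omega) 0 (by omega)
  set W : ℝ := ((0 : ℕ) : ℝ) + ∑ h ∈ Finset.range n,
    ((if low h then 1 else 0 : ℕ) : ℝ) * (E - a * e h) with hW
  refine runs_seq (halts_mapN_hasValue n 1
    (L + (6 * L ^ 2 + 5 * L + L + (L + (L + L)) + 1 + (6 * L ^ 3 + 10 * L ^ 2 + 3 * L)))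
    (by omega) (by omega) (fun i _ => ((if low i then 1 else 0 : ℕ) : ℝ) * ((E - a * e i) / W))
    ?_ ?_
      (fun i hi j hj τ hτ e1 e2 => ?_) ?_)
  · intro τ hτ; simp [IExpr.eval, hτ.idx, a₁₀.idx, a₉.idx, i8, hn]
  · intro τ hτ; rfl
  · exact (vlow τ i hi 1 e1 (by simp [hτ.idx, a₁₀.idx, a₉.idx, a₈.idx, a₇.idx])).mul
      (((vE τ (by simp [hτ.num, a₁₀.num, a₉.num])).sub
        ((va τ (by simp [hτ.num, a₁₀.num, a₉.num])).mul
          (ve τ i hi 1 e1 (by simp [hτ.num, a₁₀.num, a₉.num])) (by omega)) (by omega)).div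
        (hasValue_get (by simp [IExpr.eval, hτ.num, g10]) d10 (by omega)) (by omega)) (by omega)
  intro τ₁₁ a₁₁ g11 d11
  replace g11 := fun i hi => g11 i hi 0 (by omega)
  replace d11 := fun i hi => (d11 i hi 0 (by omega)).mono
    (t := 6 * L ^ 3 + 16 * L ^ 2 + 13 * L + 1) (by omega)
  set w : ℕ → ℝ := fun i => ((if low i then 1 else 0 : ℕ) : ℝ) * ((E - a * e i) / W) with hw
  have i11 : ∀ i, i ∉ ({1, 2, 3, 23, 24, 25, 26} : Set ℕ) → τ₁₁.idx i = σ.idx i :=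
    fun i hi => by
      have h := i8 i hi
      simp at hi; simp [a₁₁.idx, a₁₀.idx, a₉.idx, h, hi]
  refine runs_seq (halts_sumN_hasValue m 1 n L (L + (L + L + (6 * L ^ 2 + 12 * L + 2)) + 1)
    (6 * L ^ 3 + 15 * L ^ 2 + 5 * L) (by omega) (by omega) (by omega) (fun _ _ => ((1 : ℕ) : ℝ))
    (fun j _ i => ((0 : ℕ) : ℝ) - σ.idx 20 i j / σ.idx 18 i 0 * ρ i) ?_ (by omega) ?_ ?_ ?_ ?_
    (fun j hj j' hj' i hi τ hτ e1 e2 e3 => ?_) ?_)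
  · refine hsum _ _ _ _ (by omega) (le_of_eq (by ring))
  · intro τ hτ; simp [IExpr.eval, hτ.idx, i11, hm]
  · intro τ hτ; rfl
  · intro τ hτ; simp [IExpr.eval, hτ.idx, i11, hn]
  · intro i hi j hj τ hτ e1 e2; exact v1 τ
  · exact (v0 τ).sub ((vy τ i j hi hj 3 1 e3 e1 (by simp [hτ.idx, i11])
      (by simp [hτ.idx, i11])).mul (hasValue_get
        (by simpa [IExpr.eval, hτ.num, a₁₁.num, a₁₀.num, e3, hρ] using g9 i hi)
        (d9 i hi) (by omega))
      (by omega)) (by omega)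
  intro τ₁₂ a₁₂ g12 d12
  replace g12 := fun j hj => g12 j hj 0 (by omega)
  replace d12 := fun j hj => d12 j hj 0 (by omega)
  set r : ℕ → ℝ := fun j => ((1 : ℕ) : ℝ) +
    ∑ i ∈ Finset.range n, (((0 : ℕ) : ℝ) - σ.idx 20 i j / σ.idx 18 i 0 * ρ i) with hr
  refine halts_mapN_hasValue n m (L + L + (6 * L ^ 2 + 12 * L + 2) +
    (6 * L ^ 3 + 15 * L ^ 2 + 5 * L + (6 * L ^ 3 + 16 * L ^ 2 + 13 * L + 1)) + 1) (by omega) (by omega)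
    (fun i j => σ.idx 20 i j / σ.idx 18 i 0 * ρ i + r j * w i) ?_ ?_ (fun i hi j hj τ hτ e1 e2 => ?_) ?_
  · intro τ hτ; simp [IExpr.eval, hτ.idx, a₁₂.idx, i11, hn]
  · intro τ hτ; simp [IExpr.eval, hτ.idx, a₁₂.idx, i11, hm]
  · exact ((vy τ i j hi hj 1 2 e1 e2 (by simp [hτ.idx, a₁₂.idx, i11])
      (by simp [hτ.idx, a₁₂.idx, i11])).mul (hasValue_get
        (by simpa [IExpr.eval, hτ.num, a₁₂.num, a₁₁.num, a₁₀.num, e1, hρ] using g9 i hi) (d9 i hi)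
        (by omega)) (by omega)).add
      ((hasValue_get (by simp [IExpr.eval, hτ.num, e2, g12 j hj]) (d12 j hj) (by omega)).mul
        (hasValue_get (by simpa [IExpr.eval, hτ.num, a₁₂.num, e1, hw] using g11 i hi) (d11 i hi)
          (by omega)) (by omega)) (by omega)
  intro τ hτ hx _
  refine hpost τ ⟨Kn, E, W, e, S, ρ, w, r, low, by convert hK, fun _ _ => rfl, fun _ _ => rfl,
    fun _ _ => Iff.rfl, rfl, fun i _ => ?_, ?_, fun i _ => ?_, fun j _ => ?_, hx⟩
  · simp only [hρ]; split_ifs <;> simp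
  · rw [hW, Nat.cast_zero, zero_add]
    refine Finset.sum_congr rfl fun h _ => ?_
    split_ifs <;> simp
  · simp only [hw]; split_ifs <;> simp
  · simp only [hr, Nat.cast_one, Nat.cast_zero, zero_sub, Finset.sum_neg_distrib, ← sub_eq_add_neg]

end RAM

/-! ### Finding the two cost values -/

namespace RAM

open Polynomial Chores

variable {P : Prop} {k : ℕ} {ok : ℝ → Prop} {σ : Memory} {Post : Memory → Prop}

/-- `A[i][j] := e₀`, and then, for all `l < L` in turn, `A[i][j] := e` if `b`. -/
noncomputable def pickN (A : ℕ) (R C L : IExpr) (e₀ : NExpr) (b : Test) (e : NExpr) : Timed :=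
  ⟨tableN A R C L e₀ b e, fillTime R C L e₀.cost b.cost e.cost⟩

/-- With `≤` this computes a minimum, with `≥` a maximum. The alternative `l = 0` covers an empty
range, for which the initial value remains. -/
theorem halts_pickN (rel : ℝ → ℝ → Prop) [IsTrans ℝ rel] [Std.Total rel] {A : ℕ} {R C L : IExpr}
    {e₀ e : NExpr} {b : Test} (r s t : ℕ) (hr : r ≤ k + 1) (hs : s ≤ k + 1) (ht : t ≤ k + 1)
    (F : ℕ → ℕ → ℕ → ℝ)
    (hR : ∀ τ, Agree {1, 2, 3} {A} σ τ → R.eval τ = r)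
    (hC : ∀ τ, Agree {1, 2, 3} {A} σ τ → C.eval τ = s)
    (hL : ∀ τ, Agree {1, 2, 3} {A} σ τ → L.eval τ = t)
    (ha : ∀ i < r, ∀ j < s, ∀ τ, Agree {1, 2, 3} {A} σ τ →
      τ.idx 1 0 0 = i → τ.idx 2 0 0 = j → e₀.Within ok τ ∧ e₀.eval τ = F i j 0)
    (hF : ∀ i < r, ∀ j < s, ∀ l < t, ∀ τ, Agree {1, 2, 3} {A} σ τ →
      τ.idx 1 0 0 = i → τ.idx 2 0 0 = j → τ.idx 3 0 0 = l →
      (∃ l', (l' = 0 ∨ l' < t) ∧ τ.num A i j = F i j l') →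
      (b.Within ok τ ∧ (b.Holds τ ↔ rel (F i j l) (τ.num A i j))) ∧
        e.Within ok τ ∧ e.eval τ = F i j l)
    (hpost : ∀ τ, Agree {1, 2, 3} {A} σ τ →
      (∀ i < r, ∀ j < s, (∃ l, (l = 0 ∨ l < t) ∧ τ.num A i j = F i j l) ∧
        ∀ l < t, rel (τ.num A i j) (F i j l)) → Post τ) :
    Runs k ok (pickN A R C L e₀ b e) Post σ := by
  refine halts_tableN (ok := ok) (k := k) (σ := σ) (Post := Post) r s t hr hs ht
    (fun i j l x => (∃ l', (l' = 0 ∨ l' < l) ∧ x = F i j l') ∧ ∀ l' < l, rel x (F i j l'))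
    hR hC hL ?_ ?_ hpost
  · intro i hi j hj τ hτ h1 h2
    obtain ⟨hw, he⟩ := ha i hi j hj τ hτ h1 h2
    exact ⟨hw, ⟨0, Or.inl rfl, he⟩, by simp⟩
  · rintro i hi j hj l hl τ hτ h1 h2 h3 ⟨⟨l₀, hl₀, hx⟩, hall⟩
    obtain ⟨⟨hw, hb⟩, hew, he⟩ := hF i hi j hj l hl τ hτ h1 h2 h3
      ⟨l₀, hl₀.imp_right (by omega), hx⟩
    refine ⟨hw, fun h => ⟨hew, ⟨l, by omega, he⟩, fun l' hl' => ?_⟩,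
      fun h => ⟨⟨l₀, by omega, hx⟩, fun l' hl' => ?_⟩⟩
    · rw [he]
      rcases Nat.lt_succ_iff_lt_or_eq.1 hl' with h' | rfl
      · exact _root_.trans (hb.1 h) (hall l' h')
      · exact (Std.Total.total (r := rel) _ _).elim id id
    · rcases Nat.lt_succ_iff_lt_or_eq.1 hl' with h' | rfl
      · exact hall l' h'
      · exact (Std.Total.total (r := rel) _ _).resolve_right fun h' => h (hb.2 h')

/-- The entry at a position given by two counters. -/
abbrev entryN (A i j : ℕ) : NExpr := .get A (var i) (var j)

/-- Compute the least and the greatest cost, and which agents have the least cost for which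
chores. -/
noncomputable def extremesProg : Timed :=
  .seq (pickN 2 numAgents (.lit 1) numChores (colN 0 1) (.numLe (entryN 0 1 3) (entryN 2 1 2))
    (entryN 0 1 3))
  (.seq (pickN 3 (.lit 1) (.lit 1) numAgents (cellN 2) (.numLe (colN 2 3) (entryN 3 1 2))
    (colN 2 3))
  (.seq (pickN 4 numAgents (.lit 1) numChores (colN 0 1) (.numLe (entryN 4 1 2) (entryN 0 1 3))
    (entryN 0 1 3))
  (.seq (pickN 5 (.lit 1) (.lit 1) numAgents (cellN 4) (.numLe (entryN 5 1 2) (colN 4 3))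
    (colN 4 3))
    (flagI 4 numAgents numChores (.numLe (entryN 0 1 2) (cellN 3))))))

theorem halts_extremesProg {n m : ℕ} (hn : σ.idx 0 0 0 = n) (hm : σ.idx 0 0 1 = m) (hn0 : 0 < n)
    (hok : ∀ i j, ok (σ.num 0 i j))
    (hpost : ∀ τ, Agree {4, 1, 2, 3} {2, 3, 4, 5} σ τ →
      (∃ i < n, ∃ j, (j = 0 ∨ j < m) ∧ τ.num 3 0 0 = σ.num 0 i j) →
      (∃ i < n, ∃ j, (j = 0 ∨ j < m) ∧ τ.num 5 0 0 = σ.num 0 i j) →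
      (∀ i < n, ∀ j < m, τ.num 3 0 0 ≤ σ.num 0 i j ∧ σ.num 0 i j ≤ τ.num 5 0 0) →
      (∀ i < n, ∀ j < m, 0 < τ.idx 4 i j ↔ σ.num 0 i j ≤ τ.num 3 0 0) → Post τ) :
    Runs (n + m) ok extremesProg Post σ := by
  classical
  refine runs_seq (halts_pickN (· ≤ ·) n 1 m (by omega) (by omega) (by omega)
    (fun i _ j => σ.num 0 i j) ?_ ?_ ?_ ?_ ?_ ?_)
  · intro τ hτ; simp [IExpr.eval, hτ.idx, hn]
  · intro τ hτ; rfl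
  · intro τ hτ; simp [IExpr.eval, hτ.idx, hm]
  · intro i hi j hj τ hτ e1 e2
    simp [NExpr.Within, NExpr.eval, IExpr.eval, hτ.num, hok]
    rw [e1]
  · rintro i hi j hj l hl τ hτ e1 e2 e3 ⟨l', -, hl'⟩
    simp only [Test.Within, Test.Holds, NExpr.Within, NExpr.eval, IExpr.eval, e1, e2, e3, hl',
      hτ.num 0 (by simp), hok, and_self]
  intro τ₁ a₁ g₁
  have p : ∀ i < n, ok (τ₁.num 2 i 0) := fun i hi => by
    obtain ⟨⟨j, -, hj⟩, -⟩ := g₁ i hi 0 (by omega)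
    rw [hj]; exact hok i j
  refine runs_seq (halts_pickN (· ≤ ·) 1 1 n (by omega) (by omega) (by omega)
    (fun _ _ i => τ₁.num 2 i 0) ?_ ?_ ?_ ?_ ?_ ?_)
  · intro τ hτ; rfl
  · intro τ hτ; rfl
  · intro τ hτ; simp [IExpr.eval, hτ.idx, a₁.idx, hn]
  · intro i hi j hj τ hτ e1 e2
    simp [NExpr.Within, NExpr.eval, IExpr.eval, hτ.num, p 0 hn0]
  · rintro i hi j hj l hl τ hτ e1 e2 e3 ⟨l', h', hl'⟩
    simp only [Test.Within, Test.Holds, NExpr.Within, NExpr.eval, IExpr.eval, e1, e2, e3, hl',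
      hτ.num 2 (by simp), p l hl, p l' (by omega), and_self]
  intro τ₂ a₂ g₂
  have c₂ : τ₂.num 0 = σ.num 0 := by simp [a₂.num, a₁.num]
  refine runs_seq (halts_pickN (· ≥ ·) n 1 m (by omega) (by omega) (by omega)
    (fun i _ j => σ.num 0 i j) ?_ ?_ ?_ ?_ ?_ ?_)
  · intro τ hτ; simp [IExpr.eval, hτ.idx, a₂.idx, a₁.idx, hn]
  · intro τ hτ; rfl
  · intro τ hτ; simp [IExpr.eval, hτ.idx, a₂.idx, a₁.idx, hm]
  · intro i hi j hj τ hτ e1 e2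
    simp [NExpr.Within, NExpr.eval, IExpr.eval, hτ.num, c₂, hok]
    rw [e1]
  · rintro i hi j hj l hl τ hτ e1 e2 e3 ⟨l', -, hl'⟩
    simp only [Test.Within, Test.Holds, NExpr.Within, NExpr.eval, IExpr.eval, e1, e2, e3, hl',
      hτ.num 0 (by simp), c₂, hok, and_self, ge_iff_le]
  intro τ₃ a₃ g₃
  have q : ∀ i < n, ok (τ₃.num 4 i 0) := fun i hi => by
    obtain ⟨⟨j, -, hj⟩, -⟩ := g₃ i hi 0 (by omega)
    rw [hj]; exact hok i j
  refine runs_seq (halts_pickN (· ≥ ·) 1 1 n (by omega) (by omega) (by omega)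
    (fun _ _ i => τ₃.num 4 i 0) ?_ ?_ ?_ ?_ ?_ ?_)
  · intro τ hτ; rfl
  · intro τ hτ; rfl
  · intro τ hτ; simp [IExpr.eval, hτ.idx, a₃.idx, a₂.idx, a₁.idx, hn]
  · intro i hi j hj τ hτ e1 e2
    simp [NExpr.Within, NExpr.eval, IExpr.eval, hτ.num, q 0 hn0]
  · rintro i hi j hj l hl τ hτ e1 e2 e3 ⟨l', h', hl'⟩
    simp only [Test.Within, Test.Holds, NExpr.Within, NExpr.eval, IExpr.eval, e1, e2, e3, hl',
      hτ.num 4 (by simp), q l hl, q l' (by omega), and_self, ge_iff_le]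
  intro τ₄ a₄ g₄
  have h3 : τ₄.num 3 0 0 = τ₂.num 3 0 0 := by simp [a₄.num, a₃.num]
  have c₄ : τ₄.num 0 = σ.num 0 := by simp [a₄.num, a₃.num, c₂]
  obtain ⟨⟨i₁, hi₁, e₁⟩, l₁⟩ := g₂ 0 (by omega) 0 (by omega)
  obtain ⟨⟨j₁, hj₁, e₁'⟩, -⟩ := g₁ i₁ (by omega) 0 (by omega)
  obtain ⟨⟨i₂, hi₂, e₂⟩, l₂⟩ := g₄ 0 (by omega) 0 (by omega)
  obtain ⟨⟨j₂, hj₂, e₂'⟩, -⟩ := g₃ i₂ (by omega) 0 (by omega)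
  refine halts_iteI (by simp) n m (by omega) (by omega)
    (fun i j => σ.num 0 i j ≤ τ₂.num 3 0 0) (fun _ _ => 1) ?_ ?_ ?_ ?_
  · intro τ hτ; simp [IExpr.eval, hτ.idx, a₄.idx, a₃.idx, a₂.idx, a₁.idx, hn]
  · intro τ hτ; simp [IExpr.eval, hτ.idx, a₄.idx, a₃.idx, a₂.idx, a₁.idx, hm]
  · intro i hi j hj τ hτ e1 e2
    simp only [Test.Within, Test.Holds, NExpr.Within, NExpr.eval, IExpr.eval, e1, e2,
      hτ.num 0 (by simp), hτ.num 3 (by simp), c₄, h3, hok, and_self, true_and, and_true]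
    rw [e₁, e₁']
    exact hok _ _
  intro τ₅ a₅ g₅
  have f3 : τ₅.num 3 0 0 = τ₂.num 3 0 0 := by rw [a₅.num 3 (by simp), h3]
  have f5 : τ₅.num 5 0 0 = τ₄.num 5 0 0 := by rw [a₅.num 5 (by simp)]
  refine hpost τ₅ ?_ ⟨i₁, by omega, j₁, hj₁, by rw [f3, e₁, e₁']⟩
    ⟨i₂, by omega, j₂, hj₂, by rw [f5, e₂, e₂']⟩ (fun i hi j hj => ⟨?_, ?_⟩) fun i hi j hj => ?_
  · have h1 := ((a₁.mono (S' := {4, 1, 2, 3}) (T' := {2, 3, 4, 5}) (by simp) (by simp)).trans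
      (a₂.mono (by simp) (by simp)))
    exact ((h1.trans (a₃.mono (by simp) (by simp))).trans (a₄.mono (by simp) (by simp))).trans
      (a₅.mono (by simp) (by simp))
  · rw [f3]
    exact (l₁ i hi).trans ((g₁ i hi 0 (by omega)).2 j hj)
  · rw [f5]
    exact ((g₃ i hi 0 (by omega)).2 j hj).trans (l₂ i hi)
  · rw [g₅ i hi j hj, f3]
    split_ifs with h <;> simp [h]

end RAM

/-! ### Assembly: correctness, running time and encoding length -/

namespace Chores

/-- Balanced allocations and the prices computed from them yield fair and efficient allocations. -/
theorem PriceSpec.solution {n m : ℕ} {c : Fin n → Fin m → ℝ} {a b : ℝ} {adj : ℕ → ℕ → Prop}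
    {y : ℕ → ℕ → ℕ} {size cap : ℕ → ℕ} {x : ℕ → ℕ → ℝ} (hn : 0 < n) (ha : 0 < a) (hab : a ≤ b)
    (hc : ∀ i j, c i j = a ∨ c i j = b)
    (hadj : ∀ (i : Fin n) (j : Fin m), adj i j ↔ c i j = a)
    (hbal : Balanced n m adj y size cap) (hx : RAM.PriceSpec n m a b adj y size cap x) :
    IsAllocation (fun (i : Fin n) (j : Fin m) => x i j) ∧
      EnvyFree c (fun (i : Fin n) (j : Fin m) => x i j) ∧
      FracParetoOptimal c (fun (i : Fin n) (j : Fin m) => x i j) := by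
  classical
  obtain ⟨K, E, W, e, S, ρ, w, r, low, hK, he, hS, hlow, hE, hρ, hW, hw, hr, hx⟩ := hx
  have hex : ∀ j : Fin m, (∃ i < n, adj i j) ↔ ∃ i, c i j = a := fun j =>
    ⟨fun ⟨i, hi, h⟩ => ⟨⟨i, hi⟩, (hadj ⟨i, hi⟩ j).1 h⟩, fun ⟨i, h⟩ => ⟨i, i.2, (hadj i j).2 h⟩⟩
  have hpos : ∀ i j, (y i j : ℝ) / size i ≠ 0 → 0 < y i j := fun i j h =>
    Nat.pos_of_ne_zero fun h0 => h (by simp [h0])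
  have hsz : ∀ i < n, (0 : ℝ) < size i := fun i hi => Nat.cast_pos.2 (hbal.size_pos i hi)
  refine equilibrium_of_balanced hn ha hab hc (fun i j => (y i j : ℝ) / size i)
    (fun i => e i) (fun i j => by positivity)
    (fun i j h => (hadj i j).1 (hbal.supp i i.2 j j.2 (hpos i j h))) (fun j hj => ?_) (fun i => ?_)
    (fun h i j hne hij => ?_) K ?_ (fun i => S i) (fun i => ?_) (fun i => low i)
    (fun i => hlow i i.2) E ?_ (fun i => ρ i) (fun i => by convert hρ i i.2) W ?_ (fun i => w i)
    (fun i => by convert hw i i.2) (fun j => r j) (fun j => ?_) (fun i j => hx i i.2 j j.2)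
  · obtain ⟨s, hs0, -, hsum, hs⟩ := hbal.col j j.2 ((hex j).2 hj)
    have hs0' : (s : ℝ) ≠ 0 := by exact_mod_cast hs0.ne'
    calc ∑ i : Fin n, (y i j : ℝ) / size i = ∑ i : Fin n, (y i j : ℝ) / s := by
          refine Finset.sum_congr rfl fun i _ => ?_
          rcases Nat.eq_zero_or_pos (y i j) with h | h
          · simp [h]
          · rw [hs i i.2 h]
      _ = (∑ i ∈ Finset.range n, (y i j : ℝ)) / s := by
          rw [← Finset.sum_div, Finset.sum_range]
      _ = 1 := by rw [← Nat.cast_sum, hsum, div_self hs0']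
  · rw [he i i.2, ← Finset.sum_div, ← hbal.load i i.2, Nat.cast_sum, Finset.sum_range]
  · rw [he h h.2, he i i.2, div_le_div_iff₀ (hsz h h.2) (hsz i i.2)]
    exact_mod_cast hbal.balanced h h.2 i i.2 j j.2 (hpos h j hne) ((hadj i j).2 hij)
  · rw [hK, Finset.sum_range]
    refine Finset.sum_congr rfl fun j _ => ?_
    simp only [hex]
  · rw [hS i i.2, Finset.sum_range]
  · rw [hE, Finset.sum_range]
  · rw [hW, Finset.sum_range]
  · rw [hr j j.2, Finset.sum_range]

end Chores

namespace RAM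

open Polynomial Chores

/-- Compute an envy-free and Pareto-optimal allocation of a bivalued instance. -/
noncomputable def fairProg : Timed := .seq extremesProg (.seq balanceProg priceProg)

/-- The program never sees the two values of the instance, only the least and the greatest cost.
These are the two values, or coincide if only one of them occurs. -/
theorem halts_fairProg {P : Prop} {n m L : ℕ} {c : Fin n → Fin m → ℝ} (hn : 0 < n)
    (hc : Bivalued c) (hL : n + m ≤ L) (hfit : ∀ i j, Fits P L (c i j)) :
    Runs (n + m) (Fits P (priceSize L)) fairProg (fun τ => IsAllocation (output n m τ) ∧
      EnvyFree c (output n m τ) ∧ FracParetoOptimal c (output n m τ)) (input c) := by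
  have hin : ∀ i (hi : i < n) j (hj : j < m), (input c).num 0 i j = c ⟨i, hi⟩ ⟨j, hj⟩ :=
    fun i hi j hj => by simp [input, hi, hj]
  have hnum : ∀ i j, Fits P L ((input c).num 0 i j) := by
    intro i j
    by_cases h : i < n ∧ j < m
    · rw [hin i h.1 j h.2]; exact hfit _ _
    · have : (input c).num 0 i j = ((0 : ℕ) : ℝ) := by simp [input, h]
      rw [this]; exact fits_natCast (Nat.zero_le _)
  have hLB : L ≤ priceSize L := by
    unfold priceSize
    calc L ≤ L + 1 := by omega
      _ ≤ (L + 1) ^ 3 := Nat.le_self_pow (by norm_num) _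
      _ ≤ _ := by omega
  have h00 : (input c).idx 0 0 0 = n := by simp [input]
  have h01 : (input c).idx 0 0 1 = m := by simp [input]
  refine runs_seq (halts_extremesProg h00 h01 hn (fun i j => (hnum i j).mono hLB) ?_)
  rintro τ₁ a₁ ⟨i₁, hi₁, j₁, hj₁, ea⟩ ⟨i₂, hi₂, j₂, hj₂, eb⟩ hle hadj
  refine runs_seq (halts_balanceProg (n := n) (m := m) (by simp [a₁.idx, h00])
    (by simp [a₁.idx, h01]) fun τ₂ a₂ hbal => ?_)
  have b4 : τ₂.idx 4 = τ₁.idx 4 := a₂.idx 4 (by simp)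
  rw [← b4] at hbal
  refine halts_priceProg (a := τ₁.num 3 0 0) (b := τ₁.num 5 0 0) (n := n) (m := m) (L := L)
    (by simp [a₂.idx, a₁.idx, h00])
    (by simp [a₂.idx, a₁.idx, h01]) hn hL (by simp [a₂.num])
    (by simp [a₂.num]) (by rw [ea]; exact hnum _ _) (by rw [eb]; exact hnum _ _) hbal
    fun τ hτ => ?_
  -- Without chores the extremes are read from empty cells and may fail to be positive, but every
  -- allocation is a solution.
  rcases Nat.eq_zero_or_pos m with rfl | hm
  · exact ⟨⟨fun _ j => j.elim0, fun j => j.elim0⟩, fun _ _ => by simp [bundleCost],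
      fun _ _ h => by simp [Dominates, bundleCost] at h⟩
  rw [b4] at hbal hτ
  obtain ⟨α, β, hα, hβ, hαβ⟩ := hc
  replace hj₁ : j₁ < m := by omega
  replace hj₂ : j₂ < m := by omega
  rw [hin i₁ hi₁ j₁ hj₁] at ea
  rw [hin i₂ hi₂ j₂ hj₂] at eb
  have hle' : ∀ i j, τ₁.num 3 0 0 ≤ c i j ∧ c i j ≤ τ₁.num 5 0 0 := fun i j => by
    have := hle i i.2 j j.2
    rwa [hin i i.2 j j.2] at this
  have hpos : ∀ i j, 0 < c i j := fun i j => by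
    rcases hαβ i j with h | h <;> rw [h] <;> assumption
  refine PriceSpec.solution hn (ea ▸ hpos _ _) ((hle' ⟨i₁, hi₁⟩ ⟨j₁, hj₁⟩).1.trans (hle' _ _).2)
    (fun i j => ?_) (fun i j => ?_) hbal hτ
  · obtain ⟨l1, l2⟩ := hle' i j
    rw [ea] at l1 ⊢
    rw [eb] at l2 ⊢
    rcases hαβ i j with h | h <;> rcases hαβ ⟨i₁, hi₁⟩ ⟨j₁, hj₁⟩ with h' | h' <;>
      rcases hαβ ⟨i₂, hi₂⟩ ⟨j₂, hj₂⟩ with h'' | h'' <;>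
      (rw [h, h'] at l1; rw [h, h''] at l2; rw [h, h', h'']) <;>
      first | exact Or.inl rfl | exact Or.inr rfl | exact Or.inl (le_antisymm l2 l1)
  · rw [hadj i i.2 j j.2, hin i i.2 j j.2]
    exact ⟨fun h => le_antisymm h (hle' i j).1, fun h => h.le⟩

end RAM

theorem theorem2 :
    RAM.StronglyPolynomial
      (fun {n m : ℕ} (c : Fin n → Fin m → ℝ) => 0 < n ∧ Chores.Bivalued c)
      (fun {n m : ℕ} (c x : Fin n → Fin m → ℝ) =>
        Chores.IsAllocation x ∧ Chores.EnvyFree c x ∧ Chores.FracParetoOptimal c x) := by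
  classical
  refine ⟨RAM.fairProg.prog, RAM.fairProg.time, 2 * (100 * (Polynomial.X + 1) ^ 3) + 3, ?_⟩
  rintro n m c ⟨hn, hc⟩
  set IsRat : Prop := ∃ q : Fin n → Fin m → ℚ, ∀ i j, c i j = (q i j : ℝ) with hIsRat
  -- One size parameter for both cases: `Fits IsRat` says nothing about irrational input, so a
  -- single run covers real and rational matrices.
  set L : ℕ := n + m + if h : IsRat then RAM.totalBitSize h.choose else 0 with hL
  have hfit : ∀ i j, RAM.Fits IsRat L (c i j) := by
    intro i j h
    refine RAM.fits_of_bitSize (P := IsRat) (h.choose_spec i j) ?_ h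
    rw [hL, dif_pos h]
    have h1 : RAM.bitSize (h.choose i j) ≤ ∑ j, RAM.bitSize (h.choose i j) :=
      Finset.single_le_sum (f := fun j => RAM.bitSize (h.choose i j)) (fun _ _ => Nat.zero_le _)
        (Finset.mem_univ j)
    have h2 : ∑ j, RAM.bitSize (h.choose i j) ≤ RAM.totalBitSize h.choose :=
      Finset.single_le_sum (f := fun i => ∑ j, RAM.bitSize (h.choose i j))
        (fun _ _ => Nat.zero_le _) (Finset.mem_univ i)
    omega
  obtain ⟨t, τ, ht, hsol, hrun⟩ := RAM.halts_fairProg hn hc (L := L) (by omega) hfit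
  refine ⟨t, τ, hrun.mono fun _ _ => trivial, ht, hsol, fun q hq => hrun.mono fun v hv => ?_⟩
  have hP : IsRat := ⟨q, hq⟩
  have hLq : L = n + m + RAM.totalBitSize q := by
    -- A rational matrix is determined by its real entries, so the chosen witness is the given one.
    have : hP.choose = q := by
      funext i j
      exact Rat.cast_injective (α := ℝ) ((hP.choose_spec i j).symm.trans (hq i j))
    rw [hL, dif_pos hP, this]
  obtain ⟨r, hr, hs⟩ := hv.exists_rat hP
  refine ⟨r, hr, hs.trans (le_of_eq ?_)⟩
  simp [RAM.priceSize, hLq]
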